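/- **Setting.** Let $d\in\{1,2,3\}$, $T>0$, and let $\Omega\subset\mathbb R^d$ be a polytopal domain with Lipschitz boundary and outward unit normal $\mathbf n$. Let $\mathbf a\in L^\infty(0,T;W^{1,\infty}(\Omega)^d)$ with $\nabla\cdot\mathbf a=0$, let $\Gamma_-=\Gamma_-(t)=\{\mathbf x\in\partial\Omega:\ \mathbf a(t,\mathbf x)\cdot\mathbf n(\mathbf x)<0\}$, and let $u^{\rm in}\in L^2(0,T;C(\overline{\Gamma_-}))$ and $u_0\in C(\overline\Omega)$. For $h>0$ let $\mathcal K_h$ be a simplicial triangulation of $\Omega$ without hanging nodes, with cells of diameter at most $h$ and vertices $\mathbf x_1,\dots,\mathbf x_N$; let $V_h$ be the space of continuous functions on $\overline\Omega$ that are affine on each cell, with Lagrange basis $(\varphi_i)$, and write $v_i=v_h(\mathbf x_i)$ for $v_h\in V_h$. Put $$a(u,w)=\int_\Omega w\,\mathbf a\cdot\nabla u\,d\mathbf x-\int_{\Gamma_-}wu\,\mathbf a\cdot\mathbf n\,d\sigma,\qquad b(w)=-\int_{\Gamma_-}w\,u^{\rm in}\,\mathbf a\cdot\mathbf n\,d\sigma,$$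 $m_{ij}=\int_\Omega\varphi_i\varphi_j\,d\mathbf x$, $m_i=\sum_jm_{ij}$, $\mathcal N_i=\{j:m_{ij}\ne0\}$, $a_{ij}=a(\varphi_j,\varphi_i)$, $b_i=b(\varphi_i)$, and $d_{ij}=\max\{|a_{ij}|,|a_{ji}|\}$ for $i\neq j$. For symmetric correction factors $\alpha_{ij}=\alpha_{ji}\in[0,1]$ and $\beta_{ij}=\beta_{ji}\in[0,1]$ (which may depend on $t$ and on the solution) put $$d_h(w,z)=\sum_iz_i\sum_{j\in\mathcal N_i\setminus\{i\}}(1-\alpha_{ij})d_{ij}(w_i-w_j),\qquad m_h(w,z)=\sum_iz_i\sum_{j\in\mathcal N_i\setminus\{i\}}\beta_{ij}m_{ij}(w_i-w_j).$$ Given an approximate time derivative $\dot u_h(t)\in V_h$, the semi-discrete flux-corrected scheme on $[0,\tau)$ is: find $u_h:[0,\tau)\to V_h$, continuous, locally absolutely continuous on $(0,\tau)$, with $u_i(0)=u_0(\mathbf x_i)$ for all $i$ and, for almost every $t\in(0,\tau)$, $$\sum_iw_im_i\frac{du_i}{dt}+a(u_h,w_h)+d_h(u_h,w_h)=b(w_h)+m_h(\dot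 u_h,w_h)\qquad\forall w_h\in V_h.$$ The generalized coercivity condition (GCC) with $\gamma\in(0,1)$ is $$\frac{\gamma h}{\lambda}\,m_h(\dot u_h,\dot u_h)\le(1-\gamma)\,d_h(u_h,u_h)-m_h(\dot u_h,u_h)\quad\text{for a.e. }t,$$ where $\lambda$ is the maximum velocity $\|\mathbf a\|_{L^\infty((0,T)\times\Omega)}$ (the left side is read as $0$ if $\lambda=0$). In *monolithic convex limiting* (MCL), $\beta=\alpha$ and $\alpha_{ij}f_{ij}=f_{ij}^*$ for all $i$ and $j\in\mathcal N_i\setminus\{i\}$, where $f_{ij}=d_{ij}(u_i-u_j)+m_{ij}(\dot u_i-\dot u_j)$, $\bar u_{ij}=\frac{u_i+u_j}2-\frac{a_{ij}(u_j-u_i)}{2d_{ij}}$ (if $d_{ij}=0$, the products $d_{ij}\bar u_{ij}$ below are $0$), $$f_{ij}^*=\begin{cases}\min\{f_{ij},\,2d_{ij}(u_i^{\max}-\bar u_{ij}),\,2d_{ij}(\bar u_{ji}-u_j^{\min})\}&\text{if }f_{ij}\ge0,\\ \max\{f_{ij},\,2d_{ij}(u_i^{\min}-\bar u_{ij}),\,2d_{ij}(\bar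 u_{ji}-u_j^{\max})\}&\text{if }f_{ij}<0,\end{cases}$$ and $u_i^{\min}$, $u_i^{\max}$ are the infimum and supremum of the values $u_j$, $j\in\mathcal N_i$, together with the values of $u^{\rm in}$ on $\{\mathbf x\in\Gamma_-:\varphi_i(\mathbf x)\ne0\}$. **Theorem.** There is a constant $C$ that depends only on $T$, $\mathbf a$, $u^{\rm in}$, $u_0$ (and the domain $\Omega$), but not on $h$, the triangulation, $\gamma$, the correction factors or $\dot u_h$, such that the following holds. 1. (Stability.) Let $0<\tau\le T$, and let $u_h$ be a solution on $[0,\tau)$ of the flux-corrected scheme, with any approximate time derivative $\dot u_h$ and any symmetric correction factors with values in $[0,1]$ (in particular, those of MCL). If GCC holds on $(0,\tau)$ for $u_h$ and $\dot u_h$ with some $\gamma\in(0,1)$, then $\|u_h(t)\|_{L^2(\Omega)}\le C$ for all $t\in[0,\tau)$. For $\tau=T$ this gives $\|u_h\|_{L^\infty(0,T;L^2(\Omega))}\le C$. 2. (Global existence.) For every $\omega\in[0,1]$, the MCL scheme with $$\dot u_i=\frac1{m_i}\Big(b_i-\sum_{j\in\mathcal N_i}a_{ij}u_j\Big)+\frac{\omega}{m_i}\sum_{j\in\mathcal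 N_i\setminus\{i\}}d_{ij}(u_j-u_i)$$ has a solution on the whole interval $[0,T)$. -/

import Mathlib

open MeasureTheory Set
open scoped NNReal ENNReal RealInnerProductSpace

noncomputable section

namespace AFC

/-- The Euclidean space `ℝ^d`. -/
abbrev E (d : ℕ) : Type := EuclideanSpace ℝ (Fin d)

/-! ### The domain, its boundary and the inlet -/

/-- The boundary of `Ω` is locally the graph of a Lipschitz function over a hyperplane with unit
normal `e`, with `Ω` on one side of it; `g` is the graph function, extended to be constant in the
direction `e`. -/
def HasLipschitzBoundary {d : ℕ} (Ω : Set (E d)) : Prop :=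
  ∀ x ∈ frontier Ω, ∃ (r : ℝ) (e : E d) (L : ℝ≥0) (g : E d → ℝ), 0 < r ∧ ‖e‖ = 1 ∧
    LipschitzWith L g ∧ (∀ (y : E d) (s : ℝ), g (y + s • e) = g y) ∧
    ∀ y ∈ Metric.ball x r, (y ∈ Ω ↔ ⟪e, y⟫ < g y)

/-- A polytopal domain with Lipschitz boundary. -/
structure IsPolytopalDomain {d : ℕ} (Ω : Set (E d)) : Prop where
  isOpen : IsOpen Ω
  isConnected : IsConnected Ω
  polytopal : ∃ S : Finset (Finset (E d)), closure Ω = ⋃ P ∈ S, convexHull ℝ (P : Set (E d))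
  lipschitz : HasLipschitzBoundary Ω

/-- `n` is the outward unit normal to `∂Ω` at a point `x` in the relative interior of a flat piece
of the boundary: near `x` the set `Ω` is the half-space `{y | ⟪y - x, n⟫ < 0}`. -/
def IsOutwardNormal {d : ℕ} (Ω : Set (E d)) (x n : E d) : Prop :=
  x ∈ frontier Ω ∧ ‖n‖ = 1 ∧ ∃ r > 0, ∀ y ∈ Metric.ball x r, (y ∈ Ω ↔ ⟪y - x, n⟫ < 0)

open Classical in
/-- The outward unit normal field on `∂Ω`. On a polytopal domain it is defined up to the
lower-dimensional edges, where the value `0` is used. -/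
def outwardNormal {d : ℕ} (Ω : Set (E d)) (x : E d) : E d :=
  if hx : ∃ n, IsOutwardNormal Ω x n then hx.choose else 0

/-- The surface measure on `∂Ω` : the `(d-1)`-dimensional Hausdorff measure, normalized to agree
with Lebesgue measure on hyperplanes. -/
def surface {d : ℕ} (Ω : Set (E d)) : Measure (E d) :=
  (Measure.euclideanHausdorffMeasure (d - 1)).restrict (frontier Ω)

/-- The inlet `Γ₋ = {x ∈ ∂Ω | b(x) ⬝ n(x) < 0}` of a velocity `b`. -/
def inlet {d : ℕ} (Ω : Set (E d)) (b : E d → E d) : Set (E d) :=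
  {x | x ∈ frontier Ω ∧ ⟪b x, outwardNormal Ω x⟫ < 0}

/-! ### The data -/

/-- `G` is the weak derivative of the vector field `b` in `Ω`. -/
def HasWeakDeriv {d : ℕ} (Ω : Set (E d)) (b : E d → E d) (G : E d → E d →L[ℝ] E d) : Prop :=
  ∀ ψ : E d → ℝ, ContDiff ℝ ((⊤ : ℕ∞) : WithTop ℕ∞) ψ → HasCompactSupport ψ → tsupport ψ ⊆ Ω → ∀ e : E d,
    ∫ x in Ω, fderiv ℝ ψ x e • b x = - ∫ x in Ω, ψ x • G x e

/-- The field `b` is (the representative that is continuous up to the boundary of) a solenoidal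
element of `W^{1,∞}(Ω)^d`, and `b` and its weak derivative are bounded by `M`. -/
def IsSolenoidalW1Inf {d : ℕ} (Ω : Set (E d)) (M : ℝ) (b : E d → E d) : Prop :=
  ContinuousOn b (closure Ω) ∧ (∀ x ∈ closure Ω, ‖b x‖ ≤ M) ∧
  ∃ G : E d → E d →L[ℝ] E d, AEStronglyMeasurable G (volume.restrict Ω) ∧
    (∀ᵐ x ∂(volume.restrict Ω), ‖G x‖ ≤ M) ∧ HasWeakDeriv Ω b G ∧
    ∀ᵐ x ∂(volume.restrict Ω), LinearMap.trace ℝ (E d) (G x : E d →ₗ[ℝ] E d) = 0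

/-- The velocity `a ∈ L^∞(0,T;W^{1,∞}(Ω)^d)` with `∇ ⬝ a = 0`. -/
def IsVelocity {d : ℕ} (Ω : Set (E d)) (T : ℝ) (a : ℝ → E d → E d) : Prop :=
  (∀ x ∈ closure Ω, AEMeasurable (fun t => a t x) (volume.restrict (Ioo 0 T))) ∧
  ∃ M : ℝ, ∀ᵐ t ∂(volume.restrict (Ioo 0 T)), IsSolenoidalW1Inf Ω M (a t)

/-- The inflow data `u_in ∈ L²(0,T;C(closure Γ₋))`; here `Γ₋ = Γ₋(t)` may depend on time, and `B`
is a square integrable bound of the maximum norm. -/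
def IsInflowData {d : ℕ} (Ω : Set (E d)) (T : ℝ) (a : ℝ → E d → E d) (uin : ℝ → E d → ℝ) : Prop :=
  (∀ x ∈ frontier Ω, AEMeasurable (fun t => uin t x)
    (volume.restrict {t | t ∈ Ioo 0 T ∧ x ∈ inlet Ω (a t)})) ∧
  ∃ B : ℝ → ℝ, MemLp B 2 (volume.restrict (Ioo 0 T)) ∧
    ∀ᵐ t ∂(volume.restrict (Ioo 0 T)), ContinuousOn (uin t) (closure (inlet Ω (a t))) ∧
      ∀ x ∈ closure (inlet Ω (a t)), |uin t x| ≤ B t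

/-- The maximum velocity `λ`, the `L^∞` norm of `a`. -/
def maxSpeed {d : ℕ} (Ω : Set (E d)) (T : ℝ) (a : ℝ → E d → E d) : ℝ :=
  (eLpNorm (fun p : ℝ × E d => a p.1 p.2) ∞ (volume.restrict (Ioo 0 T ×ˢ Ω))).toReal

/-! ### The forms of the Galerkin method, at a fixed time -/

/-- `a(v,w) = ∫_Ω w ∇⬝(b v) - ∫_{Γ₋} w v b⬝n` for a velocity `b` with `∇ ⬝ b = 0`, for which
`∇⬝(b v) = b ⬝ ∇v`. -/
def aForm {d : ℕ} (Ω : Set (E d)) (b : E d → E d) (v w : E d → ℝ) : ℝ :=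
  (∫ x in Ω, w x * ⟪b x, gradient v x⟫)
    - ∫ x in inlet Ω b, w x * v x * ⟪b x, outwardNormal Ω x⟫ ∂(surface Ω)

/-- `b(w) = - ∫_{Γ₋} w u_in b⬝n`, for the inflow data `g`. -/
def bForm {d : ℕ} (Ω : Set (E d)) (b : E d → E d) (g : E d → ℝ) (w : E d → ℝ) : ℝ :=
  - ∫ x in inlet Ω b, w x * g x * ⟪b x, outwardNormal Ω x⟫ ∂(surface Ω)

/-! ### Triangulations and `P₁` finite elements -/

/-- A simplicial triangulation of `Ω` without hanging nodes; a cell is given by its vertices. -/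
structure Triangulation {d : ℕ} (Ω : Set (E d)) where
  cells : Finset (Finset (E d))
  card_cell : ∀ K ∈ cells, K.card = d + 1
  indep : ∀ K ∈ cells, AffineIndependent ℝ ((↑) : K → E d)
  cover : ⋃ K ∈ cells, convexHull ℝ (K : Set (E d)) = closure Ω
  conforming : ∀ K ∈ cells, ∀ L ∈ cells,
    convexHull ℝ (K : Set (E d)) ∩ convexHull ℝ (L : Set (E d)) = convexHull ℝ (K ∩ L : Set (E d))

/-- Barycentric coordinates with respect to a non-degenerate simplex. -/
def cellBasis {d : ℕ} (K : Finset (E d)) (hK : AffineIndependent ℝ ((↑) : K → E d))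
    (hc : K.card = d + 1) : AffineBasis K ℝ (E d) where
  toFun := (↑)
  ind' := hK
  tot' := hK.affineSpan_eq_top_iff_card_eq_finrank_add_one.2 (by simpa using hc)

namespace Triangulation

variable {d : ℕ} {Ω : Set (E d)} (𝒯 : Triangulation Ω)

open Classical in
/-- The set of mesh vertices. -/
def vertices : Finset (E d) := 𝒯.cells.biUnion id

/-- The mesh vertices `x_i`, used as the index set of the degrees of freedom. -/
abbrev Node : Type := {p : E d // p ∈ 𝒯.vertices}

open Classical in
/-- The Lagrange basis function `φ_i` : on every cell it is the barycentric coordinate that belongs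
to the vertex `x_i`, and it vanishes on the cells that do not contain `x_i`. -/
def hat (i : 𝒯.Node) (x : E d) : ℝ :=
  if hx : ∃ K : Finset (E d), K ∈ 𝒯.cells ∧ x ∈ convexHull ℝ (K : Set (E d)) then
    if hi : (i : E d) ∈ hx.choose then
      (cellBasis hx.choose (𝒯.indep _ hx.choose_spec.1)
        (𝒯.card_cell _ hx.choose_spec.1)).coord ⟨i, hi⟩ x
    else 0
  else 0

/-- The finite element function `v_h = ∑ v_i φ_i` with nodal values `v`; these functions are the
space `V_h`. -/
def fe (v : 𝒯.Node → ℝ) (x : E d) : ℝ := ∑ i, v i * 𝒯.hat i x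

/-! ### Galerkin and diffusion matrices, at a fixed time -/

/-- The mass matrix `m_ij`. -/
def mass (i j : 𝒯.Node) : ℝ := ∫ x in Ω, 𝒯.hat i x * 𝒯.hat j x

/-- The lumped mass `m_i`. -/
def lumped (i : 𝒯.Node) : ℝ := ∑ j, 𝒯.mass i j

open Classical in
/-- The nodal stencil `N_i`. -/
def stencil (i : 𝒯.Node) : Finset 𝒯.Node := Finset.univ.filter (fun j => 𝒯.mass i j ≠ 0)

open Classical in
/-- The punctured stencil `N_i ∖ {i}`. -/
def stencil' (i : 𝒯.Node) : Finset 𝒯.Node := (𝒯.stencil i).erase i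

/-- The advection matrix `a_ij`. -/
def aMat (b : E d → E d) (i j : 𝒯.Node) : ℝ := aForm Ω b (𝒯.hat j) (𝒯.hat i)

/-- The inflow vector `b_i`. -/
def bVec (b : E d → E d) (g : E d → ℝ) (i : 𝒯.Node) : ℝ := bForm Ω b g (𝒯.hat i)

open Classical in
/-- The artificial diffusion matrix `d_ij`. -/
def dMat (b : E d → E d) (i j : 𝒯.Node) : ℝ :=
  if i = j then - ∑ k ∈ 𝒯.stencil' i, max |𝒯.aMat b i k| |𝒯.aMat b k i|
  else max |𝒯.aMat b i j| |𝒯.aMat b j i|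

/-! ### Algebraic flux correction -/

/-- `d_h(·; w, z) = ∑_i z_i ∑_{j ∈ N_i ∖ {i}} (1 - α_ij) d_ij (w_i - w_j)`. -/
def dForm (b : E d → E d) (α : 𝒯.Node → 𝒯.Node → ℝ) (w z : 𝒯.Node → ℝ) : ℝ :=
  ∑ i, z i * ∑ j ∈ 𝒯.stencil' i, (1 - α i j) * 𝒯.dMat b i j * (w i - w j)

/-- `m_h(·; w, z) = ∑_i z_i ∑_{j ∈ N_i ∖ {i}} β_ij m_ij (w_i - w_j)`. -/
def mForm (β : 𝒯.Node → 𝒯.Node → ℝ) (w z : 𝒯.Node → ℝ) : ℝ :=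
  ∑ i, z i * ∑ j ∈ 𝒯.stencil' i, β i j * 𝒯.mass i j * (w i - w j)

/-- Correction factors: symmetric, with values in `[0,1]`. -/
def IsCorrection (α : 𝒯.Node → 𝒯.Node → ℝ) : Prop :=
  ∀ i j, α i j = α j i ∧ 0 ≤ α i j ∧ α i j ≤ 1

/-- The part `Γ_i⁻` of the inlet on which the trace of `φ_i` is supported. -/
def inletAt (b : E d → E d) (i : 𝒯.Node) : Set (E d) := {x | x ∈ inlet Ω b ∧ 𝒯.hat i x ≠ 0}

/-- The values that enter the local bounds: `u_j` for `j ∈ N_i`, and `u_in` on `Γ_i⁻`. -/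
def localValues (b : E d → E d) (g : E d → ℝ) (v : 𝒯.Node → ℝ) (i : 𝒯.Node) : Set ℝ :=
  v '' {j | j ∈ 𝒯.stencil i} ∪ g '' 𝒯.inletAt b i

/-- The local lower bound `u_i^min`. -/
def uMin (b : E d → E d) (g : E d → ℝ) (v : 𝒯.Node → ℝ) (i : 𝒯.Node) : ℝ :=
  sInf (𝒯.localValues b g v i)

/-- The local upper bound `u_i^max`. -/
def uMax (b : E d → E d) (g : E d → ℝ) (v : 𝒯.Node → ℝ) (i : 𝒯.Node) : ℝ :=
  sSup (𝒯.localValues b g v i)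

/-- The bar state. If `d_ij = 0`, its value is irrelevant: it only enters through `d_ij` times it. -/
def barState (b : E d → E d) (v : 𝒯.Node → ℝ) (i j : 𝒯.Node) : ℝ :=
  (v i + v j) / 2 - 𝒯.aMat b i j * (v j - v i) / (2 * 𝒯.dMat b i j)

/-- The target flux `f_ij = d_ij (u_i - u_j) + m_ij (u̇_i - u̇_j)`; `v'` stands for `u̇`. -/
def flux (b : E d → E d) (v v' : 𝒯.Node → ℝ) (i j : 𝒯.Node) : ℝ :=
  𝒯.dMat b i j * (v i - v j) + 𝒯.mass i j * (v' i - v' j)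

open Classical in
/-- The flux `f_ij^*` of monolithic convex limiting. -/
def mclFlux (b : E d → E d) (g : E d → ℝ) (v v' : 𝒯.Node → ℝ) (i j : 𝒯.Node) : ℝ :=
  if 0 ≤ 𝒯.flux b v v' i j then
    min (𝒯.flux b v v' i j)
      (min (2 * 𝒯.dMat b i j * (𝒯.uMax b g v i - 𝒯.barState b v i j))
        (2 * 𝒯.dMat b i j * (𝒯.barState b v j i - 𝒯.uMin b g v j)))
  else
    max (𝒯.flux b v v' i j)
      (max (2 * 𝒯.dMat b i j * (𝒯.uMin b g v i - 𝒯.barState b v i j))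
        (2 * 𝒯.dMat b i j * (𝒯.barState b v j i - 𝒯.uMax b g v j)))

/-- Correction factors of monolithic convex limiting: `f_ij^* = α_ij f_ij`. They are determined by
this wherever `f_ij ≠ 0`. -/
def IsMCL (b : E d → E d) (g : E d → ℝ) (v v' : 𝒯.Node → ℝ) (α : 𝒯.Node → 𝒯.Node → ℝ) : Prop :=
  𝒯.IsCorrection α ∧
    ∀ i, ∀ j ∈ 𝒯.stencil' i, 𝒯.mclFlux b g v v' i j = α i j * 𝒯.flux b v v' i j

/-- The approximate time derivative `u̇ = u̇^A + u̇^D`, with the amount `ω` of high order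
stabilization. -/
def rate (ω : ℝ) (b : E d → E d) (g : E d → ℝ) (v : 𝒯.Node → ℝ) (i : 𝒯.Node) : ℝ :=
  1 / 𝒯.lumped i * (𝒯.bVec b g i - ∑ j ∈ 𝒯.stencil i, 𝒯.aMat b i j * v j)
    + ω / 𝒯.lumped i * ∑ j ∈ 𝒯.stencil' i, 𝒯.dMat b i j * (v j - v i)

/-- `u` is a solution on `[0,τ)` of the semi-discrete scheme
`∑ w_i m_i du_i/dt + a(u_h,w_h) + d_h(u_h;u_h,w_h) = b(w_h) + m_h(u_h;u̇_h,w_h)` for all `w_h ∈ V_h`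
with `u_h(0) = I_h u₀`. Here `α(t)` are the correction factors in `d_h`, `β(t)` those in `m_h`, and
`u'` is the approximate time derivative `u̇`. As the data are not continuous in time, a solution is
locally absolutely continuous and the equation holds at almost every time. -/
structure IsSolution (a : ℝ → E d → E d) (uin : ℝ → E d → ℝ) (u0 : E d → ℝ) (τ : ℝ)
    (α β : ℝ → 𝒯.Node → 𝒯.Node → ℝ) (u' u : ℝ → 𝒯.Node → ℝ) : Prop where
  continuousOn : ∀ i, ContinuousOn (fun t => u t i) (Ico 0 τ)
  absolutelyContinuous : ∀ i, ∀ s t : ℝ, 0 < s → s ≤ t → t < τ →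
    AbsolutelyContinuousOnInterval (fun r => u r i) s t
  initial : ∀ i : 𝒯.Node, u 0 i = u0 i
  weak : ∀ᵐ t ∂(volume.restrict (Ioo 0 τ)), ∀ w : 𝒯.Node → ℝ,
    ∑ i, w i * 𝒯.lumped i * deriv (fun s => u s i) t + aForm Ω (a t) (𝒯.fe (u t)) (𝒯.fe w)
        + 𝒯.dForm (a t) (α t) (u t) w
      = bForm Ω (a t) (uin t) (𝒯.fe w) + 𝒯.mForm (β t) (u' t) w

/-- The generalized coercivity condition
`(γ h / λ) m_h(u_h;u̇_h,u̇_h) ≤ (1 - γ) d_h(u_h;u_h,u_h) - m_h(u_h;u̇_h,u_h)`, at a fixed time. -/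
def GCC (γ h lam : ℝ) (b : E d → E d) (α β : 𝒯.Node → 𝒯.Node → ℝ) (v' v : 𝒯.Node → ℝ) : Prop :=
  γ * h / lam * 𝒯.mForm β v' v' ≤ (1 - γ) * 𝒯.dForm b α v v - 𝒯.mForm β v' v

end Triangulation

end AFC

end

/-! Stability is an energy argument. Testing the scheme with `w = u` turns the time derivative into
half the derivative of `∑ m_i u_i²`. For a solenoidal velocity, `∫ v b⬝∇v` is half the boundary
integral of `v² b⬝n`; dropping the outflow part gives `inlet_le_advection`, and completing a square
against the inflow values leaves at most the speed bound times the surface area times `B(t)²`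
(`inflow_sub_advection_le`). Since `d_h(u,u)` and `m_h(u̇,u̇)` are nonnegative, the coercivity
condition yields `m_h(u̇,u) ≤ d_h(u,u)` (`GCC.mForm_le`), so the correction as a whole dissipates.
Integration in time bounds the lumped norm (`energy_le`), which dominates the `L²` norm by Jensen's
inequality (`integral_sq_fe_le`). All constants come from the data, none from the mesh.

The integration by parts has to match a weakly differentiable velocity with Hausdorff measure on the
boundary. On one simplex the weak divergence condition is tested with a smooth function times a
cut-off built from barycentric coordinates divided by `ε`. As `ε → 0` the derivative of the cut-off
concentrates on the faces (`IsSimplex.tendsto_integral_strip`, `IsSimplex.integral_divergence`). In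
the sum over the cells the normals cancel on interior faces and leave the outward normal on `∂Ω`
(`sum_faceNormal`).

Existence needs neither the coercivity condition nor the energy estimate. The bar states lie between
the local bounds, so zero is always an admissible flux and the limited flux is the target flux
clamped to an interval around zero (`mclFlux_eq_clamp`). The ends of this interval are maxima and
minima of functions that are Lipschitz in the nodal values, because the products `d_ij ū_ij` contain
no division. The limited scheme is therefore an ODE with a right-hand side that is globally
Lipschitz in the state, uniformly in time, and integrable in time. Measurability in time needs care
because the inlet moves: integrals over it are rewritten over a fixed set (`setIntegral_inlet`) and
suprema over it are reduced to countable ones (`uMax_eq_iSup`). Picard iteration then gives a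
solution on all of `[0,T]` (`exists_caratheodory_solution`), and the correction factors are
recovered afterwards as quotients of fluxes (`isMCL_mclFactor`). -/

noncomputable section

namespace AFC

open Filter Topology

/-! ### Barycentric coordinates of a simplex given by its vertices -/

/-- The vertex sets of non-degenerate `d`-simplices. -/
structure IsSimplex {d : ℕ} (K : Finset (E d)) : Prop where
  card : K.card = d + 1
  indep : AffineIndependent ℝ ((↑) : K → E d)

open Classical in
/-- The barycentric coordinate of the simplex `K` for the vertex `p`; it is zero if `p` is not a
vertex of `K`. -/
def bary {d : ℕ} (K : Finset (E d)) (p : E d) : E d →ᵃ[ℝ] ℝ :=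
  if h : IsSimplex K ∧ p ∈ K then (cellBasis K h.1.indep h.1.card).coord ⟨p, h.2⟩ else 0

/-- The gradient of a barycentric coordinate. -/
def baryGrad {d : ℕ} (K : Finset (E d)) (p : E d) : E d :=
  (InnerProductSpace.toDual ℝ (E d)).symm (LinearMap.toContinuousLinearMap (bary K p).linear)

section Bary

variable {d : ℕ} {K : Finset (E d)}

lemma bary_of_notMem {p : E d} (hp : p ∉ K) : bary K p = 0 := by
  simp [bary, hp]

lemma IsSimplex.bary_eq (hK : IsSimplex K) {p : E d} (hp : p ∈ K) :
    bary K p = (cellBasis K hK.indep hK.card).coord ⟨p, hp⟩ := by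
  simp [bary, hp, hK]

lemma IsSimplex.sum_bary (hK : IsSimplex K) (x : E d) : ∑ p ∈ K, bary K p x = 1 := by
  rw [← Finset.sum_coe_sort, ← (cellBasis K hK.indep hK.card).sum_coord_apply_eq_one x]
  exact Finset.sum_congr rfl fun p _ => by rw [hK.bary_eq p.2]

lemma IsSimplex.bary_vertex [DecidableEq (E d)] (hK : IsSimplex K) {p q : E d} (hp : p ∈ K)
    (hq : q ∈ K) : bary K p q = if p = q then 1 else 0 := by
  rw [hK.bary_eq hp]
  have := (cellBasis K hK.indep hK.card).coord_apply ⟨p, hp⟩ ⟨q, hq⟩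
  rw [show (cellBasis K hK.indep hK.card) ⟨q, hq⟩ = q from rfl] at this
  rw [this]; simp

lemma affineMap_combination (f : E d →ᵃ[ℝ] ℝ) (s : Finset (E d)) (w : E d → ℝ)
    (hw : ∑ q ∈ s, w q = 1) : f (∑ q ∈ s, w q • q) = ∑ q ∈ s, w q * f q := by
  have h : ∀ x, f x = f.linear x + f 0 := fun x => congrFun f.decomp x
  have h2 : ∀ q ∈ s, w q * f q = w q * f.linear q + w q * f 0 := fun q _ => by
    rw [← mul_add, ← h]
  rw [h, map_sum, Finset.sum_congr rfl h2, Finset.sum_add_distrib, ← Finset.sum_mul, hw, one_mul]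
  simp

lemma IsSimplex.bary_combination (hK : IsSimplex K) (w : E d → ℝ)
    (hw : ∑ q ∈ K, w q = 1) {p : E d} (hp : p ∈ K) : bary K p (∑ q ∈ K, w q • q) = w p := by
  classical
  rw [affineMap_combination _ _ _ hw, Finset.sum_eq_single p]
  · simp [hK.bary_vertex hp hp]
  · intro q hq hqp
    simp [hK.bary_vertex hp hq, hqp.symm]
  · exact fun h => absurd hp h

lemma IsSimplex.mem_convexHull_iff (hK : IsSimplex K) {x : E d} :
    x ∈ convexHull ℝ (K : Set (E d)) ↔ ∀ p ∈ K, 0 ≤ bary K p x := by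
  have := (cellBasis K hK.indep hK.card).convexHull_eq_nonneg_coord
  have hr : range (cellBasis K hK.indep hK.card) = (K : Set (E d)) := by
    ext y; constructor
    · rintro ⟨q, rfl⟩; exact q.2
    · intro hy; exact ⟨⟨y, hy⟩, rfl⟩
  rw [hr] at this
  rw [this]
  constructor
  · intro h p hp; rw [hK.bary_eq hp]; exact h ⟨p, hp⟩
  · intro h p; rw [← hK.bary_eq p.2]; exact h p p.2

lemma bary_nonneg_of_mem (hK : IsSimplex K) {x : E d} (hx : x ∈ convexHull ℝ (K : Set (E d)))
    (p : E d) : 0 ≤ bary K p x := by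
  by_cases hp : p ∈ K
  · exact hK.mem_convexHull_iff.1 hx p hp
  · simp [bary_of_notMem hp]

lemma bary_sub (p x y : E d) : bary K p x - bary K p y = ⟪baryGrad K p, x - y⟫ := by
  rw [baryGrad, InnerProductSpace.toDual_symm_apply, LinearMap.coe_toContinuousLinearMap']
  simpa using ((bary K p).linearMap_vsub x y).symm

lemma bary_eq_inner (p x : E d) : bary K p x = ⟪baryGrad K p, x⟫ + bary K p 0 := by
  have := bary_sub (K := K) p x 0
  simp at this; linarith

lemma bary_add (p x v : E d) : bary K p (x + v) = bary K p x + ⟪baryGrad K p, v⟫ := by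
  have := bary_sub (K := K) p (x + v) x
  simp at this; linarith

lemma contDiff_bary (p : E d) {n : WithTop ℕ∞} : ContDiff ℝ n (bary K p) := by
  rw [show (bary K p : E d → ℝ) = fun x => ⟪baryGrad K p, x⟫ + bary K p 0 from
    funext (bary_eq_inner p)]
  exact (contDiff_const.inner ℝ contDiff_id).add contDiff_const

lemma continuous_bary (p : E d) : Continuous (bary K p) := (contDiff_bary (n := 0) p).continuous

lemma hasFDerivAt_bary (p x : E d) : HasFDerivAt (bary K p) (innerSL ℝ (baryGrad K p)) x := by
  rw [show (bary K p : E d → ℝ) = fun x => innerSL ℝ (baryGrad K p) x + bary K p 0 from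
    funext (bary_eq_inner p)]
  exact ((innerSL ℝ (baryGrad K p)).hasFDerivAt).add_const _

lemma IsSimplex.baryGrad_ne_zero (hK : IsSimplex K) (hd : d ≠ 0) {p : E d} (hp : p ∈ K) :
    baryGrad K p ≠ 0 := by
  classical
  intro h0
  obtain ⟨q, hq, hqp⟩ := Finset.exists_mem_ne (by rw [hK.card]; omega : 1 < K.card) p
  have h := bary_sub (K := K) p p q
  rw [h0, hK.bary_vertex hp hp, hK.bary_vertex hp hq] at h
  simp [hqp.symm] at h

/-! ### Open cells and open faces -/

/-- The interior of the simplex `K`. -/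
def openCell (K : Finset (E d)) : Set (E d) := {x | ∀ p ∈ K, 0 < bary K p x}

/-- The relative interior of the face of `K` opposite to the vertex `k`. -/
def openFace (K : Finset (E d)) (k : E d) : Set (E d) :=
  {x | bary K k x = 0 ∧ ∀ p ∈ K, p ≠ k → 0 < bary K p x}

/-- The outward unit normal of `K` on the face opposite to the vertex `k`. -/
def faceNormal (K : Finset (E d)) (k : E d) : E d := -(‖baryGrad K k‖⁻¹ • baryGrad K k)

lemma isOpen_openCell : IsOpen (openCell K) := by
  have : openCell K = ⋂ p ∈ K, {x | 0 < bary K p x} := by ext; simp [openCell]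
  rw [this]
  exact isOpen_biInter_finset fun p _ => isOpen_lt continuous_const (continuous_bary p)

lemma measurableSet_openFace (k : E d) : MeasurableSet (openFace K k) := by
  have : openFace K k = {x | bary K k x = 0} ∩ ⋂ p ∈ K, {x | p ≠ k → 0 < bary K p x} := by
    ext; simp [openFace]
  rw [this]
  refine (measurableSet_eq_fun (continuous_bary k).measurable measurable_const).inter
    (Finset.measurableSet_biInter _ fun p _ => ?_)
  by_cases h : p = k
  · simp [h]
  · simpa [h] using measurableSet_lt measurable_const (continuous_bary (K := K) p).measurable

lemma IsSimplex.openCell_subset (hK : IsSimplex K) : openCell K ⊆ convexHull ℝ (K : Set (E d)) :=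
  fun _ hx => hK.mem_convexHull_iff.2 fun p hp => (hx p hp).le

lemma IsSimplex.openFace_subset (hK : IsSimplex K) {k : E d} :
    openFace K k ⊆ convexHull ℝ (K : Set (E d)) := by
  intro x hx
  refine hK.mem_convexHull_iff.2 fun p hp => ?_
  by_cases h : p = k
  · rw [h, hx.1]
  · exact (hx.2 p hp h).le

lemma isCompact_simplex : IsCompact (convexHull ℝ (K : Set (E d))) :=
  K.finite_toSet.isCompact_convexHull ℝ

lemma IsSimplex.norm_faceNormal (hK : IsSimplex K) (hd : d ≠ 0) {k : E d} (hk : k ∈ K) :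
    ‖faceNormal K k‖ = 1 := by
  have := norm_ne_zero_iff.2 (hK.baryGrad_ne_zero hd hk)
  rw [faceNormal, norm_neg, norm_smul, norm_inv, norm_norm, inv_mul_cancel₀ this]

/-- Near a point of an open face the simplex is a half-space. -/
lemma IsSimplex.eventually_mem_iff (hK : IsSimplex K) (hd : d ≠ 0) {k x : E d} (hk : k ∈ K)
    (hx : x ∈ openFace K k) :
    ∀ᶠ y in 𝓝 x, (y ∈ convexHull ℝ (K : Set (E d)) ↔ ⟪y - x, faceNormal K k⟫ ≤ 0) ∧
      (y ∈ openCell K ↔ ⟪y - x, faceNormal K k⟫ < 0) := by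
  -- The other coordinates stay positive near `x`, so membership is decided by the sign of the
  -- coordinate of `k` alone.
  have h1 : ∀ᶠ y in 𝓝 x, ∀ p ∈ K, p ≠ k → 0 < bary K p y := by
    refine (Finset.eventually_all K).2 fun p hp => ?_
    by_cases h : p = k
    · simp [h]
    · filter_upwards [(continuous_bary (K := K) p).continuousAt.eventually
        (lt_mem_nhds (hx.2 p hp h))] with y hy _ using hy
  filter_upwards [h1] with y hy
  have hn : 0 < ‖baryGrad K k‖ := norm_pos_iff.2 (hK.baryGrad_ne_zero hd hk)
  have h2 : ⟪y - x, faceNormal K k⟫ = -(‖baryGrad K k‖⁻¹ * bary K k y) := by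
    have := bary_sub (K := K) k y x
    rw [hx.1, sub_zero] at this
    rw [this, faceNormal, inner_neg_right, inner_smul_right, real_inner_comm]
  rw [h2]
  constructor
  · rw [hK.mem_convexHull_iff]
    constructor
    · intro h
      have := h k hk
      simp only [Left.neg_nonpos_iff]; positivity
    · intro h p hp
      by_cases hpk : p = k
      · subst hpk
        by_contra! hneg
        have := mul_neg_of_pos_of_neg (inv_pos.2 hn) hneg
        linarith
      · exact (hy p hp hpk).le
  · constructor
    · intro h
      have := mul_pos (inv_pos.2 hn) (h k hk)
      linarith
    · intro h p hp
      by_cases hpk : p = k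
      · subst hpk
        have : 0 < ‖baryGrad K p‖⁻¹ * bary K p y := by linarith
        exact (pos_iff_pos_of_mul_pos this).1 (inv_pos.2 hn)
      · exact hy p hp hpk

/-- Barycentric hyperplanes are null sets. -/
lemma IsSimplex.volume_bary_eq_zero (hK : IsSimplex K) {p : E d} (hp : p ∈ K) :
    volume {x | bary K p x = 0} = 0 := by
  classical
  let s : AffineSubspace ℝ (E d) := AffineSubspace.comap (bary K p) (AffineSubspace.mk' 0 ⊥)
  have hs : {x | bary K p x = 0} = (s : Set (E d)) := by
    ext x; simp [s]
  rw [hs]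
  refine Measure.addHaar_affineSubspace _ _ fun htop => ?_
  have : p ∈ s := htop ▸ AffineSubspace.mem_top ℝ (E d) p
  have h2 : p ∈ {x | bary K p x = 0} := hs ▸ this
  simp [hK.bary_vertex hp hp] at h2

lemma IsSimplex.volume_diff_openCell (hK : IsSimplex K) :
    volume (convexHull ℝ (K : Set (E d)) \ openCell K) = 0 := by
  refine measure_mono_null (t := ⋃ p ∈ K, {x | bary K p x = 0}) ?_
    ((measure_biUnion_null_iff K.countable_toSet).2 fun p hp => hK.volume_bary_eq_zero hp)
  rintro x ⟨hx, hx'⟩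
  simp only [openCell, mem_ofPred_eq, not_forall, not_lt] at hx'
  obtain ⟨p, hp, h⟩ := hx'
  simp only [mem_iUnion]
  exact ⟨p, hp, le_antisymm h (hK.mem_convexHull_iff.1 hx p hp)⟩

end Bary

end AFC

end

noncomputable section

namespace AFC

open Filter Topology

/-! ### Integration along a direction and over hyperplanes -/

section Slices

variable {d : ℕ}

/-- Orthogonal coordinates with respect to a unit vector `n` and a base point `p`. -/
def sliceEquiv (p n : E d) (hn : ‖n‖ = 1) : ℝ × (ℝ ∙ n)ᗮ ≃ᵐ E d :=
  (MeasurableEquiv.prodCongr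
    (LinearIsometryEquiv.toSpanUnitSingleton (𝕜 := ℝ) n hn).toHomeomorph.toMeasurableEquiv
    (MeasurableEquiv.refl _)).trans ((ℝ ∙ n).measurableEquivProd p).symm

lemma sliceEquiv_apply (p n : E d) (hn : ‖n‖ = 1) (z : ℝ × (ℝ ∙ n)ᗮ) :
    sliceEquiv p n hn z = z.1 • n + z.2 + p := by
  simp only [sliceEquiv, MeasurableEquiv.trans_apply, Submodule.measurableEquivProd_symm_apply]
  rfl

lemma measurePreserving_sliceEquiv (p n : E d) (hn : ‖n‖ = 1) :
    MeasurePreserving (sliceEquiv p n hn) := by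
  have h1 := (LinearIsometryEquiv.toSpanUnitSingleton (𝕜 := ℝ) n hn).measurePreserving.prod
    (MeasurePreserving.id (volume : Measure (ℝ ∙ n)ᗮ))
  have h2 := ((ℝ ∙ n).measurePreserving_measurableEquivProd p).symm
  rw [InnerProductSpace.euclideanHausdorffMeasure_eq_volume] at h2
  exact h2.comp h1

/-- The normal coordinate is rescaled by `δ` so that a strip of width proportional to `δ` becomes a
fixed domain. This is the blow-up used along a face of a simplex. -/
lemma integral_slice (p n : E d) (hn : ‖n‖ = 1) (f : E d → ℝ) {δ : ℝ} (hδ : 0 < δ) :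
    ∫ x, f x = δ * ∫ z : ℝ × (ℝ ∙ n)ᗮ, f ((δ * z.1) • n + z.2 + p) := by
  rw [← (measurePreserving_sliceEquiv p n hn).integral_comp' f]
  simp_rw [sliceEquiv_apply]
  let e : ℝ × (ℝ ∙ n)ᗮ ≃ᵐ ℝ × (ℝ ∙ n)ᗮ :=
    MeasurableEquiv.prodCongr (Homeomorph.mulLeft₀ δ hδ.ne').toMeasurableEquiv
      (MeasurableEquiv.refl _)
  have he : Measure.map e volume = ENNReal.ofReal δ⁻¹ • volume := by
    rw [Measure.volume_eq_prod]
    have : (e : ℝ × (ℝ ∙ n)ᗮ → ℝ × (ℝ ∙ n)ᗮ) = Prod.map (fun x => δ * x) id := rfl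
    rw [this, ← Measure.map_prod_map _ _ (measurable_const_mul δ) measurable_id, Measure.map_id,
      Real.map_volume_mul_left hδ.ne', abs_of_pos (inv_pos.2 hδ), Measure.prod_smul_left]
  have h := e.measurableEmbedding.integral_map (μ := volume)
    (fun z : ℝ × (ℝ ∙ n)ᗮ => f (z.1 • n + z.2 + p))
  rw [he, integral_smul_measure, ENNReal.toReal_ofReal (inv_pos.2 hδ).le] at h
  have h' : ∫ z : ℝ × (ℝ ∙ n)ᗮ, f ((δ * z.1) • n + z.2 + p) =
      δ⁻¹ • ∫ z : ℝ × (ℝ ∙ n)ᗮ, f (z.1 • n + z.2 + p) := h.symm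
  rw [h', smul_eq_mul, mul_inv_cancel_left₀ hδ.ne']

/-- Isometries preserve Hausdorff measure, and in the normalization used for `surface` it is
Lebesgue measure on a space of dimension `d - 1`. Face integrals thus become ordinary integrals over
the hyperplane. -/
lemma map_hyperplane (hd : d ≠ 0) (p n : E d) (hn : ‖n‖ = 1) :
    Measure.map (fun y : (ℝ ∙ n)ᗮ => (y : E d) + p) volume =
      (Measure.euclideanHausdorffMeasure (d - 1)).restrict
        (range fun y : (ℝ ∙ n)ᗮ => (y : E d) + p) := by
  have hi : Isometry (fun y : (ℝ ∙ n)ᗮ => (y : E d) + p) :=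
    (IsometryEquiv.addRight p).isometry.comp isometry_subtype_coe
  have : Fact (Module.finrank ℝ (E d) = (d - 1) + 1) := ⟨by simp; omega⟩
  have hn0 : n ≠ 0 := by rintro rfl; simp at hn
  have hr : Module.finrank ℝ (ℝ ∙ n)ᗮ = d - 1 :=
    Submodule.finrank_orthogonal_span_singleton hn0
  rw [← hi.map_euclideanHausdorffMeasure, ← hr,
    InnerProductSpace.euclideanHausdorffMeasure_eq_volume]

lemma mem_range_hyperplane {p n : E d} {x : E d} (hx : ⟪n, x - p⟫ = 0) :
    x ∈ range fun y : (ℝ ∙ n)ᗮ => (y : E d) + p :=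
  ⟨⟨x - p, Submodule.mem_orthogonal_singleton_iff_inner_right.2 hx⟩, by simp⟩

lemma measurableEmbedding_hyperplane (p n : E d) :
    MeasurableEmbedding fun y : (ℝ ∙ n)ᗮ => (y : E d) + p := by
  refine ((Homeomorph.addRight p).measurableEmbedding).comp (MeasurableEmbedding.subtype_coe ?_)
  exact (Submodule.closed_of_finiteDimensional _).measurableSet

lemma setIntegral_hyperplane (hd : d ≠ 0) (p n : E d) (hn : ‖n‖ = 1) {F : Set (E d)}
    (hFm : MeasurableSet F) (hF : ∀ x ∈ F, ⟪n, x - p⟫ = 0) (f : E d → ℝ) :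
    ∫ x in F, f x ∂(Measure.euclideanHausdorffMeasure (d - 1)) =
      ∫ y : (ℝ ∙ n)ᗮ, F.indicator f (y + p) := by
  rw [← (measurableEmbedding_hyperplane p n).integral_map (μ := volume), map_hyperplane hd p n hn,
    setIntegral_indicator hFm,
    inter_eq_self_of_subset_right fun x hx => mem_range_hyperplane (hF x hx)]

/-- Bounded subsets of a hyperplane have finite surface measure. -/
lemma hausdorff_hyperplane_lt_top (hd : d ≠ 0) (p n : E d) (hn : ‖n‖ = 1) {F : Set (E d)}
    (hFb : Bornology.IsBounded F) (hF : ∀ x ∈ F, ⟪n, x - p⟫ = 0) :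
    (Measure.euclideanHausdorffMeasure (d - 1) : Measure (E d)) F < ∞ := by
  obtain ⟨R, hR⟩ := hFb.subset_closedBall p
  have hsub : F ⊆ Metric.closedBall p R ∩ range fun y : (ℝ ∙ n)ᗮ => (y : E d) + p :=
    fun x hx => ⟨hR hx, mem_range_hyperplane (hF x hx)⟩
  refine (measure_mono hsub).trans_lt ?_
  rw [← Measure.restrict_apply Metric.isClosed_closedBall.measurableSet, ← map_hyperplane hd p n hn,
    (measurableEmbedding_hyperplane p n).map_apply]
  refine lt_of_le_of_lt (measure_mono ?_)
    (measure_closedBall_lt_top (x := (0 : (ℝ ∙ n)ᗮ)) (r := R))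
  intro y hy
  simpa [dist_eq_norm] using hy

end Slices

/-! ### A smooth cut-off function on the line -/

/-- A smooth function that is `0` on `(-∞,1]` and `1` on `[2,∞)`. -/
def ramp (s : ℝ) : ℝ := Real.smoothTransition (s - 1)

lemma contDiff_ramp {n : ℕ∞} : ContDiff ℝ n ramp :=
  Real.smoothTransition.contDiff.comp (contDiff_id.sub contDiff_const)

lemma ramp_nonneg (s : ℝ) : 0 ≤ ramp s := Real.smoothTransition.nonneg _

lemma ramp_le_one (s : ℝ) : ramp s ≤ 1 := Real.smoothTransition.le_one _

lemma ramp_of_le {s : ℝ} (hs : s ≤ 1) : ramp s = 0 :=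
  Real.smoothTransition.zero_of_nonpos (by linarith)

lemma ramp_of_ge {s : ℝ} (hs : 2 ≤ s) : ramp s = 1 :=
  Real.smoothTransition.one_of_one_le (by linarith)

lemma hasDerivAt_ramp (s : ℝ) : HasDerivAt ramp (deriv ramp s) s :=
  ((contDiff_ramp (n := 1)).differentiable (by norm_num) s).hasDerivAt

lemma continuous_deriv_ramp : Continuous (deriv ramp) :=
  (contDiff_ramp (n := 1)).continuous_deriv (by norm_num)

/-- The value `0` is the global minimum of `ramp`, so the derivative vanishes at the end point `1`
as well. -/
lemma deriv_ramp_of_le {s : ℝ} (hs : s ≤ 1) : deriv ramp s = 0 := by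
  have h : IsLocalMin ramp s := by
    refine Filter.Eventually.of_forall fun y => ?_
    rw [ramp_of_le hs]; exact ramp_nonneg y
  exact h.deriv_eq_zero

lemma deriv_ramp_of_ge {s : ℝ} (hs : 2 ≤ s) : deriv ramp s = 0 := by
  have h : IsLocalMax ramp s := by
    refine Filter.Eventually.of_forall fun y => ?_
    rw [ramp_of_ge hs]; exact ramp_le_one y
  exact h.deriv_eq_zero

lemma hasCompactSupport_deriv_ramp : HasCompactSupport (deriv ramp) := by
  refine HasCompactSupport.intro (isCompact_Icc (a := (1 : ℝ)) (b := 2)) fun s hs => ?_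
  rcases not_and_or.1 hs with h | h
  · exact deriv_ramp_of_le (not_le.1 h).le
  · exact deriv_ramp_of_ge (not_le.1 h).le

/-- The total increase of `ramp` fixes the constant in front of the limiting face integral. -/
lemma integral_deriv_ramp : ∫ s, deriv ramp s = 1 := by
  rw [integral_of_hasDerivAt_of_tendsto (m := 0) (n := 1) hasDerivAt_ramp
    (continuous_deriv_ramp.integrable_of_hasCompactSupport hasCompactSupport_deriv_ramp)]
  · simp
  · refine tendsto_const_nhds.congr' ?_
    filter_upwards [eventually_le_atBot 1] with s hs using (ramp_of_le hs).symm
  · refine tendsto_const_nhds.congr' ?_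
    filter_upwards [eventually_ge_atTop 2] with s hs using (ramp_of_ge hs).symm

end AFC

end

noncomputable section

namespace AFC

open Filter Topology

/-! ### The divergence theorem on a simplex -/

section CellDivergence

variable {d : ℕ} {K : Finset (E d)}

open Classical in
/-- The part of the derivative of the cut-off function of a simplex that is concentrated near the
face opposite to `k`. -/
def stripWeight (K : Finset (E d)) (k : E d) (ε : ℝ) (x : E d) : ℝ :=
  (∏ l ∈ K.erase k, ramp (bary K l x / ε)) * deriv ramp (bary K k x / ε)

/-- A smooth cut-off function with compact support in the interior of a simplex. -/
def cellCutoff (K : Finset (E d)) (ε : ℝ) (x : E d) : ℝ := ∏ l ∈ K, ramp (bary K l x / ε)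

lemma continuous_stripWeight (k : E d) (ε : ℝ) : Continuous (stripWeight K k ε) := by
  have h : ∀ l, Continuous fun x => bary K l x / ε := fun l => (continuous_bary l).div_const ε
  exact (continuous_finsetProd _ fun l _ => (contDiff_ramp (n := 0)).continuous.comp (h l)).mul
    (continuous_deriv_ramp.comp (h k))

/-- Outside the open cell some barycentric coordinate is at most `0`, and its factor vanishes,
whether it is `ramp` or the derivative of `ramp`. -/
lemma stripWeight_eq_zero {k : E d} (hk : k ∈ K) {ε : ℝ} (hε : 0 < ε) {x : E d}
    (hx : x ∉ openCell K) : stripWeight K k ε x = 0 := by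
  classical
  simp only [openCell, mem_ofPred_eq, not_forall, not_lt] at hx
  obtain ⟨p, hp, h⟩ := hx
  have h1 : bary K p x / ε ≤ 1 := (div_nonpos_of_nonpos_of_nonneg h hε.le).trans zero_le_one
  by_cases hpk : p = k
  · subst hpk
    rw [stripWeight, deriv_ramp_of_le h1, mul_zero]
  · rw [stripWeight, Finset.prod_eq_zero (Finset.mem_erase.2 ⟨hpk, hp⟩) (ramp_of_le h1), zero_mul]

lemma prod_ramp_mem_Icc (s : Finset (E d)) (g : E d → ℝ) :
    ∏ l ∈ s, ramp (g l) ∈ Icc (0 : ℝ) 1 :=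
  ⟨Finset.prod_nonneg fun _ _ => ramp_nonneg _,
    Finset.prod_le_one (fun _ _ => ramp_nonneg _) fun _ _ => ramp_le_one _⟩

lemma exists_bound_deriv_ramp : ∃ D, ∀ s, |deriv ramp s| ≤ D := by
  obtain ⟨D, hD⟩ := continuous_deriv_ramp.bounded_above_of_compact_support
    hasCompactSupport_deriv_ramp
  exact ⟨D, hD⟩

/-- The cut-off strip along a face concentrates on the face. -/
lemma IsSimplex.tendsto_integral_strip (hK : IsSimplex K) (hd : d ≠ 0) {k : E d} (hk : k ∈ K)
    {f : E d → ℝ} (hf : ContinuousOn f (convexHull ℝ (K : Set (E d))))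
    (hf0 : ∀ x ∉ convexHull ℝ (K : Set (E d)), f x = 0) :
    Tendsto (fun ε => ∫ x, f x * (stripWeight K k ε x * ε⁻¹)) (𝓝[>] 0)
      (𝓝 (‖baryGrad K k‖⁻¹ *
        ∫ x in openFace K k, f x ∂(Measure.euclideanHausdorffMeasure (d - 1)))) := by
  classical
  have hg := hK.baryGrad_ne_zero hd hk
  set c := ‖baryGrad K k‖ with hc
  have hc0 : 0 < c := norm_pos_iff.2 hg
  obtain ⟨n, hn_def⟩ : ∃ n : E d, n = c⁻¹ • baryGrad K k := ⟨_, rfl⟩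
  have hn : ‖n‖ = 1 := by rw [hn_def, norm_smul, norm_inv, norm_norm, inv_mul_cancel₀ hc0.ne']
  -- A vertex other than `k` lies in the hyperplane of the face and serves as origin; `n` is the
  -- inward unit normal.
  obtain ⟨p, hp, hpk⟩ := Finset.exists_mem_ne (by rw [hK.card]; omega : 1 < K.card) k
  have hbp : bary K k p = 0 := by rw [hK.bary_vertex hk hp, if_neg hpk.symm]
  have hgn : baryGrad K k = c • n := by rw [hn_def, smul_inv_smul₀ hc0.ne']
  have hface : ∀ x ∈ openFace K k, ⟪n, x - p⟫ = 0 := by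
    intro x hx
    rw [hn_def, real_inner_smul_left, ← bary_sub, hx.1, hbp, sub_zero, mul_zero]
  have hy : ∀ y : (ℝ ∙ n)ᗮ, ⟪n, (y : E d)⟫ = 0 := fun y =>
    Submodule.mem_orthogonal_singleton_iff_inner_right.1 y.2
  -- coordinates
  let X : ℝ → ℝ × (ℝ ∙ n)ᗮ → E d := fun ε z => (ε / c * z.1) • n + z.2 + p
  -- This is the reason for the scaling `ε / c`: the argument of the derivative of `ramp` becomes
  -- `z.1`, whatever `ε` is.
  have hXk : ∀ ε z, bary K k (X ε z) = ε * z.1 := by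
    intro ε z
    have : X ε z = p + ((ε / c * z.1) • n + z.2) := by simp only [X]; abel
    rw [this, bary_add, hbp, hgn, real_inner_smul_left, inner_add_right, inner_smul_right, hy,
      real_inner_self_eq_norm_sq, hn]
    field_simp
    ring
  have hXc : ∀ z, Continuous fun ε => X ε z := fun z => by fun_prop
  have hX0 : ∀ z, X 0 z = z.2 + p := fun z => by simp [X]
  have hfm : Measurable f := by
    have : f = (convexHull ℝ (K : Set (E d))).indicator f :=
      (indicator_eq_self.2 fun x hx => by_contra fun h => hx (hf0 x h)).symm
    rw [this]
    have hm : MeasurableSet (convexHull ℝ (K : Set (E d))) := isCompact_simplex.measurableSet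
    rw [← piecewise_eq_indicator]
    exact hf.measurable_piecewise continuousOn_const hm
  obtain ⟨Mf, hMf⟩ := isCompact_simplex.exists_bound_of_continuousOn hf
  obtain ⟨D, hD⟩ := exists_bound_deriv_ramp
  have hD0 : 0 ≤ D := (abs_nonneg _).trans (hD 0)
  have hMf0 : 0 ≤ Mf := (norm_nonneg _).trans (hMf p (subset_convexHull ℝ _ hp))
  obtain ⟨R, hR⟩ := (isCompact_simplex (K := K)).isBounded.subset_closedBall p
  -- the rescaled integrals
  let G : ℝ → ℝ × (ℝ ∙ n)ᗮ → ℝ := fun ε z => f (X ε z) * stripWeight K k ε (X ε z)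
  -- The Jacobian `ε / c` cancels the factor `ε⁻¹` from the derivative of the cut-off.
  have hint : ∀ ε > 0, ∫ x, f x * (stripWeight K k ε x * ε⁻¹) = c⁻¹ * ∫ z, G ε z := by
    intro ε hε
    rw [integral_slice p n hn _ (div_pos hε hc0)]
    have : ∀ z : ℝ × (ℝ ∙ n)ᗮ, f ((ε / c * z.1) • n + z.2 + p) *
        (stripWeight K k ε ((ε / c * z.1) • n + z.2 + p) * ε⁻¹) = G ε z * ε⁻¹ :=
      fun z => by simp only [G, X]; ring
    simp_rw [this]
    rw [integral_mul_const]
    field_simp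
  -- The pointwise limit of `G ε`. It is a product of a function of the normal and a function of the
  -- tangential coordinate, so its integral splits.
  let G0 : ℝ × (ℝ ∙ n)ᗮ → ℝ := fun z =>
    deriv ramp z.1 * (openFace K k).indicator f (z.2 + p)
  have hlim : ∫ z, G0 z = ∫ x in openFace K k, f x ∂(Measure.euclideanHausdorffMeasure (d - 1)) := by
    rw [setIntegral_hyperplane hd p n hn (measurableSet_openFace k) hface, Measure.volume_eq_prod,
      integral_prod_mul (fun s => deriv ramp s)
        (fun y : (ℝ ∙ n)ᗮ => (openFace K k).indicator f (y + p)), integral_deriv_ramp, one_mul]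
  rw [← hlim]
  refine Tendsto.congr' (f₁ := fun ε => c⁻¹ * ∫ z, G ε z) ?_ (Tendsto.const_mul _ ?_)
  · filter_upwards [self_mem_nhdsWithin] with ε hε using (hint ε hε).symm
  -- A common support for all `ε < 1`: the derivative of `ramp` lives on `[1,2]`, the cell lies in a
  -- ball of radius `R` about `p`, and the normal displacement is at most `2 / c`.
  let S : Set (ℝ × (ℝ ∙ n)ᗮ) := Icc 1 2 ×ˢ Metric.closedBall 0 (R + 2 / c)
  have hS : MeasurableSet S := measurableSet_Icc.prod Metric.isClosed_closedBall.measurableSet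
  refine tendsto_integral_filter_of_dominated_convergence (S.indicator fun _ => Mf * D) ?_ ?_ ?_ ?_
  · refine Eventually.of_forall fun ε => ?_
    have hXm : Measurable (X ε) := by fun_prop
    exact ((hfm.comp hXm).mul
      ((continuous_stripWeight k ε).measurable.comp hXm)).aestronglyMeasurable
  · filter_upwards [Ioo_mem_nhdsGT (zero_lt_one (α := ℝ))] with ε hε
    refine Eventually.of_forall fun z => ?_
    by_cases hz : G ε z = 0
    · rw [hz, norm_zero]
      exact indicator_nonneg (fun _ _ => mul_nonneg hMf0 hD0) _
    have hw : stripWeight K k ε (X ε z) ≠ 0 := fun h => hz (by simp [G, h])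
    have hcell : X ε z ∈ openCell K := by_contra fun h => hw (stripWeight_eq_zero hk hε.1 h)
    have hconv := hK.openCell_subset hcell
    have hder : deriv ramp z.1 ≠ 0 := fun h => hw (by
      rw [stripWeight, hXk, mul_div_cancel_left₀ _ hε.1.ne', h, mul_zero])
    have hz1 : z.1 ∈ Icc (1 : ℝ) 2 :=
      ⟨by_contra fun h => hder (deriv_ramp_of_le (not_le.1 h).le),
        by_contra fun h => hder (deriv_ramp_of_ge (not_le.1 h).le)⟩
    have hz2 : z.2 ∈ Metric.closedBall (0 : (ℝ ∙ n)ᗮ) (R + 2 / c) := by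
      rw [mem_closedBall_zero_iff, ← Submodule.norm_coe]
      have h1 : (z.2 : E d) = (X ε z - p) - (ε / c * z.1) • n := by simp only [X]; abel
      have h2 := mem_closedBall_iff_norm.1 (hR hconv)
      have h3 : ‖(ε / c * z.1) • n‖ ≤ 2 / c := by
        rw [norm_smul, hn, mul_one, Real.norm_eq_abs, abs_of_nonneg
          (mul_nonneg (div_pos hε.1 hc0).le (zero_le_one.trans hz1.1)), div_mul_eq_mul_div]
        gcongr
        nlinarith [hε.1, hε.2, hz1.1, hz1.2]
      rw [h1]
      exact (norm_sub_le _ _).trans (add_le_add h2 h3)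
    rw [indicator_of_mem (show z ∈ S from ⟨hz1, hz2⟩)]
    simp only [G, norm_mul]
    refine mul_le_mul (hMf _ hconv) ?_ (norm_nonneg _) hMf0
    rw [stripWeight, norm_mul, Real.norm_eq_abs, Real.norm_eq_abs]
    have h4 := prod_ramp_mem_Icc (K.erase k) fun l => bary K l (X ε z) / ε
    rw [abs_of_nonneg h4.1]
    exact (mul_le_mul h4.2 (hD _) (abs_nonneg _) zero_le_one).trans_eq (one_mul D)
  · refine (integrable_indicator_iff hS).2 (integrableOn_const ?_)
    rw [Measure.volume_eq_prod, Measure.prod_prod]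
    exact (ENNReal.mul_lt_top measure_Icc_lt_top measure_closedBall_lt_top).ne
  · -- almost every point of the hyperplane lies on no further face
    have hae : ∀ᵐ y : (ℝ ∙ n)ᗮ, ∀ l ∈ K, l ≠ k → bary K l (y + p) ≠ 0 := by
      refine (Finset.eventually_all K).2 fun l hl => ?_
      by_cases hlk : l = k
      · simp [hlk]
      let s : AffineSubspace ℝ (ℝ ∙ n)ᗮ := AffineSubspace.comap ((bary K l).comp
        ((AffineEquiv.vaddConst ℝ p).toAffineMap.comp (ℝ ∙ n)ᗮ.subtype.toAffineMap))
          (AffineSubspace.mk' 0 ⊥)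
      have hs : ∀ y, y ∈ s ↔ bary K l (y + p) = 0 := by
        intro y; simp [s]
      have hl' : bary K l l ≠ 0 := by rw [hK.bary_vertex hl hl]; simp
      -- The vertex `l` lies in the hyperplane of the face and has `l`-coordinate `1`, so the zero
      -- set of that coordinate is a proper affine subspace of the hyperplane.
      have hls : (⟨l - p, Submodule.mem_orthogonal_singleton_iff_inner_right.2 (by
          rw [hn_def, real_inner_smul_left, ← bary_sub, hbp, hK.bary_vertex hk hl,
            if_neg (Ne.symm hlk)]; simp)⟩ : (ℝ ∙ n)ᗮ) ∉ s := by
        rw [hs]; simpa using hl'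
      have h0 : volume (s : Set (ℝ ∙ n)ᗮ) = 0 :=
        Measure.addHaar_affineSubspace _ _ fun htop =>
          hls (htop ▸ AffineSubspace.mem_top ℝ _ _)
      filter_upwards [compl_mem_ae_iff.2 h0] with y hy' _ h using hy' ((hs y).2 h)
    have hae' : ∀ᵐ z : ℝ × (ℝ ∙ n)ᗮ, ∀ l ∈ K, l ≠ k → bary K l (z.2 + p) ≠ 0 := by
      rw [Measure.volume_eq_prod]
      exact Measure.quasiMeasurePreserving_snd.ae hae
    filter_upwards [hae'] with z hz
    by_cases hder : deriv ramp z.1 = 0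
    · have : G0 z = 0 := by simp [G0, hder]
      rw [this]
      refine tendsto_const_nhds.congr' ?_
      filter_upwards [self_mem_nhdsWithin] with ε hε
      have hε' : ε ≠ 0 := (mem_Ioi.1 hε).ne'
      simp only [G]
      rw [stripWeight, hXk, mul_div_cancel_left₀ _ hε', hder, mul_zero, mul_zero]
    have hz1 : 0 < z.1 := by
      by_contra h
      exact hder (deriv_ramp_of_le ((not_lt.1 h).trans zero_le_one))
    have htend : ∀ l, Tendsto (fun ε => bary K l (X ε z)) (𝓝[>] 0) (𝓝 (bary K l (z.2 + p))) := by
      intro l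
      rw [← hX0 z]
      exact (((continuous_bary l).comp (hXc z)).tendsto 0).mono_left nhdsWithin_le_nhds
    by_cases hF : (z.2 : E d) + p ∈ openFace K k
    -- On the open face the other coordinates have positive limits, so after division by `ε` all
    -- remaining factors `ramp` equal `1`.
    · have h1 : ∀ᶠ ε in 𝓝[>] (0 : ℝ), ∀ l ∈ K, l ≠ k → 2 ≤ bary K l (X ε z) / ε := by
        refine (Finset.eventually_all K).2 fun l hl => ?_
        by_cases hlk : l = k
        · simp [hlk]
        have hpos := hF.2 l hl hlk
        have h2 : ∀ᶠ ε in 𝓝[>] (0 : ℝ), bary K l (z.2 + p) / 2 < bary K l (X ε z) :=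
          (htend l).eventually (lt_mem_nhds (by linarith))
        filter_upwards [h2, Ioo_mem_nhdsGT (show 0 < bary K l (z.2 + p) / 4 by linarith)]
          with ε h3 h4 _
        rw [le_div_iff₀ h4.1]
        linarith [h4.2]
      have h5 : Tendsto (fun ε => f (X ε z)) (𝓝[>] 0) (𝓝 (f (z.2 + p))) := by
        -- Since `f` is continuous only on the closed simplex, the approach has to stay inside it;
        -- this uses `0 < z.1`.
        have h6 : Tendsto (fun ε => X ε z) (𝓝[>] 0)
            (𝓝[convexHull ℝ (K : Set (E d))] ((z.2 : E d) + p)) := by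
          refine tendsto_nhdsWithin_iff.2 ⟨?_, ?_⟩
          · rw [← hX0 z]
            exact ((hXc z).tendsto 0).mono_left nhdsWithin_le_nhds
          · filter_upwards [h1, self_mem_nhdsWithin] with ε h7 hε
            refine hK.mem_convexHull_iff.2 fun l hl => ?_
            have hε' : 0 < ε := hε
            by_cases hlk : l = k
            · rw [hlk, hXk]; positivity
            · have := (le_div_iff₀ hε').1 (h7 l hl hlk)
              linarith
        exact (hf _ (hK.openFace_subset hF)).tendsto.comp h6
      have h8 : G0 z = f (z.2 + p) * deriv ramp z.1 := by
        simp only [G0, indicator_of_mem hF]; ring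
      rw [h8]
      refine (h5.mul_const (deriv ramp z.1)).congr' ?_
      filter_upwards [h1, self_mem_nhdsWithin] with ε h7 hε
      have hε' : ε ≠ 0 := (mem_Ioi.1 hε).ne'
      have h9 : ∏ l ∈ K.erase k, ramp (bary K l (X ε z) / ε) = 1 :=
        Finset.prod_eq_one fun l hl => ramp_of_ge
          (h7 l (Finset.mem_of_mem_erase hl) (Finset.ne_of_mem_erase hl))
      simp only [G, stripWeight, hXk, mul_div_cancel_left₀ _ hε', h9, one_mul]
    -- Off the open face some coordinate is strictly negative, because zero values were excluded
    -- almost everywhere. The point `X ε z` is then eventually outside the cell.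
    · have h1 : ∃ l ∈ K, l ≠ k ∧ bary K l (z.2 + p) < 0 := by
        by_contra! h
        refine hF ⟨?_, fun l hl hlk => lt_of_le_of_ne (h l hl hlk) (hz l hl hlk).symm⟩
        rw [← hX0 z, hXk, zero_mul]
      obtain ⟨l, hl, hlk, hneg⟩ := h1
      have h8 : G0 z = 0 := by simp [G0, indicator_of_notMem hF]
      rw [h8]
      refine tendsto_const_nhds.congr' ?_
      filter_upwards [(htend l).eventually (gt_mem_nhds hneg), self_mem_nhdsWithin] with ε h2 hε
      have hnot : X ε z ∉ openCell K := fun h => (h l hl).not_gt h2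
      simp only [G, stripWeight_eq_zero hk hε hnot, mul_zero]

end CellDivergence

end AFC

end

/-! ### The divergence theorem on a simplex: cut-off functions and passage to the limit -/

noncomputable section

namespace AFC

open Filter Topology

section CellDivergence

variable {d : ℕ} {K : Finset (E d)}

lemma contDiff_cellCutoff (ε : ℝ) {n : ℕ∞} : ContDiff ℝ n (cellCutoff K ε) :=
  contDiff_prod fun l _ => contDiff_ramp.comp ((contDiff_bary l).div_const ε)

lemma cellCutoff_mem_Icc (ε : ℝ) (x : E d) : cellCutoff K ε x ∈ Icc (0 : ℝ) 1 :=
  prod_ramp_mem_Icc _ _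

lemma fderiv_cellCutoff (ε : ℝ) (x v : E d) :
    fderiv ℝ (cellCutoff K ε) x v = ∑ k ∈ K, stripWeight K k ε x * ε⁻¹ * ⟪baryGrad K k, v⟫ := by
  classical
  have h : ∀ l ∈ K, HasFDerivAt (fun x => ramp (bary K l x / ε))
      ((deriv ramp (bary K l x / ε) * ε⁻¹) • innerSL ℝ (baryGrad K l)) x := by
    intro l _
    have h1 : HasFDerivAt (fun x => bary K l x / ε) (ε⁻¹ • innerSL ℝ (baryGrad K l)) x := by
      have h0 : (fun x => bary K l x / ε) = ε⁻¹ • (bary K l : E d → ℝ) := by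
        ext y; simp [div_eq_inv_mul]
      rw [h0]
      exact (hasFDerivAt_bary l x).const_smul ε⁻¹
    have h2 := (hasDerivAt_ramp (bary K l x / ε)).comp_hasFDerivAt x h1
    rwa [smul_smul] at h2
  have h3 : HasFDerivAt (cellCutoff K ε) _ x := HasFDerivAt.finsetProd h
  rw [h3.fderiv, sum_apply]
  refine Finset.sum_congr rfl fun k _ => ?_
  simp only [stripWeight, smul_apply, innerSL_apply_apply, smul_eq_mul]
  ring

/-- As `ramp` vanishes up to `1` and not just up to `0`, the support keeps away from the faces. This
makes the cut-off an admissible factor of test functions in the open cell. -/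
lemma tsupport_cellCutoff_subset {ε : ℝ} (hε : 0 < ε) :
    tsupport (cellCutoff K ε) ⊆ {x | ∀ p ∈ K, ε ≤ bary K p x} := by
  have hc : IsClosed {x | ∀ p ∈ K, ε ≤ bary K p x} := by
    have : {x | ∀ p ∈ K, ε ≤ bary K p x} = ⋂ p ∈ K, {x | ε ≤ bary K p x} := by ext; simp
    rw [this]
    exact isClosed_biInter fun p _ => isClosed_le continuous_const (continuous_bary p)
  refine closure_minimal (fun x hx => ?_) hc
  intro p hp
  by_contra! h
  exact hx (Finset.prod_eq_zero hp (ramp_of_le ((div_le_one hε).2 h.le)))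

lemma tendsto_cellCutoff {x : E d} (hx : x ∈ openCell K) :
    ∀ᶠ ε in 𝓝[>] (0 : ℝ), cellCutoff K ε x = 1 := by
  have : ∀ᶠ ε in 𝓝[>] (0 : ℝ), ∀ p ∈ K, 2 ≤ bary K p x / ε := by
    refine (Finset.eventually_all K).2 fun p hp => ?_
    filter_upwards [Ioo_mem_nhdsGT (half_pos (hx p hp))] with ε hε
    rw [le_div_iff₀ hε.1]
    linarith [hε.2]
  filter_upwards [this] with ε h
  exact Finset.prod_eq_one fun p hp => ramp_of_ge (h p hp)

/-- The divergence theorem on a simplex, for a continuous vector field that is solenoidal in the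
sense of distributions, multiplied by a smooth function. -/
lemma IsSimplex.integral_divergence (hK : IsSimplex K) (hd : d ≠ 0) {b : E d → E d}
    (hb : ContinuousOn b (convexHull ℝ (K : Set (E d))))
    (hdiv : ∀ φ : E d → ℝ, ContDiff ℝ ((⊤ : ℕ∞) : WithTop ℕ∞) φ → HasCompactSupport φ →
      tsupport φ ⊆ openCell K → ∫ x in openCell K, fderiv ℝ φ x (b x) = 0)
    {ψ : E d → ℝ} (hψ : ContDiff ℝ ((⊤ : ℕ∞) : WithTop ℕ∞) ψ) :
    ∫ x in openCell K, fderiv ℝ ψ x (b x) =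
      ∑ k ∈ K, ∫ x in openFace K k, ψ x * ⟪b x, faceNormal K k⟫
        ∂(Measure.euclideanHausdorffMeasure (d - 1)) := by
  set C := convexHull ℝ (K : Set (E d)) with hC
  have hCm : MeasurableSet C := isCompact_simplex.measurableSet
  have hsub : openCell K ⊆ C := hK.openCell_subset
  have hψc : Continuous ψ := hψ.continuous
  have hψd : Differentiable ℝ ψ := hψ.differentiable (by simp)
  have hdψ : Continuous (fderiv ℝ ψ) := hψ.continuous_fderiv (by simp)
  have hint : ∀ {g : E d → ℝ}, ContinuousOn g C → IntegrableOn g (openCell K) := fun hg =>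
    (hg.integrableOn_compact isCompact_simplex).mono_set hsub
  have hcont1 : ContinuousOn (fun x => fderiv ℝ ψ x (b x)) C := hdψ.continuousOn.clm_apply hb
  have hcont2 : ∀ k, ContinuousOn (fun x => ψ x * ⟪baryGrad K k, b x⟫) C := fun k =>
    hψc.continuousOn.mul (continuousOn_const.inner hb)
  -- Extended by zero, since the velocity is controlled only on the simplex while the strip
  -- integrals run over the whole space.
  let f : E d → E d → ℝ := fun k => C.indicator fun x => ψ x * ⟪baryGrad K k, b x⟫
  have hf : ∀ k, ContinuousOn (f k) C := fun k =>
    (hcont2 k).congr fun x hx => indicator_of_mem hx _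
  have hf0 : ∀ k, ∀ x ∉ C, f k x = 0 := fun k x hx => indicator_of_notMem hx _
  -- The weak divergence condition tested with `ψ` times the cut-off. The product rule separates the
  -- volume term from one strip term per face.
  have hid : ∀ ε > 0, (∫ x in openCell K, cellCutoff K ε x * fderiv ℝ ψ x (b x)) +
      ∑ k ∈ K, ∫ x, f k x * (stripWeight K k ε x * ε⁻¹) = 0 := by
    intro ε hε
    have hcut : ContDiff ℝ ((⊤ : ℕ∞) : WithTop ℕ∞) (cellCutoff K ε) := contDiff_cellCutoff ε
    have hts : tsupport (fun x => ψ x * cellCutoff K ε x) ⊆ openCell K := by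
      refine (tsupport_mul_subset_right).trans ((tsupport_cellCutoff_subset hε).trans ?_)
      exact fun x hx p hp => hε.trans_le (hx p hp)
    have h0 := hdiv (fun x => ψ x * cellCutoff K ε x) (hψ.mul hcut)
      (HasCompactSupport.of_support_subset_isCompact (isCompact_simplex (K := K))
        ((subset_tsupport _).trans (hts.trans hsub))) hts
    have h1 : ∀ x ∈ openCell K, fderiv ℝ (fun x => ψ x * cellCutoff K ε x) x (b x) =
        cellCutoff K ε x * fderiv ℝ ψ x (b x) +
          ∑ k ∈ K, f k x * (stripWeight K k ε x * ε⁻¹) := by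
      intro x hx
      rw [fderiv_fun_mul (hψd x) (hcut.differentiable (by simp) x)]
      simp only [add_apply, smul_apply, smul_eq_mul,
        fderiv_cellCutoff, Finset.mul_sum]
      rw [add_comm]
      congr 1
      refine Finset.sum_congr rfl fun k _ => ?_
      simp only [f, indicator_of_mem (hsub hx)]
      ring
    rw [setIntegral_congr_fun isOpen_openCell.measurableSet h1, integral_add, integral_finsetSum]
      at h0
    · rw [← h0]
      congr 1
      refine Finset.sum_congr rfl fun k hk => ?_
      refine (setIntegral_eq_integral_of_forall_compl_eq_zero fun x hx => ?_).symm
      rw [stripWeight_eq_zero hk hε hx, zero_mul, mul_zero]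
    · exact fun k _ => hint ((hf k).mul
        ((continuous_stripWeight k ε).mul continuous_const).continuousOn)
    · exact hint (hcut.continuous.continuousOn.mul hcont1)
    · exact integrable_finsetSum _ fun k _ => hint ((hf k).mul
        ((continuous_stripWeight k ε).mul continuous_const).continuousOn)
  have hlim1 : Tendsto (fun ε => ∫ x in openCell K, cellCutoff K ε x * fderiv ℝ ψ x (b x))
      (𝓝[>] 0) (𝓝 (∫ x in openCell K, fderiv ℝ ψ x (b x))) := by
    refine tendsto_integral_filter_of_dominated_convergence
      (fun x => ‖fderiv ℝ ψ x (b x)‖) ?_ ?_ (hint hcont1).norm ?_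
    · exact Eventually.of_forall fun ε => (hint ((contDiff_cellCutoff (n := 0)
        ε).continuous.continuousOn.mul hcont1)).aestronglyMeasurable
    · refine Eventually.of_forall fun ε => Eventually.of_forall fun x => ?_
      rw [norm_mul]
      have := cellCutoff_mem_Icc (K := K) ε x
      refine mul_le_of_le_one_left (norm_nonneg _) ?_
      rw [Real.norm_eq_abs, abs_of_nonneg this.1]
      exact this.2
    · filter_upwards [ae_restrict_mem isOpen_openCell.measurableSet] with x hx
      refine tendsto_const_nhds.congr' ?_
      filter_upwards [tendsto_cellCutoff hx] with ε h
      rw [h, one_mul]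
  have hlim2 := tendsto_finsetSum K fun k (hk : k ∈ K) =>
    hK.tendsto_integral_strip hd hk (hf k) (hf0 k)
  have hlim := hlim1.add hlim2
  have hzero : Tendsto (fun _ : ℝ => (0 : ℝ)) (𝓝[>] (0 : ℝ)) (𝓝 0) := tendsto_const_nhds
  have heq := tendsto_nhds_unique (hlim.congr' (f₂ := fun _ => 0) (by
    filter_upwards [self_mem_nhdsWithin] with ε hε using hid ε hε)) hzero
  rw [eq_neg_of_add_eq_zero_left heq, ← Finset.sum_neg_distrib]
  refine Finset.sum_congr rfl fun k _ => ?_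
  rw [← integral_const_mul, ← integral_neg]
  refine setIntegral_congr_fun (measurableSet_openFace k) fun x hx => ?_
  have hxC : x ∈ C := hK.openFace_subset hx
  -- The gradient of the coordinate of `k` points into the simplex; its negative, normalized, is the
  -- outward normal.
  simp only [f, indicator_of_mem hxC, faceNormal, inner_neg_right,
    inner_smul_right]
  rw [real_inner_comm]
  ring

end CellDivergence

/-! ### Solenoidal fields -/

section Solenoidal

variable {d : ℕ} {Ω : Set (E d)} {M : ℝ} {b : E d → E d}

/-- The weak derivative is tested in each direction of an orthonormal basis, and the components are
summed: the result is the integral of `φ` times the trace of `G`, which is zero. -/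
lemma IsSolenoidalW1Inf.integral_fderiv_eq_zero (hΩ : IsOpen Ω) (hb : IsSolenoidalW1Inf Ω M b)
    {φ : E d → ℝ} (hφ : ContDiff ℝ ((⊤ : ℕ∞) : WithTop ℕ∞) φ) (hc : HasCompactSupport φ)
    (hs : tsupport φ ⊆ Ω) : ∫ x in Ω, fderiv ℝ φ x (b x) = 0 := by
  obtain ⟨hbc, hbM, G, hGm, hGM, hG, htr⟩ := hb
  let B := EuclideanSpace.basisFun (Fin d) ℝ
  have hbm : AEStronglyMeasurable b (volume.restrict Ω) :=
    (hbc.mono subset_closure).aestronglyMeasurable hΩ.measurableSet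
  have hbM' : ∀ᵐ x ∂(volume.restrict Ω), ‖b x‖ ≤ M := by
    filter_upwards [ae_restrict_mem hΩ.measurableSet] with x hx using hbM x (subset_closure hx)
  have hφi : Integrable φ := hφ.continuous.integrable_of_hasCompactSupport hc
  have hdc : Continuous (fderiv ℝ φ) := hφ.continuous_fderiv (by simp)
  have hdi : ∀ e, Integrable (fun x => fderiv ℝ φ x e) := fun e => by
    refine (hdc.clm_apply continuous_const).integrable_of_hasCompactSupport ?_
    exact hc.fderiv_apply ℝ e
  have hi1 : ∀ e, Integrable (fun x => fderiv ℝ φ x e • b x) (volume.restrict Ω) := fun e =>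
    (hdi e).restrict.smul_bdd M hbm hbM'
  have hGe : ∀ e, AEStronglyMeasurable (fun x => G x e) (volume.restrict Ω) := fun e =>
    (ContinuousLinearMap.apply ℝ (E d) e).continuous.comp_aestronglyMeasurable hGm
  have hi2 : ∀ e, Integrable (fun x => φ x • G x e) (volume.restrict Ω) := fun e => by
    refine hφi.restrict.smul_bdd (M * ‖e‖) (hGe e) ?_
    filter_upwards [hGM] with x hx using (G x).le_of_opNorm_le hx e
  have key : ∀ i, ∫ x in Ω, fderiv ℝ φ x (B i) * ⟪B i, b x⟫ =
      -∫ x in Ω, φ x * ⟪B i, G x (B i)⟫ := by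
    intro i
    have h := congrArg (fun v => ⟪B i, v⟫) (hG φ hφ hc hs (B i))
    simp only [inner_neg_right] at h
    rw [← integral_inner (hi1 _), ← integral_inner (hi2 _)] at h
    simpa only [inner_smul_right] using h
  have h1 : ∀ x, fderiv ℝ φ x (b x) = ∑ i, fderiv ℝ φ x (B i) * ⟪B i, b x⟫ := by
    intro x
    conv_lhs => rw [← B.sum_repr' (b x)]
    simp only [map_sum, map_smul, smul_eq_mul]
    exact Finset.sum_congr rfl fun i _ => mul_comm _ _
  simp_rw [h1]
  rw [integral_finsetSum]
  · simp_rw [key]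
    rw [Finset.sum_neg_distrib, ← integral_finsetSum]
    · rw [neg_eq_zero]
      refine integral_eq_zero_of_ae ?_
      filter_upwards [htr] with x hx
      rw [LinearMap.trace_eq_sum_inner _ B] at hx
      rw [← Finset.mul_sum]
      simp only [Pi.zero_apply]
      rw [show ∑ i, ⟪B i, G x (B i)⟫ = 0 from hx, mul_zero]
    · intro i _
      simpa only [inner_smul_right] using (hi2 (B i)).const_inner (𝕜 := ℝ) (B i)
  · intro i _
    simpa only [inner_smul_right] using (hi1 (B i)).const_inner (𝕜 := ℝ) (B i)

end Solenoidal

end AFC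

end

noncomputable section

namespace AFC

open Filter Topology

/-! ### The regular part of the boundary and the outward normal -/

section Normal

variable {d : ℕ} {Ω : Set (E d)}

/-- Statements valid near `x` are evaluated along a well-chosen ray. This reduces comparisons of
half-spaces to inequalities between inner products. -/
lemma exists_pos_smul_of_eventually {x : E d} {P : E d → Prop} (h : ∀ᶠ y in 𝓝 x, P y) (v : E d) :
    ∃ s : ℝ, 0 < s ∧ P (x + s • v) := by
  have hc : Tendsto (fun s : ℝ => x + s • v) (𝓝[>] 0) (𝓝 x) := by
    have : Continuous fun s : ℝ => x + s • v := by fun_prop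
    simpa using (this.tendsto 0).mono_left nhdsWithin_le_nhds
  obtain ⟨s, hs, hs'⟩ := ((hc.eventually h).and self_mem_nhdsWithin).exists
  exact ⟨s, hs', hs⟩

/-- A small step in the direction `e` from a boundary point leads strictly above the graph, into an
open set that misses `Ω` nearby, hence out of the closure. This excludes slits, so that interiors of
cells lie in `Ω`. -/
lemma HasLipschitzBoundary.interior_closure (hΩ : IsOpen Ω) (hL : HasLipschitzBoundary Ω) :
    interior (closure Ω) = Ω := by
  refine Subset.antisymm (fun x hx => ?_) (interior_maximal subset_closure hΩ)
  by_contra hxΩ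
  have hxf : x ∈ frontier Ω := by
    rw [hΩ.frontier_eq]; exact ⟨interior_subset hx, hxΩ⟩
  obtain ⟨r, e, L, g, hr, he, hgL, hge, hg⟩ := hL x hxf
  have hgx : g x ≤ ⟪e, x⟫ := not_lt.1 fun h => hxΩ ((hg x (Metric.mem_ball_self hr)).2 h)
  have hev : ∀ᶠ y in 𝓝 x, y ∈ closure Ω ∧ y ∈ Metric.ball x r :=
    (show ∀ᶠ y in 𝓝 x, y ∈ closure Ω from mem_interior_iff_mem_nhds.1 hx).and (Metric.ball_mem_nhds x hr)
  obtain ⟨s, hs, hy, hyb⟩ := exists_pos_smul_of_eventually hev e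
  have hopen : IsOpen {z | g z < ⟪e, z⟫} :=
    isOpen_lt hgL.continuous (continuous_const.inner continuous_id)
  have hmem : x + s • e ∈ {z | g z < ⟪e, z⟫} := by
    simp only [mem_ofPred_eq, hge, inner_add_right, inner_smul_right, real_inner_self_eq_norm_sq,
      he]
    linarith
  obtain ⟨z, ⟨hz1, hz2⟩, hz3⟩ := mem_closure_iff.1 hy _ (hopen.inter Metric.isOpen_ball) ⟨hmem, hyb⟩
  exact absurd ((hg z hz2).1 hz3) (not_lt.2 (le_of_lt hz1))

/-- If `n ≠ n'`, a small step along `n' - n` enters one of the two half-spaces and not the other. -/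
lemma IsOutwardNormal.unique {x n n' : E d} (h : IsOutwardNormal Ω x n)
    (h' : IsOutwardNormal Ω x n') : n = n' := by
  obtain ⟨-, hn, r, hr, hb⟩ := h
  obtain ⟨-, hn', r', hr', hb'⟩ := h'
  have hev : ∀ᶠ y in 𝓝 x, ⟪y - x, n⟫ < 0 ↔ ⟪y - x, n'⟫ < 0 := by
    filter_upwards [Metric.ball_mem_nhds x hr, Metric.ball_mem_nhds x hr'] with y h1 h2
    rw [← hb y h1, hb' y h2]
  obtain ⟨s, hs, h⟩ := exists_pos_smul_of_eventually hev (n' - n)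
  by_contra hne
  have hlt : ⟪n, n'⟫ < 1 := (inner_lt_one_iff_real_of_norm_eq_one hn hn').2 hne
  simp only [add_sub_cancel_left, real_inner_smul_left, inner_sub_left,
    real_inner_self_eq_norm_sq, hn, hn', real_inner_comm n n'] at h
  have h1 := h.1 (by nlinarith)
  nlinarith

lemma IsOutwardNormal.outwardNormal_eq {x n : E d} (h : IsOutwardNormal Ω x n) :
    outwardNormal Ω x = n := by
  have hx : ∃ n, IsOutwardNormal Ω x n := ⟨n, h⟩
  rw [outwardNormal, dif_pos hx]
  exact hx.choose_spec.unique h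

/-- Nearby boundary points lie on the same hyperplane, so they see the same half-space. The normal
is thus locally constant on the regular boundary, the source of its continuity and measurability. -/
lemma IsOutwardNormal.eventually (hΩ : IsOpen Ω) {x n : E d} (h : IsOutwardNormal Ω x n) :
    ∀ᶠ y in 𝓝 x, y ∈ frontier Ω → IsOutwardNormal Ω y n := by
  obtain ⟨-, hn, r, hr, hb⟩ := h
  filter_upwards [Metric.ball_mem_nhds x hr] with y hy hyf
  have hyf' := hyf
  rw [hΩ.frontier_eq] at hyf'
  have h1 : 0 ≤ ⟪y - x, n⟫ := not_lt.1 fun h => hyf'.2 ((hb y hy).2 h)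
  have h2 : ⟪y - x, n⟫ ≤ 0 := by
    by_contra! hpos
    have hopen : IsOpen {z : E d | 0 < ⟪z - x, n⟫} :=
      isOpen_lt continuous_const ((continuous_id.sub continuous_const).inner continuous_const)
    obtain ⟨z, ⟨hz1, hz2⟩, hz3⟩ :=
      mem_closure_iff.1 hyf'.1 _ (hopen.inter Metric.isOpen_ball) ⟨hpos, hy⟩
    exact absurd ((hb z hz2).1 hz3) (not_lt.2 (le_of_lt hz1))
  have h3 : ⟪y - x, n⟫ = 0 := le_antisymm h2 h1
  refine ⟨hyf, hn, r - dist y x, sub_pos.2 hy, fun z hz => ?_⟩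
  have hzx : z ∈ Metric.ball x r := by
    rw [Metric.mem_ball] at hz ⊢
    linarith [dist_triangle z y x]
  rw [hb z hzx, show z - x = (z - y) + (y - x) by abel, inner_add_left, h3, add_zero]

/-- The points of `∂Ω` at which the outward normal exists. -/
def regularBoundary (Ω : Set (E d)) : Set (E d) := {x | ∃ n, IsOutwardNormal Ω x n}

lemma regularBoundary_subset : regularBoundary Ω ⊆ frontier Ω := fun _ ⟨_, h⟩ => h.1

lemma outwardNormal_of_notMem {x : E d} (hx : x ∉ regularBoundary Ω) : outwardNormal Ω x = 0 := by
  rw [outwardNormal, dif_neg]; exact hx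

lemma norm_outwardNormal_le (x : E d) : ‖outwardNormal Ω x‖ ≤ 1 := by
  by_cases hx : x ∈ regularBoundary Ω
  · obtain ⟨n, hn⟩ := hx
    rw [hn.outwardNormal_eq, hn.2.1]
  · rw [outwardNormal_of_notMem hx, norm_zero]; exact zero_le_one

lemma measurableSet_regularBoundary (hΩ : IsOpen Ω) : MeasurableSet (regularBoundary Ω) := by
  have : regularBoundary Ω =
      frontier Ω ∩ {x | ∀ᶠ y in 𝓝 x, y ∈ frontier Ω → y ∈ regularBoundary Ω} := by
    ext x
    refine ⟨fun hx => ⟨regularBoundary_subset hx, ?_⟩, fun hx => ?_⟩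
    · obtain ⟨n, hn⟩ := hx
      filter_upwards [hn.eventually hΩ] with y hy hyf using ⟨n, hy hyf⟩
    · exact (show ∀ᶠ y in 𝓝 x, y ∈ frontier Ω → y ∈ regularBoundary Ω from hx.2).self_of_nhds hx.1
  rw [this]
  exact isClosed_frontier.measurableSet.inter isOpen_setOfPred_eventually_nhds.measurableSet

lemma continuousOn_outwardNormal (hΩ : IsOpen Ω) :
    ContinuousOn (outwardNormal Ω) (regularBoundary Ω) := by
  rintro x ⟨n, hn⟩
  refine (continuousWithinAt_const (b := n)).congr_of_eventuallyEq ?_ hn.outwardNormal_eq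
  filter_upwards [nhdsWithin_le_nhds (hn.eventually hΩ), self_mem_nhdsWithin] with y hy hyR
  exact (hy (regularBoundary_subset hyR)).outwardNormal_eq

lemma measurable_outwardNormal (hΩ : IsOpen Ω) : Measurable (outwardNormal Ω) := by
  classical
  have h : outwardNormal Ω = (regularBoundary Ω).piecewise (outwardNormal Ω) 0 := by
    ext1 x
    by_cases hx : x ∈ regularBoundary Ω
    · simp [hx]
    · simp [hx, outwardNormal_of_notMem hx]
  rw [h]
  exact (continuousOn_outwardNormal hΩ).measurable_piecewise continuousOn_const
    (measurableSet_regularBoundary hΩ)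

/-- Where no normal exists its default value `0` makes the normal velocity vanish, so the strict
inequality fails. -/
lemma inlet_subset_regularBoundary (b : E d → E d) : inlet Ω b ⊆ regularBoundary Ω := by
  intro x hx
  by_contra h
  have := hx.2
  rw [outwardNormal_of_notMem h, inner_zero_right] at this
  exact lt_irrefl _ this

lemma inlet_subset_frontier (b : E d → E d) : inlet Ω b ⊆ frontier Ω := fun _ hx => hx.1

lemma continuousOn_normalVelocity (hΩ : IsOpen Ω) {b : E d → E d}
    (hb : ContinuousOn b (closure Ω)) :
    ContinuousOn (fun x => ⟪b x, outwardNormal Ω x⟫) (regularBoundary Ω) :=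
  (hb.mono (regularBoundary_subset.trans frontier_subset_closure)).inner
    (continuousOn_outwardNormal hΩ)

lemma measurableSet_inlet (hΩ : IsOpen Ω) {b : E d → E d} (hb : ContinuousOn b (closure Ω)) :
    MeasurableSet (inlet Ω b) := by
  have h : inlet Ω b = regularBoundary Ω ∩ {x | ⟪b x, outwardNormal Ω x⟫ < 0} := by
    ext x
    exact ⟨fun hx => ⟨inlet_subset_regularBoundary b hx, hx.2⟩,
      fun hx => ⟨regularBoundary_subset hx.1, hx.2⟩⟩
  rw [h]
  obtain ⟨U, hU, h'⟩ := (continuousOn_iff'.1 (continuousOn_normalVelocity hΩ hb)) (Iio 0) isOpen_Iio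
  rw [inter_comm]
  exact h' ▸ hU.measurableSet.inter (measurableSet_regularBoundary hΩ)

lemma restrict_surface_inlet (b : E d → E d) :
    (surface Ω).restrict (inlet Ω b) =
      (Measure.euclideanHausdorffMeasure (d - 1)).restrict (inlet Ω b) :=
  Measure.restrict_restrict_of_subset (inlet_subset_frontier b)

end Normal

end AFC

end

/-! ### Geometry of a conforming triangulation -/

noncomputable section

namespace AFC

open Filter Topology

namespace Triangulation

section Geometry

variable {d : ℕ} {Ω : Set (E d)} (𝒯 : Triangulation Ω)

lemma isSimplex {K : Finset (E d)} (hK : K ∈ 𝒯.cells) : IsSimplex K :=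
  ⟨𝒯.card_cell K hK, 𝒯.indep K hK⟩

lemma mem_closure_iff {x : E d} :
    x ∈ closure Ω ↔ ∃ K ∈ 𝒯.cells, x ∈ convexHull ℝ (K : Set (E d)) := by
  rw [← 𝒯.cover]; simp

lemma isCompact_closure (𝒯 : Triangulation Ω) : IsCompact (closure Ω) := by
  rw [← 𝒯.cover]
  exact 𝒯.cells.isCompact_biUnion fun K _ => isCompact_simplex

lemma cell_subset {K : Finset (E d)} (hK : K ∈ 𝒯.cells) :
    convexHull ℝ (K : Set (E d)) ⊆ closure Ω :=
  fun _ hx => 𝒯.mem_closure_iff.2 ⟨K, hK, hx⟩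

lemma mem_vertices {K : Finset (E d)} (hK : K ∈ 𝒯.cells) {p : E d} (hp : p ∈ K) :
    p ∈ 𝒯.vertices := by
  classical
  exact Finset.mem_biUnion.2 ⟨K, hK, hp⟩

lemma node_mem_closure (i : 𝒯.Node) : (i : E d) ∈ closure Ω := by
  classical
  obtain ⟨K, hK, hi⟩ := Finset.mem_biUnion.1 i.2
  exact 𝒯.cell_subset hK (subset_convexHull ℝ _ hi)

/-- Barycentric coordinates of different cells agree at common points. -/
lemma bary_eq_of_mem {K L : Finset (E d)} (hK : K ∈ 𝒯.cells) (hL : L ∈ 𝒯.cells) {x : E d}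
    (hxK : x ∈ convexHull ℝ (K : Set (E d))) (hxL : x ∈ convexHull ℝ (L : Set (E d))) (p : E d) :
    bary K p x = bary L p x := by
  classical
  have hx : x ∈ convexHull ℝ ((K ∩ L : Finset (E d)) : Set (E d)) := by
    rw [Finset.coe_inter, ← 𝒯.conforming K hK L hL]; exact ⟨hxK, hxL⟩
  obtain ⟨w, -, hw1, hwx⟩ := Finset.mem_convexHull'.1 hx
  -- By conformity `x` is a convex combination of common vertices. Zero weights elsewhere make it a
  -- barycentric representation in both cells, and such representations are unique.
  let w' : E d → ℝ := fun q => if q ∈ K ∩ L then w q else 0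
  have hsum : ∀ {J : Finset (E d)}, K ∩ L ⊆ J → ∑ q ∈ J, w' q = 1 := fun hJ => by
    rw [← hw1, ← Finset.sum_subset hJ fun q _ hq => if_neg hq]
    exact Finset.sum_congr rfl fun q hq => if_pos hq
  have hcomb : ∀ {J : Finset (E d)}, K ∩ L ⊆ J → ∑ q ∈ J, w' q • q = x := fun hJ => by
    rw [← hwx, ← Finset.sum_subset hJ fun q _ hq => by simp only [w', if_neg hq, zero_smul]]
    exact Finset.sum_congr rfl fun q hq => by simp only [w', if_pos hq]
  have hval : ∀ {J : Finset (E d)}, J ∈ 𝒯.cells → K ∩ L ⊆ J → p ∈ J → bary J p x = w' p :=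
    fun hJ hsub hp => by
      have := (𝒯.isSimplex hJ).bary_combination w' (hsum hsub) hp
      rwa [hcomb hsub] at this
  have hval' : ∀ {J : Finset (E d)}, J ∈ 𝒯.cells → K ∩ L ⊆ J → bary J p x = w' p :=
    fun {J} hJ hsub => by
      by_cases hp : p ∈ J
      · exact hval hJ hsub hp
      · rw [bary_of_notMem hp]
        exact (if_neg fun h => hp (hsub h)).symm
  rw [hval' hK Finset.inter_subset_left, hval' hL Finset.inter_subset_right]

/-- All coordinates of `K` are positive at `x` and agree with those of `L`, so every vertex of `K`
is a vertex of `L`; the cardinalities are equal. -/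
lemma eq_of_mem_openCell {K L : Finset (E d)} (hK : K ∈ 𝒯.cells) (hL : L ∈ 𝒯.cells) {x : E d}
    (hxK : x ∈ openCell K) (hxL : x ∈ convexHull ℝ (L : Set (E d))) : K = L := by
  refine Finset.eq_of_subset_of_card_le (fun p hp => ?_)
    (by rw [𝒯.card_cell K hK, 𝒯.card_cell L hL])
  by_contra hpL
  have h := 𝒯.bary_eq_of_mem hK hL ((𝒯.isSimplex hK).openCell_subset hxK) hxL p
  rw [bary_of_notMem hpL] at h
  exact (hxK p hp).ne' h

/-! ### Hat functions -/

/-- The definition picks some cell containing `x`; by `bary_eq_of_mem` the choice does not matter.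
-/
lemma hat_eq {K : Finset (E d)} (hK : K ∈ 𝒯.cells) {x : E d}
    (hx : x ∈ convexHull ℝ (K : Set (E d))) (i : 𝒯.Node) : 𝒯.hat i x = bary K i x := by
  have hex : ∃ K : Finset (E d), K ∈ 𝒯.cells ∧ x ∈ convexHull ℝ (K : Set (E d)) := ⟨K, hK, hx⟩
  rw [𝒯.bary_eq_of_mem hK hex.choose_spec.1 hx hex.choose_spec.2, hat, dif_pos hex]
  by_cases hi : (i : E d) ∈ hex.choose
  · rw [dif_pos hi, (𝒯.isSimplex hex.choose_spec.1).bary_eq hi]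
  · rw [dif_neg hi, bary_of_notMem hi]; rfl

lemma hat_of_notMem {x : E d} (hx : x ∉ closure Ω) (i : 𝒯.Node) : 𝒯.hat i x = 0 := by
  rw [hat, dif_neg]
  rintro ⟨K, hK, hxK⟩
  exact hx (𝒯.cell_subset hK hxK)

lemma hat_nonneg (i : 𝒯.Node) (x : E d) : 0 ≤ 𝒯.hat i x := by
  by_cases hx : x ∈ closure Ω
  · obtain ⟨K, hK, hxK⟩ := 𝒯.mem_closure_iff.1 hx
    rw [𝒯.hat_eq hK hxK]
    exact bary_nonneg_of_mem (𝒯.isSimplex hK) hxK _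
  · rw [𝒯.hat_of_notMem hx]

lemma sum_node_eq {K : Finset (E d)} (hK : K ∈ 𝒯.cells) (x : E d) :
    ∑ i : 𝒯.Node, bary K i x = 1 := by
  rw [← (𝒯.isSimplex hK).sum_bary x, Finset.sum_coe_sort 𝒯.vertices (fun p => bary K p x)]
  refine (Finset.sum_subset (fun p hp => 𝒯.mem_vertices hK hp) fun p _ hp => ?_).symm
  rw [bary_of_notMem hp]; rfl

lemma sum_hat {x : E d} (hx : x ∈ closure Ω) : ∑ i, 𝒯.hat i x = 1 := by
  obtain ⟨K, hK, hxK⟩ := 𝒯.mem_closure_iff.1 hx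
  simp_rw [𝒯.hat_eq hK hxK]
  exact 𝒯.sum_node_eq hK x

lemma hat_le_one (i : 𝒯.Node) (x : E d) : 𝒯.hat i x ≤ 1 := by
  by_cases hx : x ∈ closure Ω
  · rw [← 𝒯.sum_hat hx]
    exact Finset.single_le_sum (fun j _ => 𝒯.hat_nonneg j x) (Finset.mem_univ i)
  · rw [𝒯.hat_of_notMem hx]; exact zero_le_one

lemma hat_self (i : 𝒯.Node) : 𝒯.hat i i = 1 := by
  classical
  obtain ⟨K, hK, hi⟩ := Finset.mem_biUnion.1 i.2
  have hi' : (i : E d) ∈ K := hi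
  rw [𝒯.hat_eq hK (subset_convexHull ℝ _ hi'), (𝒯.isSimplex hK).bary_vertex hi' hi', if_pos rfl]

lemma continuousOn_hat (i : 𝒯.Node) : ContinuousOn (𝒯.hat i) (closure Ω) := by
  have h : ContinuousOn (𝒯.hat i) (⋃ K : 𝒯.cells, convexHull ℝ ((K : Finset (E d)) : Set (E d))) := by
    refine (locallyFinite_of_finite _).continuousOn_iUnion
      (fun K => isCompact_simplex.isClosed) fun K => ?_
    exact (continuous_bary _).continuousOn.congr fun x hx => 𝒯.hat_eq K.2 hx i
  have hcov : ⋃ K : 𝒯.cells, convexHull ℝ ((K : Finset (E d)) : Set (E d)) = closure Ω := by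
    rw [← 𝒯.cover]; ext; simp
  rwa [hcov] at h

lemma measurable_hat (i : 𝒯.Node) : Measurable (𝒯.hat i) := by
  classical
  have h : 𝒯.hat i = (closure Ω).piecewise (𝒯.hat i) 0 := by
    ext1 x
    by_cases hx : x ∈ closure Ω
    · simp [hx]
    · simp [hx, 𝒯.hat_of_notMem hx]
  rw [h]
  exact (𝒯.continuousOn_hat i).measurable_piecewise continuousOn_const isClosed_closure.measurableSet

lemma measurable_fe (v : 𝒯.Node → ℝ) : Measurable (𝒯.fe v) :=
  Finset.measurable_sum _ fun i _ => (𝒯.measurable_hat i).const_mul _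

/-- The finite element function on a cell, extended to an affine function. -/
def cellFun (K : Finset (E d)) (v : 𝒯.Node → ℝ) (x : E d) : ℝ := ∑ i, v i * bary K i x

/-- The gradient of a finite element function on a cell. -/
def cellGrad (K : Finset (E d)) (v : 𝒯.Node → ℝ) : E d := ∑ i, v i • baryGrad K i

lemma fe_eq {K : Finset (E d)} (hK : K ∈ 𝒯.cells) {x : E d}
    (hx : x ∈ convexHull ℝ (K : Set (E d))) (v : 𝒯.Node → ℝ) : 𝒯.fe v x = 𝒯.cellFun K v x :=
  Finset.sum_congr rfl fun i _ => by rw [𝒯.hat_eq hK hx]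

lemma contDiff_cellFun (K : Finset (E d)) (v : 𝒯.Node → ℝ) {n : WithTop ℕ∞} :
    ContDiff ℝ n (𝒯.cellFun K v) :=
  ContDiff.sum fun _ _ => contDiff_const.mul (contDiff_bary _)

lemma hasGradientAt_cellFun (K : Finset (E d)) (v : 𝒯.Node → ℝ) (x : E d) :
    HasGradientAt (𝒯.cellFun K v) (𝒯.cellGrad K v) x := by
  rw [hasGradientAt_iff_hasFDerivAt]
  have h : HasFDerivAt (𝒯.cellFun K v) (∑ i : 𝒯.Node, v i • innerSL ℝ (baryGrad K i)) x :=
    HasFDerivAt.fun_sum fun i _ => (hasFDerivAt_bary _ x).const_mul (v i)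
  have h' : InnerProductSpace.toDual ℝ (E d) (𝒯.cellGrad K v) =
      ∑ i : 𝒯.Node, v i • innerSL ℝ (baryGrad K i) := by
    ext y
    simp [cellGrad, sum_apply]
  rw [h']
  exact h

lemma hasGradientAt_fe {K : Finset (E d)} (hK : K ∈ 𝒯.cells) {x : E d} (hx : x ∈ openCell K)
    (v : 𝒯.Node → ℝ) : HasGradientAt (𝒯.fe v) (𝒯.cellGrad K v) x := by
  refine (𝒯.hasGradientAt_cellFun K v x).congr_of_eventuallyEq ?_
  filter_upwards [isOpen_openCell.mem_nhds hx] with y hy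
  exact 𝒯.fe_eq hK ((𝒯.isSimplex hK).openCell_subset hy) v

lemma fe_single [DecidableEq 𝒯.Node] (i : 𝒯.Node) : 𝒯.fe (Pi.single i 1) = 𝒯.hat i := by
  ext x
  rw [fe, Finset.sum_eq_single i]
  · simp
  · intro j _ hj; simp [Pi.single_eq_of_ne hj]
  · simp

/-! ### Integration over the cells -/

variable {𝒯}

lemma openCell_subset_domain (hreg : interior (closure Ω) = Ω) {K : Finset (E d)}
    (hK : K ∈ 𝒯.cells) : openCell K ⊆ Ω := by
  rw [← hreg]
  exact interior_maximal (((𝒯.isSimplex hK).openCell_subset).trans (𝒯.cell_subset hK))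
    isOpen_openCell

variable (𝒯)

lemma volume_closure_diff_openCells :
    volume (closure Ω \ ⋃ K ∈ 𝒯.cells, openCell K) = 0 := by
  refine measure_mono_null (t := ⋃ K ∈ 𝒯.cells, (convexHull ℝ (K : Set (E d)) \ openCell K)) ?_
    ((measure_biUnion_null_iff 𝒯.cells.countable_toSet).2 fun K hK =>
      (𝒯.isSimplex hK).volume_diff_openCell)
  rintro x ⟨hx, hx'⟩
  obtain ⟨K, hK, hxK⟩ := 𝒯.mem_closure_iff.1 hx
  simp only [mem_iUnion, not_exists] at hx' ⊢
  exact ⟨K, hK, hxK, hx' K hK⟩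

lemma ae_mem_openCell (hΩ : IsOpen Ω) :
    ∀ᵐ x ∂(volume.restrict Ω), ∃ K ∈ 𝒯.cells, x ∈ openCell K := by
  rw [ae_restrict_iff' hΩ.measurableSet]
  filter_upwards [compl_mem_ae_iff.2 𝒯.volume_closure_diff_openCells] with x hx hxΩ
  by_contra h
  refine hx ⟨subset_closure hxΩ, fun h' => h ?_⟩
  simpa using h'

lemma integral_eq_sum_cells (hreg : interior (closure Ω) = Ω) {F : E d → ℝ}
    (hF : IntegrableOn F Ω) : ∫ x in Ω, F x = ∑ K ∈ 𝒯.cells, ∫ x in openCell K, F x := by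
  have hsub : ⋃ K ∈ 𝒯.cells, openCell K ⊆ Ω := iUnion₂_subset fun K hK =>
    openCell_subset_domain hreg hK
  rw [← integral_biUnion_finset _ (fun K _ => isOpen_openCell.measurableSet)]
  · refine setIntegral_congr_set (ae_eq_set.2 ⟨?_, ?_⟩)
    · exact measure_mono_null (sdiff_subset_sdiff_left subset_closure)
        𝒯.volume_closure_diff_openCells
    · rw [sdiff_eq_empty.2 hsub, measure_empty]
  · intro K hK L hL hne
    refine disjoint_left.2 fun x hx hx' => hne ?_
    exact 𝒯.eq_of_mem_openCell hK hL hx ((𝒯.isSimplex hL).openCell_subset hx')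
  · exact fun K hK => hF.mono_set (openCell_subset_domain hreg hK)

lemma volume_domain_lt_top (𝒯 : Triangulation Ω) : volume Ω < ∞ :=
  (measure_mono subset_closure).trans_lt 𝒯.isCompact_closure.measure_lt_top

lemma face_lt_top (hd : d ≠ 0) {K : Finset (E d)} (hK : K ∈ 𝒯.cells) {k : E d} (hk : k ∈ K) :
    (Measure.euclideanHausdorffMeasure (d - 1) : Measure (E d))
      {x ∈ convexHull ℝ (K : Set (E d)) | bary K k x = 0} < ∞ := by
  classical
  have hS := 𝒯.isSimplex hK
  obtain ⟨p, hp, hpk⟩ := Finset.exists_mem_ne (by rw [hS.card]; omega : 1 < K.card) k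
  refine hausdorff_hyperplane_lt_top hd p (faceNormal K k) (hS.norm_faceNormal hd hk)
    (isCompact_simplex.isBounded.subset fun x hx => hx.1) fun x hx => ?_
  rw [faceNormal, inner_neg_left, real_inner_smul_left, ← bary_sub, hx.2,
    hS.bary_vertex hk hp, if_neg hpk.symm]
  simp

/-- A point of a cell with all coordinates positive is interior to `Ω`, so the boundary is covered
by finitely many faces, each a bounded part of a hyperplane. -/
lemma surface_lt_top (𝒯 : Triangulation Ω) (hd : d ≠ 0) (hreg : interior (closure Ω) = Ω) : surface Ω univ < ∞ := by
  rw [surface, Measure.restrict_apply_univ]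
  have hsub : frontier Ω ⊆ ⋃ K ∈ 𝒯.cells, ⋃ k ∈ K,
      {x ∈ convexHull ℝ (K : Set (E d)) | bary K k x = 0} := by
    intro x hx
    obtain ⟨K, hK, hxK⟩ := 𝒯.mem_closure_iff.1 (frontier_subset_closure hx)
    by_contra h
    simp only [mem_iUnion, mem_ofPred_eq, not_exists, not_and] at h
    have hcell : x ∈ openCell K := fun p hp => lt_of_le_of_ne
      ((𝒯.isSimplex hK).mem_convexHull_iff.1 hxK p hp) (Ne.symm (h K hK p hp hxK))
    have hxi : x ∈ interior Ω := by
      rw [mem_interior_iff_mem_nhds]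
      exact mem_of_superset (isOpen_openCell.mem_nhds hcell) (openCell_subset_domain hreg hK)
    exact hx.2 hxi
  refine (measure_mono hsub).trans_lt ?_
  exact measure_biUnion_lt_top 𝒯.cells.finite_toSet fun K hK =>
    measure_biUnion_lt_top K.finite_toSet fun k hk => 𝒯.face_lt_top hd hK hk

/-! ### Cancellation of the normals on interior faces -/

/-- The `d` positive coordinates at `x` are the same in `L`, so `L` contains these `d` vertices and
just one more, whose coordinate must vanish at `x`. -/
lemma mem_openFace_of_mem {K L : Finset (E d)} (hK : K ∈ 𝒯.cells) (hL : L ∈ 𝒯.cells) {k x : E d}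
    (hk : k ∈ K) (hx : x ∈ openFace K k) (hxL : x ∈ convexHull ℝ (L : Set (E d))) :
    ∃ l ∈ L, x ∈ openFace L l := by
  classical
  have hb := 𝒯.bary_eq_of_mem hL hK hxL ((𝒯.isSimplex hK).openFace_subset hx)
  have hsub : K.erase k ⊆ L := by
    intro p hp
    by_contra hpL
    have := hb p
    rw [bary_of_notMem hpL] at this
    exact (hx.2 p (Finset.mem_of_mem_erase hp) (Finset.ne_of_mem_erase hp)).ne this
  have hcard : (K.erase k).card < L.card := by
    rw [Finset.card_erase_of_mem hk, 𝒯.card_cell K hK, 𝒯.card_cell L hL]; omega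
  obtain ⟨q, hqL, hq⟩ := Finset.exists_mem_notMem_of_card_lt_card hcard
  have hL' : L = insert q (K.erase k) := by
    refine (Finset.eq_of_subset_of_card_le (Finset.insert_subset hqL hsub) ?_).symm
    rw [Finset.card_insert_of_notMem hq, Finset.card_erase_of_mem hk, 𝒯.card_cell K hK,
      𝒯.card_cell L hL]; omega
  refine ⟨q, hqL, ?_, fun p hp hpq => ?_⟩
  · rw [hb]
    by_cases hqk : q = k
    · rw [hqk, hx.1]
    · rw [bary_of_notMem fun h => hq (Finset.mem_erase.2 ⟨hqk, h⟩)]; rfl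
  · rw [hb]
    have hp' : p ∈ K.erase k := by
      rw [hL'] at hp
      exact (Finset.mem_insert.1 hp).resolve_left hpq
    exact hx.2 p (Finset.mem_of_mem_erase hp') (Finset.ne_of_mem_erase hp')

lemma openFace_unique {K : Finset (E d)} {k l x : E d} (hk : k ∈ K)
    (hxk : x ∈ openFace K k) (hxl : x ∈ openFace K l) : k = l := by
  by_contra h
  exact (hxl.2 k hk h).ne' hxk.1

/-- If the two unit normals were not opposite, a small step along minus their sum would enter both
open cells, which are disjoint. -/
lemma faceNormal_eq_neg (hd : d ≠ 0) {K L : Finset (E d)} (hK : K ∈ 𝒯.cells) (hL : L ∈ 𝒯.cells)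
    (hKL : K ≠ L) {k l x : E d} (hk : k ∈ K) (hl : l ∈ L) (hxk : x ∈ openFace K k)
    (hxl : x ∈ openFace L l) : faceNormal K k = -faceNormal L l := by
  have hev := ((𝒯.isSimplex hK).eventually_mem_iff hd hk hxk).and
    ((𝒯.isSimplex hL).eventually_mem_iff hd hl hxl)
  obtain ⟨s, hs, ⟨-, h1⟩, -, h2⟩ :=
    exists_pos_smul_of_eventually hev (-(faceNormal K k + faceNormal L l))
  have hn := (𝒯.isSimplex hK).norm_faceNormal hd hk
  have hn' := (𝒯.isSimplex hL).norm_faceNormal hd hl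
  rw [← inner_eq_neg_one_iff_of_norm_eq_one (𝕜 := ℝ) hn hn']
  simp only [add_sub_cancel_left, real_inner_smul_left, inner_neg_left, inner_add_left,
    real_inner_self_eq_norm_sq, hn, hn', real_inner_comm (faceNormal K k) (faceNormal L l)]
    at h1 h2
  by_contra hne
  have hge := neg_le_of_abs_le (abs_real_inner_le_norm (faceNormal K k) (faceNormal L l))
  rw [hn, hn', mul_one] at hge
  have hlt : -1 < ⟪faceNormal K k, faceNormal L l⟫ := lt_of_le_of_ne hge (Ne.symm hne)
  have e1 := h1.2 (by nlinarith)
  have e2 := h2.2 (by nlinarith)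
  exact hKL (𝒯.eq_of_mem_openCell hK hL e1 ((𝒯.isSimplex hL).openCell_subset e2))

/-- Cells not containing `x` are closed and stay away from it, while the others have an open face
through `x` and look like half-spaces there. -/
lemma eventually_mem_closure_iff (hd : d ≠ 0) {K : Finset (E d)} (hK : K ∈ 𝒯.cells) {k x : E d}
    (hk : k ∈ K) (hx : x ∈ openFace K k) :
    ∀ᶠ y in 𝓝 x, (y ∈ closure Ω ↔ ∃ L ∈ 𝒯.cells, ∃ l ∈ L, x ∈ openFace L l ∧
      ⟪y - x, faceNormal L l⟫ ≤ 0) := by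
  have hev : ∀ᶠ y in 𝓝 x, ∀ L ∈ 𝒯.cells, (y ∈ convexHull ℝ (L : Set (E d)) ↔
      ∃ l ∈ L, x ∈ openFace L l ∧ ⟪y - x, faceNormal L l⟫ ≤ 0) := by
    refine (Finset.eventually_all 𝒯.cells).2 fun L hL => ?_
    by_cases hxL : x ∈ convexHull ℝ (L : Set (E d))
    · obtain ⟨l, hl, hxl⟩ := 𝒯.mem_openFace_of_mem hK hL hk hx hxL
      filter_upwards [(𝒯.isSimplex hL).eventually_mem_iff hd hl hxl] with y hy
      rw [hy.1]
      refine ⟨fun h => ⟨l, hl, hxl, h⟩, ?_⟩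
      rintro ⟨l', hl', hxl', h⟩
      rwa [openFace_unique hl hxl hxl']
    · filter_upwards [isCompact_simplex.isClosed.isOpen_compl.mem_nhds hxL] with y hy
      refine ⟨fun h => absurd h hy, ?_⟩
      rintro ⟨l', hl', hxl', h⟩
      exact absurd ((𝒯.isSimplex hL).openFace_subset hxl') hxL
  filter_upwards [hev] with y hy
  rw [𝒯.mem_closure_iff]
  exact exists_congr fun L => and_congr_right fun hL => hy L hL

/-- Either exactly two cells meet at `x`, with opposite normals, and `x` is interior; or `K` is
alone there, the domain is its half-space near `x`, and the face normal is the outward normal. This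
pointwise identity assembles the divergence theorems of the cells. -/
lemma sum_faceNormal (hd : d ≠ 0) (hreg : interior (closure Ω) = Ω) {K : Finset (E d)}
    (hK : K ∈ 𝒯.cells) {k x : E d} (hk : k ∈ K) (hx : x ∈ openFace K k) :
    ∑ L ∈ 𝒯.cells, ∑ l ∈ L, (openFace L l).indicator (fun _ => faceNormal L l) x =
      (frontier Ω).indicator (outwardNormal Ω) x := by
  classical
  have hΩ : IsOpen Ω := hreg ▸ isOpen_interior
  have hev := 𝒯.eventually_mem_closure_iff hd hK hk hx
  have hinner : ∀ L ∈ 𝒯.cells, ∀ l ∈ L, x ∈ openFace L l →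
      ∑ l' ∈ L, (openFace L l').indicator (fun _ => faceNormal L l') x = faceNormal L l := by
    intro L _ l hl hxl
    rw [Finset.sum_eq_single l, indicator_of_mem hxl]
    · intro l' hl' hne
      exact indicator_of_notMem (fun h => hne (openFace_unique hl' h hxl)) _
    · exact fun h => absurd hl h
  have hinner0 : ∀ L ∈ 𝒯.cells, (∀ l ∈ L, x ∉ openFace L l) →
      ∑ l' ∈ L, (openFace L l').indicator (fun _ => faceNormal L l') x = 0 := fun L _ h =>
    Finset.sum_eq_zero fun l' hl' => indicator_of_notMem (h l' hl') _
  have hxcl : x ∈ closure Ω := 𝒯.cell_subset hK ((𝒯.isSimplex hK).openFace_subset hx)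
  by_cases hother : ∃ L ∈ 𝒯.cells, L ≠ K ∧ ∃ l ∈ L, x ∈ openFace L l
  · obtain ⟨L, hL, hLK, l, hl, hxl⟩ := hother
    have hneg := 𝒯.faceNormal_eq_neg hd hL hK hLK hl hk hxl hx
    -- The two opposite closed half-spaces together cover a neighbourhood of `x`.
    have hxΩ : x ∈ Ω := by
      rw [← hreg, mem_interior_iff_mem_nhds]
      filter_upwards [hev] with y hy
      rw [hy]
      rcases le_total ⟪y - x, faceNormal K k⟫ 0 with h | h
      · exact ⟨K, hK, k, hk, hx, h⟩
      · exact ⟨L, hL, l, hl, hxl, by rw [hneg, inner_neg_right]; linarith⟩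
    have hxf : x ∉ frontier Ω := fun h => by
      rw [hΩ.frontier_eq] at h; exact h.2 hxΩ
    rw [indicator_of_notMem hxf, ← Finset.add_sum_erase _ _ hK,
      ← Finset.add_sum_erase _ _ (Finset.mem_erase.2 ⟨hLK, hL⟩), hinner K hK k hk hx,
      hinner L hL l hl hxl, Finset.sum_eq_zero, hneg]
    · simp
    · intro J hJ
      simp only [Finset.mem_erase] at hJ
      refine hinner0 J hJ.2.2 fun j hj hxj => ?_
      have e1 := 𝒯.faceNormal_eq_neg hd hJ.2.2 hL hJ.1 hj hl hxj hxl
      have e2 := 𝒯.faceNormal_eq_neg hd hJ.2.2 hK hJ.2.1 hj hk hxj hx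
      -- A third normal would be opposite to both of two opposite unit vectors.
      have e3 : faceNormal K k = 0 := by
        rw [hneg, neg_neg] at e1
        have e4 := eq_neg_iff_add_eq_zero.1 (e1.symm.trans e2)
        exact (smul_eq_zero.1 ((two_smul ℝ _).trans e4)).resolve_left two_ne_zero
      have := (𝒯.isSimplex hK).norm_faceNormal hd hk
      rw [e3, norm_zero] at this
      exact zero_ne_one this
  · have honly : ∀ L ∈ 𝒯.cells, L ≠ K → ∀ l ∈ L, x ∉ openFace L l := fun L hL hne l hl hxl =>
      hother ⟨L, hL, hne, l, hl, hxl⟩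
    rw [Finset.sum_eq_single K (fun L hL hne => hinner0 L hL (honly L hL hne))
      (fun h => absurd hK h), hinner K hK k hk hx]
    have hev' : ∀ᶠ y in 𝓝 x, (y ∈ closure Ω ↔ ⟪y - x, faceNormal K k⟫ ≤ 0) := by
      filter_upwards [hev] with y hy
      rw [hy]
      refine ⟨?_, fun h => ⟨K, hK, k, hk, hx, h⟩⟩
      rintro ⟨L, hL, l, hl, hxl, h⟩
      by_cases hLK : L = K
      · subst hLK
        rwa [openFace_unique hk hx hxl]
      · exact absurd hxl (honly L hL hLK l hl)
    have hn := (𝒯.isSimplex hK).norm_faceNormal hd hk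
    have hmem : ∀ᶠ y in 𝓝 x, (y ∈ Ω ↔ ⟪y - x, faceNormal K k⟫ < 0) := by
      filter_upwards [hev'.eventually_nhds] with y hy
      constructor
      · intro hyΩ
        refine lt_of_le_of_ne (hy.self_of_nhds.1 (subset_closure hyΩ)) fun h0 => ?_
        -- A point of the open set `Ω` on the hyperplane could be moved outwards inside `Ω`, out of
        -- the half-space containing the closure.
        obtain ⟨s, hs, hs1, hs2⟩ := exists_pos_smul_of_eventually
          (hy.and (hΩ.mem_nhds hyΩ)) (faceNormal K k)
        have h1 := hs1.1 (subset_closure hs2)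
        rw [show y + s • faceNormal K k - x = (y - x) + s • faceNormal K k by abel,
          inner_add_left, h0, real_inner_smul_left, real_inner_self_eq_norm_sq, hn] at h1
        linarith
      · intro hlt
        rw [← hreg, mem_interior_iff_mem_nhds]
        have hopen : ∀ᶠ z in 𝓝 y, ⟪z - x, faceNormal K k⟫ < 0 :=
          (isOpen_lt ((continuous_id.sub continuous_const).inner continuous_const)
            continuous_const).mem_nhds hlt
        filter_upwards [hy, hopen] with z hz hz' using hz.2 hz'.le
    have hxf : x ∈ frontier Ω := by
      rw [hΩ.frontier_eq]
      refine ⟨hxcl, fun h => ?_⟩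
      have := hmem.self_of_nhds.1 h
      simp at this
    obtain ⟨r, hr, hball⟩ := Metric.eventually_nhds_iff_ball.1 hmem
    have hnormal : IsOutwardNormal Ω x (faceNormal K k) := ⟨hxf, hn, r, hr, hball⟩
    rw [indicator_of_mem hxf, hnormal.outwardNormal_eq]

end Geometry

end Triangulation

end AFC

end

/-! ### Integrability of the forms and coercivity of advection -/

noncomputable section

namespace AFC

open Filter Topology

namespace Triangulation

section Forms

variable {d : ℕ} {Ω : Set (E d)} (𝒯 : Triangulation Ω) {M : ℝ} {b : E d → E d}

lemma abs_hat_le_one (i : 𝒯.Node) (x : E d) : |𝒯.hat i x| ≤ 1 := by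
  rw [abs_of_nonneg (𝒯.hat_nonneg i x)]; exact 𝒯.hat_le_one i x

lemma abs_fe_le (v : 𝒯.Node → ℝ) (x : E d) : |𝒯.fe v x| ≤ ∑ i, |v i| := by
  refine (Finset.abs_sum_le_sum_abs _ _).trans (Finset.sum_le_sum fun i _ => ?_)
  rw [abs_mul]
  exact mul_le_of_le_one_right (abs_nonneg _) (𝒯.abs_hat_le_one i x)

/-! ### Integrability -/

lemma measurable_gradient (f : E d → ℝ) : Measurable (gradient f) :=
  (InnerProductSpace.toDual ℝ (E d)).symm.continuous.measurable.comp (measurable_fderiv ℝ f)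

lemma gradient_fe_ae (hΩ : IsOpen Ω) (v : 𝒯.Node → ℝ) :
    ∀ᵐ x ∂(volume.restrict Ω), gradient (𝒯.fe v) x = ∑ i, v i • gradient (𝒯.hat i) x := by
  classical
  filter_upwards [𝒯.ae_mem_openCell hΩ] with x ⟨K, hK, hx⟩
  have h : ∀ i, gradient (𝒯.hat i) x = baryGrad K i := fun i => by
    rw [← 𝒯.fe_single, (𝒯.hasGradientAt_fe hK hx _).gradient, cellGrad, Finset.sum_eq_single i]
    · simp
    · intro j _ hj; simp [Pi.single_eq_of_ne hj]
    · simp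
  simp_rw [h]
  exact (𝒯.hasGradientAt_fe hK hx v).gradient

/-- A bound for the gradient of a finite element function. -/
def gradBound (v : 𝒯.Node → ℝ) : ℝ := ∑ K ∈ 𝒯.cells, ‖𝒯.cellGrad K v‖

lemma norm_gradient_fe_le (hΩ : IsOpen Ω) (v : 𝒯.Node → ℝ) :
    ∀ᵐ x ∂(volume.restrict Ω), ‖gradient (𝒯.fe v) x‖ ≤ 𝒯.gradBound v := by
  filter_upwards [𝒯.ae_mem_openCell hΩ] with x ⟨K, hK, hx⟩
  rw [(𝒯.hasGradientAt_fe hK hx v).gradient]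
  exact Finset.single_le_sum (f := fun K => ‖𝒯.cellGrad K v‖) (fun _ _ => norm_nonneg _) hK

lemma norm_gradient_hat_le (hΩ : IsOpen Ω) :
    ∃ G : ℝ, 0 ≤ G ∧ ∀ i, ∀ᵐ x ∂(volume.restrict Ω), ‖gradient (𝒯.hat i) x‖ ≤ G := by
  classical
  refine ⟨∑ i, 𝒯.gradBound (Pi.single i 1), Finset.sum_nonneg fun i _ =>
    Finset.sum_nonneg fun _ _ => norm_nonneg _, fun i => ?_⟩
  filter_upwards [𝒯.norm_gradient_fe_le hΩ (Pi.single i 1)] with x hx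
  rw [𝒯.fe_single] at hx
  exact hx.trans (Finset.single_le_sum (f := fun i => 𝒯.gradBound (Pi.single i 1))
    (fun i _ => Finset.sum_nonneg fun _ _ => norm_nonneg _) (Finset.mem_univ i))

lemma integrableOn_advection (hΩ : IsOpen Ω) (hb : ContinuousOn b (closure Ω))
    (hM : ∀ x ∈ closure Ω, ‖b x‖ ≤ M) (v w : 𝒯.Node → ℝ) :
    IntegrableOn (fun x => 𝒯.fe w x * ⟪b x, gradient (𝒯.fe v) x⟫) Ω := by
  refine IntegrableOn.of_bound 𝒯.volume_domain_lt_top ?_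
    ((∑ i, |w i|) * (|M| * 𝒯.gradBound v)) ?_
  · have hbm : AEStronglyMeasurable b (volume.restrict Ω) :=
      (hb.mono subset_closure).aestronglyMeasurable hΩ.measurableSet
    exact (𝒯.measurable_fe w).aestronglyMeasurable.mul
      (hbm.inner (measurable_gradient _).aestronglyMeasurable)
  · filter_upwards [𝒯.norm_gradient_fe_le hΩ v, ae_restrict_mem hΩ.measurableSet] with x hx hxΩ
    rw [norm_mul]
    refine mul_le_mul (𝒯.abs_fe_le w x) ?_ (norm_nonneg _)
      (Finset.sum_nonneg fun _ _ => abs_nonneg _)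
    exact (norm_inner_le_norm _ _).trans (mul_le_mul
      ((hM x (subset_closure hxΩ)).trans (le_abs_self M)) hx (norm_nonneg _) (abs_nonneg _))

lemma isFiniteMeasure_surface (𝒯 : Triangulation Ω) (hd : d ≠ 0)
    (hreg : interior (closure Ω) = Ω) : IsFiniteMeasure (surface Ω) :=
  ⟨𝒯.surface_lt_top hd hreg⟩

end Forms

end Triangulation

section Boundary

variable {d : ℕ} {Ω : Set (E d)} {M : ℝ} {b : E d → E d}

lemma abs_normalVelocity_le (hM : ∀ x ∈ closure Ω, ‖b x‖ ≤ M) {x : E d} (hx : x ∈ frontier Ω) :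
    |⟪b x, outwardNormal Ω x⟫| ≤ |M| := by
  refine (abs_real_inner_le_norm _ _).trans ?_
  exact (mul_le_of_le_one_right (norm_nonneg _) (norm_outwardNormal_le x)).trans
    ((hM x (frontier_subset_closure hx)).trans (le_abs_self M))

lemma aestronglyMeasurable_normalVelocity (hΩ : IsOpen Ω) (hb : ContinuousOn b (closure Ω)) :
    AEStronglyMeasurable (fun x => ⟪b x, outwardNormal Ω x⟫) (surface Ω) := by
  have hbm : AEStronglyMeasurable b (surface Ω) :=
    (hb.mono frontier_subset_closure).aestronglyMeasurable isClosed_frontier.measurableSet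
  exact hbm.inner (measurable_outwardNormal hΩ).aestronglyMeasurable

lemma integrableOn_inlet [IsFiniteMeasure (surface Ω)] (hΩ : IsOpen Ω)
    (hb : ContinuousOn b (closure Ω)) (hM : ∀ x ∈ closure Ω, ‖b x‖ ≤ M) {φ : E d → ℝ} {c : ℝ}
    (hφ : AEStronglyMeasurable φ ((surface Ω).restrict (inlet Ω b)))
    (hc : ∀ x ∈ inlet Ω b, |φ x| ≤ c) :
    IntegrableOn (fun x => φ x * ⟪b x, outwardNormal Ω x⟫) (inlet Ω b) (surface Ω) := by
  refine IntegrableOn.of_bound (measure_lt_top _ _) ?_ (c * |M|) ?_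
  · exact hφ.mul (aestronglyMeasurable_normalVelocity hΩ hb).restrict
  · filter_upwards [ae_restrict_mem (measurableSet_inlet hΩ hb)] with x hx
    rw [norm_mul]
    exact mul_le_mul (hc x hx) (abs_normalVelocity_le hM hx.1) (norm_nonneg _)
      ((abs_nonneg _).trans (hc x hx))

lemma aestronglyMeasurable_inflow (hΩ : IsOpen Ω) (hb : ContinuousOn b (closure Ω)) {g : E d → ℝ}
    (hg : ContinuousOn g (closure (inlet Ω b))) :
    AEStronglyMeasurable g ((surface Ω).restrict (inlet Ω b)) :=
  (hg.mono subset_closure).aestronglyMeasurable (measurableSet_inlet hΩ hb)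

end Boundary

namespace Triangulation

section Coercivity

variable {d : ℕ} {Ω : Set (E d)} (𝒯 : Triangulation Ω) {M : ℝ} {b : E d → E d}

/-- The advection form is bounded below by the inflow through the inlet. -/
lemma inlet_le_advection (hd : d ≠ 0) (hreg : interior (closure Ω) = Ω)
    (hb : IsSolenoidalW1Inf Ω M b) (v : 𝒯.Node → ℝ) :
    1 / 2 * ∫ x in inlet Ω b, 𝒯.fe v x * 𝒯.fe v x * ⟪b x, outwardNormal Ω x⟫ ∂(surface Ω) ≤
      ∫ x in Ω, 𝒯.fe v x * ⟪b x, gradient (𝒯.fe v) x⟫ := by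
  classical
  have hΩ : IsOpen Ω := hreg ▸ isOpen_interior
  have hbc := hb.1
  have hM := hb.2.1
  have := 𝒯.isFiniteMeasure_surface hd hreg
  set H : Measure (E d) := Measure.euclideanHausdorffMeasure (d - 1) with hH
  let f : Finset (E d) → E d → E d → ℝ := fun K k x =>
    𝒯.cellFun K v x ^ 2 * ⟪b x, faceNormal K k⟫
  -- The integrand is half the derivative of `v²` in the direction `b`. On a cell `v` is affine and
  -- extends smoothly to the whole space, so the divergence theorem applies with `ψ = v²`.
  have hcell : ∀ K ∈ 𝒯.cells, ∫ x in openCell K, 𝒯.fe v x * ⟪b x, gradient (𝒯.fe v) x⟫ =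
      1 / 2 * ∑ k ∈ K, ∫ x in openFace K k, f K k x ∂H := by
    intro K hK
    have hdiv := (𝒯.isSimplex hK).integral_divergence hd (hbc.mono (𝒯.cell_subset hK))
      (fun φ hφ hc hs => by
        have h0 := hb.integral_fderiv_eq_zero hΩ hφ hc
          (hs.trans (openCell_subset_domain hreg hK))
        rw [← h0]
        refine (setIntegral_eq_of_subset_of_forall_sdiff_eq_zero hΩ.measurableSet
          (openCell_subset_domain hreg hK) fun x hx => ?_).symm
        have : fderiv ℝ φ x = 0 := by
          by_contra h
          exact hx.2 (hs (support_fderiv_subset ℝ h))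
        rw [this]; rfl)
      ((𝒯.contDiff_cellFun K v).pow 2)
    rw [← hdiv, ← integral_const_mul]
    refine setIntegral_congr_fun isOpen_openCell.measurableSet fun x hx => ?_
    have hg := 𝒯.hasGradientAt_cellFun K v x
    have h1 : HasFDerivAt (fun x => 𝒯.cellFun K v x ^ 2) _ x := hg.hasFDerivAt.pow 2
    simp only [(𝒯.hasGradientAt_fe hK hx v).gradient,
      𝒯.fe_eq hK ((𝒯.isSimplex hK).openCell_subset hx), h1.fderiv, smul_apply,
      InnerProductSpace.toDual_apply_apply, smul_eq_mul, real_inner_comm]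
    simp
    ring
  have hfi : ∀ K ∈ 𝒯.cells, ∀ k ∈ K, IntegrableOn (f K k) (openFace K k) H := by
    intro K hK k hk
    have hfc : ContinuousOn (f K k) (convexHull ℝ (K : Set (E d))) :=
      ((𝒯.contDiff_cellFun K v (n := 0)).continuous.pow 2).continuousOn.mul
        ((hbc.mono (𝒯.cell_subset hK)).inner continuousOn_const)
    obtain ⟨c, hc⟩ := isCompact_simplex.exists_bound_of_continuousOn hfc
    have hsub := (𝒯.isSimplex hK).openFace_subset (k := k)
    refine IntegrableOn.of_bound ?_ ?_ c ?_
    · have hsub' : openFace K k ⊆ {x ∈ convexHull ℝ (K : Set (E d)) | bary K k x = 0} :=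
        fun x hx => ⟨hsub hx, hx.1⟩
      exact (measure_mono hsub').trans_lt (𝒯.face_lt_top hd hK hk)
    · exact (hfc.mono hsub).aestronglyMeasurable (measurableSet_openFace k)
    · filter_upwards [ae_restrict_mem (measurableSet_openFace k)] with x hx using hc x (hsub hx)
  have hfi' : ∀ K ∈ 𝒯.cells, ∀ k ∈ K, Integrable ((openFace K k).indicator (f K k)) H :=
    fun K hK k hk => (integrable_indicator_iff (measurableSet_openFace k)).2 (hfi K hK k hk)
  have hsum : ∑ K ∈ 𝒯.cells, ∑ k ∈ K, ∫ x in openFace K k, f K k x ∂H =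
      ∫ x, ∑ K ∈ 𝒯.cells, ∑ k ∈ K, (openFace K k).indicator (f K k) x ∂H := by
    rw [integral_finsetSum _ fun K hK => integrable_finsetSum _ fun k hk => hfi' K hK k hk]
    refine Finset.sum_congr rfl fun K hK => ?_
    rw [integral_finsetSum _ fun k hk => hfi' K hK k hk]
    exact Finset.sum_congr rfl fun k _ =>
      (integral_indicator (measurableSet_openFace k)).symm
  rw [𝒯.integral_eq_sum_cells hreg (𝒯.integrableOn_advection hΩ hbc hM v v),
    Finset.sum_congr rfl hcell, ← Finset.mul_sum, hsum, restrict_surface_inlet,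
    ← integral_indicator (measurableSet_inlet hΩ hbc)]
  -- After summation both sides are integrals against the same Hausdorff measure, and a pointwise
  -- comparison suffices: the right-hand side only has the nonnegative outflow in addition.
  refine mul_le_mul_of_nonneg_left (integral_mono ?_ ?_ fun x => ?_) (by norm_num)
  · rw [integrable_indicator_iff (measurableSet_inlet hΩ hbc), IntegrableOn,
      ← restrict_surface_inlet]
    refine integrableOn_inlet hΩ hbc hM (c := (∑ i, |v i|) * (∑ i, |v i|))
      ((𝒯.measurable_fe v).mul (𝒯.measurable_fe v)).aestronglyMeasurable fun x _ => ?_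
    rw [abs_mul]
    exact mul_le_mul (𝒯.abs_fe_le v x) (𝒯.abs_fe_le v x) (abs_nonneg _)
      (Finset.sum_nonneg fun _ _ => abs_nonneg _)
  · exact integrable_finsetSum _ fun K hK => integrable_finsetSum _ fun k hk => hfi' K hK k hk
  · have hneg : ∀ x ∈ inlet Ω b, 𝒯.fe v x * 𝒯.fe v x * ⟪b x, outwardNormal Ω x⟫ ≤ 0 :=
      fun x hx => mul_nonpos_of_nonneg_of_nonpos (mul_self_nonneg _) hx.2.le
    by_cases hS : ∃ K ∈ 𝒯.cells, ∃ k ∈ K, x ∈ openFace K k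
    · have hpt : ∀ K ∈ 𝒯.cells, ∀ k ∈ K, (openFace K k).indicator (f K k) x =
          𝒯.fe v x ^ 2 * ⟪b x, (openFace K k).indicator (fun _ => faceNormal K k) x⟫ := by
        intro K hK k hk
        by_cases hx : x ∈ openFace K k
        · rw [indicator_of_mem hx, indicator_of_mem hx,
            𝒯.fe_eq hK ((𝒯.isSimplex hK).openFace_subset hx)]
        · rw [indicator_of_notMem hx, indicator_of_notMem hx, inner_zero_right, mul_zero]
      have htot : ∑ K ∈ 𝒯.cells, ∑ k ∈ K, (openFace K k).indicator (f K k) x =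
          𝒯.fe v x ^ 2 * ⟪b x, (frontier Ω).indicator (outwardNormal Ω) x⟫ := by
        obtain ⟨K, hK, k, hk, hx⟩ := hS
        rw [← 𝒯.sum_faceNormal hd hreg hK hk hx, inner_sum, Finset.mul_sum]
        refine Finset.sum_congr rfl fun L hL => ?_
        rw [inner_sum, Finset.mul_sum]
        exact Finset.sum_congr rfl fun l hl => hpt L hL l hl
      simp only
      rw [htot]
      by_cases hxi : x ∈ inlet Ω b
      · rw [indicator_of_mem hxi, indicator_of_mem hxi.1, sq]
      · rw [indicator_of_notMem hxi]
        by_cases hxf : x ∈ frontier Ω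
        · rw [indicator_of_mem hxf]
          exact mul_nonneg (sq_nonneg _) (not_lt.1 fun h => hxi ⟨hxf, h⟩)
        · rw [indicator_of_notMem hxf, inner_zero_right, mul_zero]
    -- At points on no open face the sum over faces is zero and the inlet integrand is at most zero.
    -- Hence lower-dimensional edges need not be shown to be null sets.
    · push Not at hS
      simp only
      rw [Finset.sum_eq_zero fun K hK => Finset.sum_eq_zero fun k hk =>
        indicator_of_notMem (hS K hK k hk) _]
      exact indicator_nonpos hneg x

/-- The contributions of advection and inflow to the energy balance. -/
lemma inflow_sub_advection_le (hd : d ≠ 0) (hreg : interior (closure Ω) = Ω)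
    (hb : IsSolenoidalW1Inf Ω M b) {g : E d → ℝ} {B : ℝ}
    (hg : ContinuousOn g (closure (inlet Ω b)))
    (hB : ∀ x ∈ closure (inlet Ω b), |g x| ≤ B) (v : 𝒯.Node → ℝ) :
    2 * bForm Ω b g (𝒯.fe v) - 2 * aForm Ω b (𝒯.fe v) (𝒯.fe v) ≤
      |M| * (surface Ω univ).toReal * B ^ 2 := by
  have hΩ : IsOpen Ω := hreg ▸ isOpen_interior
  have hbc := hb.1
  have hM := hb.2.1
  have := 𝒯.isFiniteMeasure_surface hd hreg
  have hcoer := 𝒯.inlet_le_advection hd hreg hb v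
  have hv0 : 0 ≤ ∑ i, |v i| := Finset.sum_nonneg fun _ _ => abs_nonneg _
  have hi1 : IntegrableOn (fun x => 𝒯.fe v x * 𝒯.fe v x * ⟪b x, outwardNormal Ω x⟫)
      (inlet Ω b) (surface Ω) := by
    refine integrableOn_inlet hΩ hbc hM (c := (∑ i, |v i|) * (∑ i, |v i|))
      ((𝒯.measurable_fe v).mul (𝒯.measurable_fe v)).aestronglyMeasurable fun x _ => ?_
    rw [abs_mul]
    exact mul_le_mul (𝒯.abs_fe_le v x) (𝒯.abs_fe_le v x) (abs_nonneg _) hv0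
  have hi2 : IntegrableOn (fun x => 𝒯.fe v x * g x * ⟪b x, outwardNormal Ω x⟫)
      (inlet Ω b) (surface Ω) := by
    refine integrableOn_inlet hΩ hbc hM (c := (∑ i, |v i|) * B)
      ((𝒯.measurable_fe v).aestronglyMeasurable.mul (aestronglyMeasurable_inflow hΩ hbc hg))
      fun x hx => ?_
    rw [abs_mul]
    exact mul_le_mul (𝒯.abs_fe_le v x) (hB x (subset_closure hx)) (abs_nonneg _) hv0
  -- Completing the square: with `s = b⬝n < 0`, `v² s - 2 v g s = (v - g)² s - g² s ≤ g² |s|`.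
  have hle : ∫ x in inlet Ω b, (𝒯.fe v x * 𝒯.fe v x * ⟪b x, outwardNormal Ω x⟫
      - 2 * (𝒯.fe v x * g x * ⟪b x, outwardNormal Ω x⟫)) ∂(surface Ω) ≤
      ∫ x in inlet Ω b, |M| * B ^ 2 ∂(surface Ω) := by
    refine setIntegral_mono_on (hi1.sub (hi2.const_mul 2)) integrableOn_const
      (measurableSet_inlet hΩ hbc) fun x hx => ?_
    have h1 : ⟪b x, outwardNormal Ω x⟫ < 0 := hx.2
    have h2 := abs_normalVelocity_le hM hx.1
    rw [abs_of_neg h1] at h2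
    have h3 : g x ^ 2 ≤ B ^ 2 := by
      rw [← sq_abs]
      exact pow_le_pow_left₀ (abs_nonneg _) (hB x (subset_closure hx)) 2
    have h4 : g x ^ 2 * -⟪b x, outwardNormal Ω x⟫ ≤ B ^ 2 * |M| :=
      mul_le_mul h3 h2 (by linarith) (sq_nonneg _)
    nlinarith [mul_nonneg (sq_nonneg (𝒯.fe v x - g x)) (neg_nonneg.2 h1.le)]
  rw [integral_sub hi1 (hi2.const_mul 2), integral_const_mul, setIntegral_const, smul_eq_mul] at hle
  have hmeas : (surface Ω).real (inlet Ω b) ≤ (surface Ω univ).toReal :=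
    measureReal_mono (subset_univ _)
  have h5 : (surface Ω).real (inlet Ω b) * (|M| * B ^ 2) ≤
      (surface Ω univ).toReal * (|M| * B ^ 2) :=
    mul_le_mul_of_nonneg_right hmeas (by positivity)
  simp only [aForm, bForm]
  linarith

end Coercivity

end Triangulation

end AFC

end

/-! ### Mass and diffusion forms, and the energy estimate -/

noncomputable section

namespace AFC

open Filter Topology

namespace Triangulation

section Matrices

variable {d : ℕ} {Ω : Set (E d)} (𝒯 : Triangulation Ω)

/-! ### Mass matrix -/

lemma integrableOn_hat (i : 𝒯.Node) : IntegrableOn (𝒯.hat i) Ω :=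
  IntegrableOn.of_bound 𝒯.volume_domain_lt_top (𝒯.measurable_hat i).aestronglyMeasurable 1
    (Eventually.of_forall fun x => 𝒯.abs_hat_le_one i x)

lemma integrableOn_hat_mul (i j : 𝒯.Node) : IntegrableOn (fun x => 𝒯.hat i x * 𝒯.hat j x) Ω := by
  refine IntegrableOn.of_bound 𝒯.volume_domain_lt_top
    ((𝒯.measurable_hat i).mul (𝒯.measurable_hat j)).aestronglyMeasurable 1
    (Eventually.of_forall fun x => ?_)
  rw [norm_mul]
  exact mul_le_one₀ (𝒯.abs_hat_le_one i x) (norm_nonneg _) (𝒯.abs_hat_le_one j x)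

lemma mass_comm (i j : 𝒯.Node) : 𝒯.mass i j = 𝒯.mass j i := by
  simp only [mass, mul_comm]

lemma mass_nonneg (i j : 𝒯.Node) : 0 ≤ 𝒯.mass i j :=
  integral_nonneg fun x => mul_nonneg (𝒯.hat_nonneg i x) (𝒯.hat_nonneg j x)

lemma lumped_eq (hΩ : IsOpen Ω) (i : 𝒯.Node) : 𝒯.lumped i = ∫ x in Ω, 𝒯.hat i x := by
  rw [lumped]
  simp only [mass]
  rw [← integral_finsetSum _ fun j _ => 𝒯.integrableOn_hat_mul i j]
  refine setIntegral_congr_fun hΩ.measurableSet fun x hx => ?_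
  simp only [← Finset.mul_sum, 𝒯.sum_hat (subset_closure hx), mul_one]

lemma lumped_nonneg (i : 𝒯.Node) : 0 ≤ 𝒯.lumped i :=
  Finset.sum_nonneg fun j _ => 𝒯.mass_nonneg i j

lemma sum_lumped (hΩ : IsOpen Ω) : ∑ i, 𝒯.lumped i = (volume Ω).toReal := by
  simp_rw [𝒯.lumped_eq hΩ]
  rw [← integral_finsetSum _ fun j _ => 𝒯.integrableOn_hat j,
    setIntegral_congr_fun hΩ.measurableSet fun x hx => 𝒯.sum_hat (subset_closure hx),
    setIntegral_const, smul_eq_mul, mul_one, Measure.real]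

/-- The hat function is positive near its vertex, and the vertex lies in the closure of `Ω`, so it
is positive on a nonempty open subset of `Ω`. -/
lemma mass_self_pos (hΩ : IsOpen Ω) (i : 𝒯.Node) : 0 < 𝒯.mass i i := by
  rw [mass, setIntegral_pos_iff_support_of_nonneg_ae
    (Eventually.of_forall fun x => mul_self_nonneg _) (𝒯.integrableOn_hat_mul i i)]
  have hev : ∀ᶠ x in 𝓝[closure Ω] (i : E d), 0 < 𝒯.hat i x := by
    refine (𝒯.continuousOn_hat i i (𝒯.node_mem_closure i)).eventually (lt_mem_nhds ?_)
    rw [𝒯.hat_self]; exact one_pos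
  obtain ⟨U, hU, hiU, hsub⟩ := mem_nhdsWithin.1 hev
  have hne : (U ∩ Ω).Nonempty := _root_.mem_closure_iff.1 (𝒯.node_mem_closure i) U hU hiU
  refine ((hU.inter hΩ).measure_pos volume hne).trans_le (measure_mono fun x hx => ⟨?_, hx.2⟩)
  exact (mul_self_pos.2 (hsub ⟨hx.1, subset_closure hx.2⟩).ne').ne'

lemma lumped_pos (hΩ : IsOpen Ω) (i : 𝒯.Node) : 0 < 𝒯.lumped i :=
  (𝒯.mass_self_pos hΩ i).trans_le
    (Finset.single_le_sum (fun j _ => 𝒯.mass_nonneg i j) (Finset.mem_univ i))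

/-- Jensen's inequality for the weights `φ_i(x)`, obtained by expanding the nonnegative variance. -/
lemma sq_fe_le (v : 𝒯.Node → ℝ) {x : E d} (hx : x ∈ closure Ω) :
    𝒯.fe v x ^ 2 ≤ ∑ i, v i ^ 2 * 𝒯.hat i x := by
  have h := Finset.sum_nonneg fun i (_ : i ∈ Finset.univ) =>
    mul_nonneg (sq_nonneg (v i - 𝒯.fe v x)) (𝒯.hat_nonneg i x)
  have e : ∑ i, (v i - 𝒯.fe v x) ^ 2 * 𝒯.hat i x = ∑ i, v i ^ 2 * 𝒯.hat i x
      - 2 * 𝒯.fe v x * ∑ i, v i * 𝒯.hat i x + 𝒯.fe v x ^ 2 * ∑ i, 𝒯.hat i x := by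
    rw [Finset.mul_sum, Finset.mul_sum, ← Finset.sum_sub_distrib, ← Finset.sum_add_distrib]
    exact Finset.sum_congr rfl fun i _ => by ring
  rw [e, 𝒯.sum_hat hx, show ∑ i, v i * 𝒯.hat i x = 𝒯.fe v x from rfl] at h
  nlinarith

lemma integral_sq_fe_le (hΩ : IsOpen Ω) (v : 𝒯.Node → ℝ) :
    ∫ x in Ω, 𝒯.fe v x ^ 2 ≤ ∑ i, 𝒯.lumped i * v i ^ 2 := by
  have hint : ∀ i, IntegrableOn (fun x => v i ^ 2 * 𝒯.hat i x) Ω := fun i =>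
    (𝒯.integrableOn_hat i).const_mul _
  calc ∫ x in Ω, 𝒯.fe v x ^ 2 ≤ ∫ x in Ω, ∑ i, v i ^ 2 * 𝒯.hat i x := by
        refine integral_mono_of_nonneg (Eventually.of_forall fun x => sq_nonneg _)
          (integrable_finsetSum _ fun i _ => hint i) ?_
        filter_upwards [ae_restrict_mem hΩ.measurableSet] with x hx
          using 𝒯.sq_fe_le v (subset_closure hx)
    _ = ∑ i, 𝒯.lumped i * v i ^ 2 := by
        rw [integral_finsetSum _ fun i _ => hint i]
        refine Finset.sum_congr rfl fun i _ => ?_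
        rw [integral_const_mul, 𝒯.lumped_eq hΩ, mul_comm]

lemma eLpNorm_fe_le (hΩ : IsOpen Ω) (v : 𝒯.Node → ℝ) {c : ℝ}
    (hc : ∑ i, 𝒯.lumped i * v i ^ 2 ≤ c) :
    eLpNorm (𝒯.fe v) 2 (volume.restrict Ω) ≤ ENNReal.ofReal (Real.sqrt c) := by
  have hint : Integrable (fun x => 𝒯.fe v x ^ 2) (volume.restrict Ω) := by
    refine IntegrableOn.of_bound 𝒯.volume_domain_lt_top
      ((𝒯.measurable_fe v).pow_const 2).aestronglyMeasurable ((∑ i, |v i|) ^ 2)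
      (Eventually.of_forall fun x => ?_)
    rw [norm_pow]
    exact pow_le_pow_left₀ (norm_nonneg _) (𝒯.abs_fe_le v x) 2
  have hmem : MemLp (𝒯.fe v) 2 (volume.restrict Ω) :=
    (memLp_two_iff_integrable_sq (𝒯.measurable_fe v).aestronglyMeasurable).2 hint
  rw [hmem.eLpNorm_eq_integral_rpow_norm (by norm_num) (by norm_num)]
  refine ENNReal.ofReal_le_ofReal ?_
  simp only [ENNReal.toReal_ofNat, Real.rpow_ofNat, Real.norm_eq_abs, sq_abs]
  rw [← one_div, ← Real.sqrt_eq_rpow]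
  exact Real.sqrt_le_sqrt ((𝒯.integral_sq_fe_le hΩ v).trans hc)

/-! ### Diffusion forms -/

lemma mem_stencil'_iff {i j : 𝒯.Node} : j ∈ 𝒯.stencil' i ↔ j ≠ i ∧ 𝒯.mass i j ≠ 0 := by
  simp [stencil', stencil]

lemma mem_stencil'_comm {i j : 𝒯.Node} : j ∈ 𝒯.stencil' i ↔ i ∈ 𝒯.stencil' j := by
  rw [mem_stencil'_iff, mem_stencil'_iff, 𝒯.mass_comm, ne_comm]

lemma dMat_of_ne (b : E d → E d) {i j : 𝒯.Node} (h : i ≠ j) :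
    𝒯.dMat b i j = max |𝒯.aMat b i j| |𝒯.aMat b j i| := by
  rw [dMat, if_neg h]

lemma dMat_comm (b : E d → E d) (i j : 𝒯.Node) (h : i ≠ j) : 𝒯.dMat b i j = 𝒯.dMat b j i := by
  rw [𝒯.dMat_of_ne b h, 𝒯.dMat_of_ne b h.symm, max_comm]

lemma dMat_nonneg (b : E d → E d) {i j : 𝒯.Node} (h : i ≠ j) : 0 ≤ 𝒯.dMat b i j := by
  rw [𝒯.dMat_of_ne b h]; exact (abs_nonneg _).trans (le_max_left _ _)

lemma abs_aMat_le_dMat (b : E d → E d) {i j : 𝒯.Node} (h : i ≠ j) :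
    |𝒯.aMat b i j| ≤ 𝒯.dMat b i j := by
  rw [𝒯.dMat_of_ne b h]; exact le_max_left _ _

/-- By symmetry the sum is half of `∑ c_ij (z_i - z_j)²`. -/
lemma diffusion_nonneg (c : 𝒯.Node → 𝒯.Node → ℝ)
    (hc : ∀ i, ∀ j ∈ 𝒯.stencil' i, c i j = c j i ∧ 0 ≤ c i j) (z : 𝒯.Node → ℝ) :
    0 ≤ ∑ i, z i * ∑ j ∈ 𝒯.stencil' i, c i j * (z i - z j) := by
  classical
  let C : 𝒯.Node → 𝒯.Node → ℝ := fun i j => if j ∈ 𝒯.stencil' i then c i j else 0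
  have hC0 : ∀ i j, 0 ≤ C i j := fun i j => by
    by_cases h : j ∈ 𝒯.stencil' i
    · simp only [C, if_pos h]; exact (hc i j h).2
    · simp only [C, if_neg h, le_refl]
  have hCs : ∀ i j, C i j = C j i := fun i j => by
    by_cases h : j ∈ 𝒯.stencil' i
    · simp only [C, if_pos h, if_pos (𝒯.mem_stencil'_comm.1 h), (hc i j h).1]
    · simp only [C, if_neg h, if_neg fun h' => h (𝒯.mem_stencil'_comm.1 h')]
  have h1 : ∑ i, z i * ∑ j ∈ 𝒯.stencil' i, c i j * (z i - z j) =
      ∑ i, ∑ j, C i j * (z i * (z i - z j)) := by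
    refine Finset.sum_congr rfl fun i _ => ?_
    rw [Finset.mul_sum, ← Finset.sum_subset (Finset.subset_univ (𝒯.stencil' i))]
    · exact Finset.sum_congr rfl fun j hj => by simp only [C, if_pos hj]; ring
    · intro j _ hj; simp only [C, if_neg hj, zero_mul]
  have h2 : ∑ i, ∑ j, C i j * (z i * (z i - z j)) = ∑ i, ∑ j, C i j * (z j * (z j - z i)) := by
    rw [Finset.sum_comm]
    exact Finset.sum_congr rfl fun i _ => Finset.sum_congr rfl fun j _ => by rw [hCs]
  have h3 : 0 ≤ ∑ i, ∑ j, C i j * (z i - z j) ^ 2 :=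
    Finset.sum_nonneg fun i _ => Finset.sum_nonneg fun j _ => mul_nonneg (hC0 i j) (sq_nonneg _)
  have h4 : ∑ i, ∑ j, C i j * (z i - z j) ^ 2 =
      ∑ i, ∑ j, C i j * (z i * (z i - z j)) + ∑ i, ∑ j, C i j * (z j * (z j - z i)) := by
    simp_rw [← Finset.sum_add_distrib]
    exact Finset.sum_congr rfl fun i _ => Finset.sum_congr rfl fun j _ => by ring
  rw [h1]
  linarith

lemma dForm_self_nonneg (b : E d → E d) {α : 𝒯.Node → 𝒯.Node → ℝ} (hα : 𝒯.IsCorrection α)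
    (v : 𝒯.Node → ℝ) : 0 ≤ 𝒯.dForm b α v v := by
  refine 𝒯.diffusion_nonneg (fun i j => (1 - α i j) * 𝒯.dMat b i j) (fun i j hj => ?_) v
  have hij : i ≠ j := (𝒯.mem_stencil'_iff.1 hj).1.symm
  refine ⟨by rw [(hα i j).1, 𝒯.dMat_comm b i j hij],
    mul_nonneg (sub_nonneg.2 (hα i j).2.2) (𝒯.dMat_nonneg b hij)⟩

lemma mForm_self_nonneg {β : 𝒯.Node → 𝒯.Node → ℝ} (hβ : 𝒯.IsCorrection β)
    (v : 𝒯.Node → ℝ) : 0 ≤ 𝒯.mForm β v v :=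
  𝒯.diffusion_nonneg (fun i j => β i j * 𝒯.mass i j) (fun i j _ =>
    ⟨by rw [(hβ i j).1, 𝒯.mass_comm], mul_nonneg (hβ i j).2.1 (𝒯.mass_nonneg i j)⟩) v

/-- The generalized coercivity condition makes the flux correction dissipative. -/
lemma GCC.mForm_le {γ h lam : ℝ} (hγ : γ ∈ Ioo (0 : ℝ) 1) (hh : 0 < h) (hlam : 0 ≤ lam)
    {b : E d → E d} {α β : 𝒯.Node → 𝒯.Node → ℝ} {v' v : 𝒯.Node → ℝ} (hα : 𝒯.IsCorrection α)
    (hβ : 𝒯.IsCorrection β) (hgcc : 𝒯.GCC γ h lam b α β v' v) :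
    𝒯.mForm β v' v ≤ 𝒯.dForm b α v v := by
  have h1 := 𝒯.dForm_self_nonneg b hα v
  -- If `lam = 0`, division by zero gives `0`, in accordance with the convention for the left side.
  have h2 : 0 ≤ γ * h / lam * 𝒯.mForm β v' v' :=
    mul_nonneg (div_nonneg (mul_nonneg hγ.1.le hh.le) hlam) (𝒯.mForm_self_nonneg hβ v')
  have h3 := mul_nonneg hγ.1.le h1
  rw [GCC] at hgcc
  linarith

end Matrices

/-! ### Stability -/

section Stability

variable {d : ℕ} {Ω : Set (E d)} (𝒯 : Triangulation Ω)

/-- With `w = u` in the scheme, `GCC.mForm_le` removes the correction terms and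
`inflow_sub_advection_le` bounds the rest. The lumped energy then grows at a rate of at most `c
B(t)²`, and no Gronwall argument is needed. -/
lemma energy_le (hd : d ≠ 0) (hreg : interior (closure Ω) = Ω) {T : ℝ} {a : ℝ → E d → E d} {M : ℝ}
    (ha : ∀ᵐ t ∂(volume.restrict (Ioo 0 T)), IsSolenoidalW1Inf Ω M (a t)) {uin : ℝ → E d → ℝ}
    {B : ℝ → ℝ} (hB : MemLp B 2 (volume.restrict (Ioo 0 T)))
    (huin : ∀ᵐ t ∂(volume.restrict (Ioo 0 T)), ContinuousOn (uin t) (closure (inlet Ω (a t))) ∧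
      ∀ x ∈ closure (inlet Ω (a t)), |uin t x| ≤ B t) {u0 : E d → ℝ} {U : ℝ}
    (hU : ∀ x ∈ closure Ω, |u0 x| ≤ U) {γ h lam : ℝ} (hγ : γ ∈ Ioo (0 : ℝ) 1) (hh : 0 < h)
    (hlam : 0 ≤ lam) {τ : ℝ} (hτ : τ ∈ Ioc 0 T) {α β : ℝ → 𝒯.Node → 𝒯.Node → ℝ}
    {u' u : ℝ → 𝒯.Node → ℝ}
    (hαβ : ∀ᵐ t ∂(volume.restrict (Ioo 0 τ)), 𝒯.IsCorrection (α t) ∧ 𝒯.IsCorrection (β t))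
    (hsol : 𝒯.IsSolution a uin u0 τ α β u' u)
    (hgcc : ∀ᵐ t ∂(volume.restrict (Ioo 0 τ)),
      𝒯.GCC γ h lam (a t) (α t) (β t) (u' t) (u t)) {t : ℝ} (ht : t ∈ Ico 0 τ) :
    ∑ i, 𝒯.lumped i * u t i ^ 2 ≤ U ^ 2 * (volume Ω).toReal +
      |M| * (surface Ω univ).toReal * ∫ s in Ioo 0 T, B s ^ 2 := by
  have hΩ : IsOpen Ω := hreg ▸ isOpen_interior
  set c := |M| * (surface Ω univ).toReal with hc
  have hc0 : 0 ≤ c := mul_nonneg (abs_nonneg _) ENNReal.toReal_nonneg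
  have hBi : Integrable (fun s => B s ^ 2) (volume.restrict (Ioo 0 T)) := hB.integrable_sq
  have hI0 : 0 ≤ ∫ s in Ioo 0 T, B s ^ 2 := integral_nonneg fun s => sq_nonneg _
  have h0 : ∑ i, 𝒯.lumped i * u 0 i ^ 2 ≤ U ^ 2 * (volume Ω).toReal := by
    rw [← 𝒯.sum_lumped hΩ, Finset.mul_sum]
    refine Finset.sum_le_sum fun i _ => ?_
    rw [hsol.initial i, mul_comm]
    refine mul_le_mul_of_nonneg_right ?_ (𝒯.lumped_nonneg i)
    rw [← sq_abs]
    exact pow_le_pow_left₀ (abs_nonneg _) (hU _ (𝒯.node_mem_closure i)) 2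
  rcases ht.1.eq_or_lt with rfl | ht0
  · linarith [mul_nonneg hc0 hI0]
  have hsubτ : Ioo 0 τ ⊆ Ioo 0 T := Ioo_subset_Ioo_right hτ.2
  have hdis : ∀ᵐ r, r ∈ Ioo 0 τ → (∀ i, DifferentiableAt ℝ (fun s => u s i) r) →
      ∑ i, 𝒯.lumped i * (2 * (u r i * deriv (fun s => u s i) r)) ≤ c * B r ^ 2 := by
    have ha' := ae_restrict_of_ae_restrict_of_subset hsubτ ha
    have huin' := ae_restrict_of_ae_restrict_of_subset hsubτ huin
    rw [← ae_restrict_iff' measurableSet_Ioo]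
    filter_upwards [ha', huin', hαβ, hsol.weak, hgcc] with r h1 h2 h3 h4 h5 _
    have h6 := h4 (u r)
    have h7 := GCC.mForm_le 𝒯 hγ hh hlam h3.1 h3.2 h5
    have h8 := 𝒯.inflow_sub_advection_le hd hreg h1 h2.1 h2.2 (u r)
    have h9 : ∑ i, 𝒯.lumped i * (2 * (u r i * deriv (fun s => u s i) r)) =
        2 * ∑ i, u r i * 𝒯.lumped i * deriv (fun s => u s i) r := by
      rw [Finset.mul_sum]
      exact Finset.sum_congr rfl fun i _ => by ring
    rw [h9]
    linarith
  -- Absolute continuity is available only away from time `0`, so the energy is integrated from `s >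
  -- 0`; continuity at `0` then allows `s → 0`.
  have hmain : ∀ s ∈ Ioo 0 t, ∑ i, 𝒯.lumped i * u t i ^ 2 ≤
      ∑ i, 𝒯.lumped i * u s i ^ 2 + c * ∫ s in Ioo 0 T, B s ^ 2 := by
    intro s hs
    have hac := fun i => hsol.absolutelyContinuous i s t hs.1 hs.2.le ht.2
    have hac2 : ∀ i, AbsolutelyContinuousOnInterval (fun r => u r i * u r i) s t :=
      fun i => (hac i).mul (hac i)
    have hftc : ∑ i, 𝒯.lumped i * u t i ^ 2 - ∑ i, 𝒯.lumped i * u s i ^ 2 =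
        ∫ r in s..t, ∑ i, 𝒯.lumped i * deriv (fun r => u r i * u r i) r := by
      rw [intervalIntegral.integral_finsetSum fun i _ =>
        (hac2 i).intervalIntegrable_deriv.const_mul _, ← Finset.sum_sub_distrib]
      refine Finset.sum_congr rfl fun i _ => ?_
      rw [intervalIntegral.integral_const_mul, (hac2 i).integral_deriv_eq_sub]
      ring
    have hsub : Ioc s t ⊆ Ioo 0 T := fun r hr =>
      ⟨hs.1.trans hr.1, hr.2.trans_lt (ht.2.trans_le hτ.2)⟩
    have hBst : IntervalIntegrable (fun r => c * B r ^ 2) volume s t := by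
      rw [intervalIntegrable_iff_integrableOn_Ioc_of_le hs.2.le]
      exact IntegrableOn.mono_set (hBi.const_mul c) hsub
    have hdint : IntervalIntegrable
        (fun r => ∑ i, 𝒯.lumped i * deriv (fun r => u r i * u r i) r) volume s t := by
      simpa only [Finset.sum_fn] using IntervalIntegrable.sum Finset.univ fun i _ =>
        (hac2 i).intervalIntegrable_deriv.const_mul (𝒯.lumped i)
    have hle : ∫ r in s..t, ∑ i, 𝒯.lumped i * deriv (fun r => u r i * u r i) r ≤
        ∫ r in s..t, c * B r ^ 2 := by
      refine intervalIntegral.integral_mono_ae_restrict hs.2.le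
        hdint hBst ?_
      have hdiff : ∀ᵐ r, ∀ i, r ∈ uIcc s t → DifferentiableAt ℝ (fun s => u s i) r :=
        ae_all_iff.2 fun i => (hac i).ae_differentiableAt
      rw [EventuallyLE, ae_restrict_iff' measurableSet_Icc]
      filter_upwards [hdis, hdiff] with r h1 h2 hr
      have hr' : r ∈ Ioo 0 τ := ⟨hs.1.trans_le hr.1, hr.2.trans_lt ht.2⟩
      have h3 : ∀ i, DifferentiableAt ℝ (fun s => u s i) r := fun i =>
        h2 i (by rwa [uIcc_of_le hs.2.le])
      refine le_of_eq_of_le (Finset.sum_congr rfl fun i _ => ?_) (h1 hr' h3)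
      rw [deriv_fun_mul (h3 i) (h3 i)]
      ring
    have hle2 : ∫ r in s..t, c * B r ^ 2 ≤ c * ∫ s in Ioo 0 T, B s ^ 2 := by
      rw [intervalIntegral.integral_of_le hs.2.le, integral_const_mul]
      exact mul_le_mul_of_nonneg_left (setIntegral_mono_set hBi
        (Eventually.of_forall fun _ => sq_nonneg _) hsub.eventuallyLE) hc0
    linarith
  have hlim : Tendsto (fun s => ∑ i, 𝒯.lumped i * u s i ^ 2 + c * ∫ s in Ioo 0 T, B s ^ 2) (𝓝[>] 0)
      (𝓝 (∑ i, 𝒯.lumped i * u 0 i ^ 2 + c * ∫ s in Ioo 0 T, B s ^ 2)) := by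
    refine (tendsto_finsetSum _ fun i _ => ?_).add_const _
    refine Tendsto.const_mul _ (Tendsto.pow ?_ 2)
    have hτ0 : (0 : ℝ) ∈ Ico 0 τ := ⟨le_rfl, hτ.1⟩
    refine Tendsto.mono_left (hsol.continuousOn i 0 hτ0) ?_
    rw [← nhdsWithin_Ioo_eq_nhdsGT hτ.1]
    exact nhdsWithin_mono _ Ioo_subset_Ico_self
  have := ge_of_tendsto hlim (by
    filter_upwards [Ioo_mem_nhdsGT ht0] with s hs using hmain s hs)
  linarith

end Stability

end Triangulation

end AFC

end

noncomputable section

namespace AFC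

open Filter Topology

/-! ### Carathéodory functions -/

section Modification

variable {α Y V : Type*} [MeasurableSpace α] {μ : Measure α} [TopologicalSpace Y]
  [TopologicalSpace.MetrizableSpace Y] [SecondCountableTopology Y] [MeasurableSpace Y]
  [OpensMeasurableSpace Y] [TopologicalSpace V] [TopologicalSpace.PseudoMetrizableSpace V]
  [MeasurableSpace V] [BorelSpace V] [Zero V]

/-- A function that is measurable in `t` and, for almost every `t`, continuous in `y` agrees for
almost every `t` with a jointly measurable function. -/
lemma exists_measurable_modification {f : α → Y → V} (hm : ∀ y, AEMeasurable (fun t => f t y) μ)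
    (hc : ∀ᵐ t ∂μ, Continuous (f t)) :
    ∃ F : α → Y → V, Measurable (Function.uncurry F) ∧ ∀ᵐ t ∂μ, F t = f t := by
  classical
  obtain ⟨D, hD, hDd⟩ := TopologicalSpace.exists_countable_dense Y
  have hmk : ∀ᵐ t ∂μ, ∀ y ∈ D, f t y = (hm y).mk _ t :=
    (ae_ball_iff hD).2 fun y _ => (hm y).ae_eq_mk
  -- On this measurable set of full measure `f t` is continuous and agrees with measurable
  -- representatives on a countable dense set. Setting `F` to zero elsewhere makes it continuous in
  -- `y` for every `t`, and limits along the dense set make it measurable in `t` for every `y`.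
  obtain ⟨S, hS, hSm, hSp⟩ := (hc.and hmk).exists_measurable_mem
  let F : α → Y → V := fun t y => if t ∈ S then f t y else 0
  have hFc : ∀ t, Continuous (F t) := fun t => by
    by_cases ht : t ∈ S
    · simpa only [F, if_pos ht] using (hSp t ht).1
    · simpa only [F, if_neg ht] using continuous_const
  have hFD : ∀ y ∈ D, Measurable fun t => F t y := fun y hy => by
    have : (fun t => F t y) = S.indicator ((hm y).mk _) := by
      ext t
      by_cases ht : t ∈ S
      · simp only [F, if_pos ht, indicator_of_mem ht, (hSp t ht).2 y hy]
      · simp only [F, if_neg ht, indicator_of_notMem ht]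
    rw [this]
    exact (hm y).measurable_mk.indicator hSm
  have hFm : ∀ y, Measurable fun t => F t y := fun y => by
    obtain ⟨x, hxD, hx⟩ := mem_closure_iff_seq_limit.1 (hDd y)
    refine measurable_of_tendsto_metrizable (fun n => hFD (x n) (hxD n)) ?_
    exact tendsto_pi_nhds.2 fun t => ((hFc t).tendsto y).comp hx
  refine ⟨F, (measurable_uncurry_of_continuous_of_measurable (u := fun y t => F t y) hFc hFm).comp
    measurable_swap, ?_⟩
  filter_upwards [hS] with t ht
  ext y
  simp only [F, if_pos ht]

lemma aemeasurable_integral_of_continuous {f : α → Y → V}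
    (hm : ∀ y, AEMeasurable (fun t => f t y) μ) (hc : ∀ᵐ t ∂μ, Continuous (f t)) {ν : Measure Y}
    [SFinite ν] {g : V → Y → ℝ} (hg : Measurable (Function.uncurry g)) :
    AEMeasurable (fun t => ∫ y, g (f t y) y ∂ν) μ := by
  obtain ⟨F, hF, hFf⟩ := exists_measurable_modification hm hc
  have h1 : Measurable fun p : α × Y => g (F p.1 p.2) p.2 := hg.comp (hF.prodMk measurable_snd)
  refine ⟨fun t => ∫ y, g (F t y) y ∂ν, h1.stronglyMeasurable.integral_prod_right.measurable, ?_⟩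
  filter_upwards [hFf] with t ht
  rw [ht]

end Modification

/-- Right-hand sides that are measurable in time, Lipschitz continuous in the state uniformly in
time, and integrable in time. -/
structure IsCaratheodory {ι : Type*} [Fintype ι] (μ : Measure ℝ) (f : ℝ → (ι → ℝ) → ℝ) : Prop where
  measurable : ∀ v, AEMeasurable (fun t => f t v) μ
  lipschitz : ∃ K : ℝ≥0, ∀ᵐ t ∂μ, LipschitzWith K (f t)
  bound : ∃ k : ℝ → ℝ, Integrable k μ ∧ ∀ᵐ t ∂μ, |f t 0| ≤ k t

namespace IsCaratheodory

variable {ι : Type*} [Fintype ι] {μ : Measure ℝ} {f g : ℝ → (ι → ℝ) → ℝ}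

lemma congr (hf : IsCaratheodory μ f) (h : ∀ᵐ t ∂μ, f t = g t) : IsCaratheodory μ g := by
  obtain ⟨K, hK⟩ := hf.lipschitz
  obtain ⟨k, hk, hk'⟩ := hf.bound
  refine ⟨fun v => (hf.measurable v).congr ?_, ⟨K, ?_⟩, k, hk, ?_⟩
  · filter_upwards [h] with t ht using congrFun ht v
  · filter_upwards [h, hK] with t ht ht' using ht ▸ ht'
  · filter_upwards [h, hk'] with t ht ht' using ht ▸ ht'

lemma coord (i : ι) : IsCaratheodory μ fun _ (v : ι → ℝ) => v i :=
  ⟨fun _ => aemeasurable_const, ⟨1, Eventually.of_forall fun _ => LipschitzWith.eval i⟩,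
    0, integrable_zero _ _ _, Eventually.of_forall fun _ => by simp⟩

lemma of_integrable {c : ℝ → ℝ} (hc : Integrable c μ) :
    IsCaratheodory μ fun t (_ : ι → ℝ) => c t :=
  ⟨fun _ => hc.aemeasurable, ⟨0, Eventually.of_forall fun t => LipschitzWith.const (c t)⟩,
    fun t => |c t|, hc.norm, Eventually.of_forall fun _ => le_rfl⟩

lemma add (hf : IsCaratheodory μ f) (hg : IsCaratheodory μ g) :
    IsCaratheodory μ fun t v => f t v + g t v := by
  obtain ⟨K, hK⟩ := hf.lipschitz
  obtain ⟨k, hk, hk'⟩ := hf.bound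
  obtain ⟨L, hL⟩ := hg.lipschitz
  obtain ⟨l, hl, hl'⟩ := hg.bound
  refine ⟨fun v => (hf.measurable v).add (hg.measurable v), ⟨K + L, ?_⟩,
    fun t => k t + l t, hk.add hl, ?_⟩
  · filter_upwards [hK, hL] with t h1 h2 using h1.add h2
  · filter_upwards [hk', hl'] with t h1 h2 using (abs_add_le _ _).trans (add_le_add h1 h2)

lemma neg (hf : IsCaratheodory μ f) : IsCaratheodory μ fun t v => -f t v := by
  obtain ⟨K, hK⟩ := hf.lipschitz
  obtain ⟨k, hk, hk'⟩ := hf.bound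
  refine ⟨fun v => (hf.measurable v).neg, ⟨K, ?_⟩, k, hk, ?_⟩
  · filter_upwards [hK] with t h1 using h1.neg
  · filter_upwards [hk'] with t h1 using by rwa [abs_neg]

lemma sub (hf : IsCaratheodory μ f) (hg : IsCaratheodory μ g) :
    IsCaratheodory μ fun t v => f t v - g t v := by
  simpa only [sub_eq_add_neg] using hf.add hg.neg

lemma sum {κ : Type*} (s : Finset κ) {f : κ → ℝ → (ι → ℝ) → ℝ}
    (hf : ∀ j ∈ s, IsCaratheodory μ (f j)) : IsCaratheodory μ fun t v => ∑ j ∈ s, f j t v := by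
  classical
  induction s using Finset.induction_on with
  | empty => simpa using of_integrable (integrable_zero _ _ _)
  | insert j s hj ih =>
    simp only [Finset.sum_insert hj]
    exact (hf j (Finset.mem_insert_self j s)).add
      (ih fun k hk => hf k (Finset.mem_insert_of_mem hk))

lemma max (hf : IsCaratheodory μ f) (hg : IsCaratheodory μ g) :
    IsCaratheodory μ fun t v => Max.max (f t v) (g t v) := by
  obtain ⟨K, hK⟩ := hf.lipschitz
  obtain ⟨k, hk, hk'⟩ := hf.bound
  obtain ⟨L, hL⟩ := hg.lipschitz
  obtain ⟨l, hl, hl'⟩ := hg.bound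
  refine ⟨fun v => (hf.measurable v).max (hg.measurable v), ⟨Max.max K L, ?_⟩,
    fun t => k t + l t, hk.add hl, ?_⟩
  · filter_upwards [hK, hL] with t h1 h2 using h1.max h2
  · filter_upwards [hk', hl'] with t h1 h2
    have h3 := (abs_nonneg _).trans h1
    have h4 := (abs_nonneg _).trans h2
    exact (abs_max_le_max_abs_abs).trans (max_le (by linarith) (by linarith))

lemma min (hf : IsCaratheodory μ f) (hg : IsCaratheodory μ g) :
    IsCaratheodory μ fun t v => Min.min (f t v) (g t v) := by
  refine (hf.neg.max hg.neg).neg.congr (Eventually.of_forall fun t => ?_)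
  ext v
  rw [max_neg_neg, neg_neg]

lemma coef_mul (hf : IsCaratheodory μ f) {c : ℝ → ℝ} (hc : AEMeasurable c μ) {A : ℝ}
    (hA : ∀ᵐ t ∂μ, |c t| ≤ A) : IsCaratheodory μ fun t v => c t * f t v := by
  obtain ⟨K, hK⟩ := hf.lipschitz
  obtain ⟨k, hk, hk'⟩ := hf.bound
  refine ⟨fun v => hc.mul (hf.measurable v), ⟨A.toNNReal * K, ?_⟩, fun t => |A| * k t,
    hk.const_mul _, ?_⟩
  · filter_upwards [hK, hA] with t h1 h2
    refine LipschitzWith.of_dist_le_mul fun v w => ?_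
    rw [Real.dist_eq, ← mul_sub, abs_mul, NNReal.coe_mul,
      Real.coe_toNNReal _ ((abs_nonneg _).trans h2), mul_assoc]
    exact mul_le_mul h2 (by simpa [Real.dist_eq] using h1.dist_le_mul v w) (abs_nonneg _)
      ((abs_nonneg _).trans h2)
  · filter_upwards [hk', hA] with t h1 h2
    rw [abs_mul]
    exact mul_le_mul (h2.trans (le_abs_self A)) h1 (abs_nonneg _) (abs_nonneg _)

lemma const_mul (hf : IsCaratheodory μ f) (c : ℝ) : IsCaratheodory μ fun t v => c * f t v :=
  hf.coef_mul aemeasurable_const (Eventually.of_forall fun _ => le_rfl)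

end IsCaratheodory

/-! ### Global solutions of Carathéodory equations -/

section ODE

variable {X : Type*} [NormedAddCommGroup X] [MeasurableSpace X] [BorelSpace X]
  [SecondCountableTopology X] {T : ℝ}

/-- The Lipschitz condition gives the linear growth `‖F t (w t)‖ ≤ k t + K ‖w t‖`. -/
lemma intervalIntegrable_nemytskii (hT : 0 ≤ T) {F : ℝ → X → X}
    (hF : Measurable (Function.uncurry F)) {K : ℝ≥0}
    (hK : ∀ᵐ t ∂(volume.restrict (Ioo 0 T)), LipschitzWith K (F t)) {k : ℝ → ℝ}
    (hk : IntegrableOn k (Ioo 0 T)) (hk' : ∀ᵐ t ∂(volume.restrict (Ioo 0 T)), ‖F t 0‖ ≤ k t)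
    {w : ℝ → X} (hw : Continuous w) : IntervalIntegrable (fun s => F s (w s)) volume 0 T := by
  rw [intervalIntegrable_iff_integrableOn_Ioo_of_le hT]
  have hwi : IntegrableOn (fun s => K * ‖w s‖) (Ioo 0 T) :=
    ((continuous_const.mul hw.norm).integrableOn_Icc (a := 0) (b := T)).mono_set Ioo_subset_Icc_self
  refine Integrable.mono' (hk.add hwi)
    (hF.comp (measurable_id.prodMk hw.measurable)).aestronglyMeasurable ?_
  filter_upwards [hK, hk'] with t h1 h2
  have h3 := h1.dist_le_mul (w t) 0
  rw [dist_eq_norm, dist_zero_right] at h3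
  have h4 := norm_le_norm_add_norm_sub' (F t (w t)) (F t 0)
  simp only [Pi.add_apply]
  linarith

variable [NormedSpace ℝ X] [CompleteSpace X]

/-- The integral equation of a Carathéodory right-hand side has a global solution. -/
lemma exists_integral_solution (hT : 0 < T) {F : ℝ → X → X} (hF : Measurable (Function.uncurry F))
    {K : ℝ≥0} (hK : ∀ᵐ t ∂(volume.restrict (Ioo 0 T)), LipschitzWith K (F t)) {k : ℝ → ℝ}
    (hk : IntegrableOn k (Ioo 0 T)) (hk' : ∀ᵐ t ∂(volume.restrict (Ioo 0 T)), ‖F t 0‖ ≤ k t)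
    (x₀ : X) : ∃ w : ℝ → X, Continuous w ∧
      ∀ t ∈ Icc 0 T, w t = x₀ + ∫ s in (0 : ℝ)..t, F s (w s) := by
  have hint := fun w : C(Icc 0 T, X) => intervalIntegrable_nemytskii hT.le hF hK hk hk'
    (w.IccExtend hT.le).continuous
  have hint' : ∀ (w : C(Icc 0 T, X)), ∀ t ∈ Icc 0 T,
      IntervalIntegrable (fun s => F s (w.IccExtend hT.le s)) volume 0 t := fun w t ht =>
    (hint w).mono_set (by rw [uIcc_of_le ht.1, uIcc_of_le hT.le]; exact Icc_subset_Icc_right ht.2)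
  let Φ : C(Icc 0 T, X) → C(Icc 0 T, X) := fun w =>
    ⟨fun t => x₀ + ∫ s in (0 : ℝ)..t, F s (w.IccExtend hT.le s), by
      refine continuous_const.add ?_
      have h := intervalIntegral.continuousOn_primitive_interval'
        (hint w) (left_mem_uIcc (a := (0 : ℝ)) (b := T))
      rw [uIcc_of_le hT.le] at h
      exact continuousOn_iff_continuous_domRestrict.1 h⟩
  -- The factorial gained by iterating the integral operator makes some power of it a contraction on
  -- all of `[0,T]`, so no short-time solutions have to be patched together.
  have hiter : ∀ (w z : C(Icc 0 T, X)) (n : ℕ) (t : Icc 0 T),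
      ‖Φ^[n] w t - Φ^[n] z t‖ ≤ (K * (t : ℝ)) ^ n / n.factorial * dist w z := by
    intro w z n
    induction n with
    | zero =>
      intro t
      simpa [← dist_eq_norm] using ContinuousMap.dist_apply_le_dist (f := w) (g := z) t
    | succ n ih =>
      intro t
      rw [Function.iterate_succ_apply', Function.iterate_succ_apply']
      set w' := Φ^[n] w
      set z' := Φ^[n] z
      have h1 : Φ w' t - Φ z' t = ∫ s in (0 : ℝ)..t,
          (F s (w'.IccExtend hT.le s) - F s (z'.IccExtend hT.le s)) := by
        rw [intervalIntegral.integral_sub (hint' w' t t.2) (hint' z' t t.2)]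
        simp only [Φ, ContinuousMap.coe_mk, add_sub_add_left_eq_sub]
      rw [h1]
      have h2 : ∀ᵐ s, s ∈ Ioc 0 (t : ℝ) →
          ‖F s (w'.IccExtend hT.le s) - F s (z'.IccExtend hT.le s)‖ ≤
            K * ((K * s) ^ n / n.factorial * dist w z) := by
        have hK' := (ae_restrict_iff' measurableSet_Ioo).1 hK
        -- The integral runs over `Ioc 0 t`, which may contain `T`, but the Lipschitz bound is known
        -- only on the open interval.
        have hne : ∀ᵐ s : ℝ, s ≠ T := by simp [ae_iff, measure_singleton]
        filter_upwards [hK', hne] with s h3 hsT hs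
        have hsT' : s ∈ Ioo 0 T := ⟨hs.1, lt_of_le_of_ne (hs.2.trans t.2.2) hsT⟩
        have h4 := (h3 hsT').dist_le_mul (w'.IccExtend hT.le s) (z'.IccExtend hT.le s)
        rw [dist_eq_norm, dist_eq_norm] at h4
        refine h4.trans (mul_le_mul_of_nonneg_left ?_ K.2)
        have hs' : s ∈ Icc 0 T := Ioo_subset_Icc_self hsT'
        have h5 := ih ⟨s, hs'⟩
        rwa [ContinuousMap.coe_IccExtend, ContinuousMap.coe_IccExtend,
          IccExtend_of_mem _ _ hs', IccExtend_of_mem _ _ hs']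
      refine (intervalIntegral.norm_integral_le_of_norm_le t.2.1 h2
        (Continuous.intervalIntegrable (by fun_prop) _ _)).trans_eq ?_
      have h6 : ∀ s : ℝ, (K : ℝ) * ((K * s) ^ n / n.factorial * dist w z) =
          (K ^ (n + 1) / n.factorial * dist w z) * s ^ n := fun s => by
        rw [mul_pow]; ring
      simp_rw [h6]
      rw [intervalIntegral.integral_const_mul, integral_pow, Nat.factorial_succ]
      have : (n.factorial : ℝ) ≠ 0 := Nat.cast_ne_zero.2 n.factorial_ne_zero
      push_cast
      field_simp
      simp
      ring
  obtain ⟨n, hn⟩ := ((FloorSemiring.tendsto_pow_div_factorial_atTop ((K : ℝ) * T)).eventually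
    (gt_mem_nhds zero_lt_one)).exists
  have hq0 : 0 ≤ (K * T : ℝ) ^ n / n.factorial := by positivity
  have hcontr : ContractingWith ⟨_, hq0⟩ Φ^[n] := by
    refine ⟨by exact_mod_cast hn, LipschitzWith.of_dist_le_mul fun w z => ?_⟩
    refine (ContinuousMap.dist_le (mul_nonneg hq0 dist_nonneg)).2 fun t => ?_
    rw [dist_eq_norm]
    refine (hiter w z n t).trans (mul_le_mul_of_nonneg_right ?_ dist_nonneg)
    have ht0 : 0 ≤ (t : ℝ) := t.2.1
    have htT : (t : ℝ) ≤ T := t.2.2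
    change (K * (t : ℝ)) ^ n / n.factorial ≤ (K * T) ^ n / n.factorial
    gcongr
  have : Nonempty C(Icc 0 T, X) := ⟨0⟩
  have hfix := hcontr.isFixedPt_fixedPoint_iterate
  set w := ContractingWith.fixedPoint Φ^[n] hcontr
  refine ⟨w.IccExtend hT.le, (w.IccExtend hT.le).continuous, fun t ht => ?_⟩
  have h := congrArg (fun v : C(Icc 0 T, X) => v ⟨t, ht⟩) hfix
  have h' : x₀ + ∫ s in (0 : ℝ)..t, F s (w.IccExtend hT.le s) = w ⟨t, ht⟩ := h
  rw [h', ContinuousMap.coe_IccExtend, IccExtend_of_mem _ _ ht]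

/-- Global absolutely continuous solutions of Carathéodory equations. -/
lemma exists_caratheodory_solution {ι : Type*} [Fintype ι] (hT : 0 < T) {F : ℝ → (ι → ℝ) → ι → ℝ}
    (hF : ∀ i, IsCaratheodory (volume.restrict (Ioo 0 T)) fun t v => F t v i) (x₀ : ι → ℝ) :
    ∃ u : ℝ → ι → ℝ, (∀ i, AbsolutelyContinuousOnInterval (fun t => u t i) 0 T) ∧ u 0 = x₀ ∧
      ∀ᵐ t ∂(volume.restrict (Ioo 0 T)), ∀ i, HasDerivAt (fun s => u s i) (F t (u t) i) t := by
  choose K hK using fun i => (hF i).lipschitz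
  choose k hk hk' using fun i => (hF i).bound
  have hlip : ∀ᵐ t ∂(volume.restrict (Ioo 0 T)), LipschitzWith (∑ i, K i) (F t) := by
    filter_upwards [ae_all_iff.2 hK] with t ht
    refine LipschitzWith.of_dist_le_mul fun v w => ?_
    refine (dist_pi_le_iff (by positivity)).2 fun i => ((ht i).dist_le_mul v w).trans ?_
    gcongr
    exact Finset.single_le_sum (f := K) (fun _ _ => zero_le) (Finset.mem_univ i)
  obtain ⟨G, hG, hGF⟩ := exists_measurable_modification (μ := volume.restrict (Ioo 0 T)) (f := F)
    (fun v => aemeasurable_pi_iff.2 fun i => (hF i).measurable v)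
    (hlip.mono fun t ht => ht.continuous)
  have hlip' : ∀ᵐ t ∂(volume.restrict (Ioo 0 T)), LipschitzWith (∑ i, K i) (G t) := by
    filter_upwards [hlip, hGF] with t h1 h2 using h2 ▸ h1
  have hbd : ∀ᵐ t ∂(volume.restrict (Ioo 0 T)), ‖G t 0‖ ≤ ∑ i, |k i t| := by
    filter_upwards [ae_all_iff.2 hk', hGF] with t h1 h2
    rw [h2]
    refine (pi_norm_le_iff_of_nonneg (Finset.sum_nonneg fun _ _ => abs_nonneg _)).2 fun i => ?_
    exact ((h1 i).trans (le_abs_self _)).trans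
      (Finset.single_le_sum (f := fun i => |k i t|) (fun _ _ => abs_nonneg _) (Finset.mem_univ i))
  have hki : IntegrableOn (fun t => ∑ i, |k i t|) (Ioo 0 T) :=
    integrable_finsetSum _ fun i _ => (hk i).norm
  obtain ⟨w, hw, hwt⟩ := exists_integral_solution hT hG hlip' hki hbd x₀
  have hint := intervalIntegrable_nemytskii hT.le hG hlip' hki hbd hw
  have hint' : ∀ i, IntervalIntegrable (fun s => G s (w s) i) volume 0 T := fun i =>
    ⟨(ContinuousLinearMap.proj (R := ℝ) (φ := fun _ : ι => ℝ) i).integrable_comp hint.1,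
      (ContinuousLinearMap.proj (R := ℝ) (φ := fun _ : ι => ℝ) i).integrable_comp hint.2⟩
  have heq : ∀ t ∈ Icc 0 T, ∀ i, w t i = x₀ i + ∫ s in (0 : ℝ)..t, G s (w s) i := by
    intro t ht i
    have hsub : IntervalIntegrable (fun s => G s (w s)) volume 0 t :=
      hint.mono_set (by rw [uIcc_of_le ht.1, uIcc_of_le hT.le]; exact Icc_subset_Icc_right ht.2)
    have h : ∫ s in (0 : ℝ)..t, G s (w s) i = (∫ s in (0 : ℝ)..t, G s (w s)) i :=
      (ContinuousLinearMap.proj (R := ℝ) (φ := fun _ : ι => ℝ) i).intervalIntegral_comp_comm hsub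
    rw [h, ← Pi.add_apply, ← hwt t ht]
  -- The solution is taken as the integral expression, equal to `w` on `[0,T]`, so that absolute
  -- continuity and the derivative almost everywhere follow from Lebesgue's theorems for primitives.
  refine ⟨fun t i => x₀ i + ∫ s in (0 : ℝ)..t, G s (w s) i, fun i => ?_, ?_, ?_⟩
  · have hc : AbsolutelyContinuousOnInterval (fun _ : ℝ => x₀ i) 0 T :=
      ((LipschitzWith.const (x₀ i)).lipschitzOnWith (s := uIcc 0 T)).absolutelyContinuousOnInterval
    exact hc.add ((hint' i).absolutelyContinuousOnInterval_intervalIntegral left_mem_uIcc)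
  · ext i; simp
  · have hder : ∀ᵐ t, ∀ i, t ∈ uIcc 0 T → ∀ c ∈ uIcc 0 T,
        HasDerivAt (fun x => ∫ s in c..x, G s (w s) i) (G t (w t) i) t :=
      ae_all_iff.2 fun i => (hint' i).ae_hasDerivAt_integral
    filter_upwards [ae_restrict_of_ae hder, hGF, ae_restrict_mem measurableSet_Ioo] with t h1 h2 ht i
    have ht' : t ∈ Icc 0 T := Ioo_subset_Icc_self ht
    have hwu : (fun i => x₀ i + ∫ s in (0 : ℝ)..t, G s (w s) i) = w t :=
      funext fun i => (heq t ht' i).symm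
    rw [hwu, ← h2]
    exact (h1 i (by rwa [uIcc_of_le hT.le]) 0 left_mem_uIcc).const_add _

end ODE

end AFC

end

/-! ### The scheme at a fixed time: matrix form, local bounds and limited fluxes -/

noncomputable section

namespace AFC

open Filter Topology

/-- The data of the transport problem at a fixed time: a solenoidal velocity and inflow values that
are continuous on the inlet and bounded by `β`. -/
structure IsAdmissible {d : ℕ} (Ω : Set (E d)) (M β : ℝ) (b : E d → E d) (g : E d → ℝ) : Prop where
  velocity : IsSolenoidalW1Inf Ω M b
  continuousOn : ContinuousOn g (closure (inlet Ω b))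
  bound : ∀ x ∈ closure (inlet Ω b), |g x| ≤ β

lemma IsAdmissible.neg {d : ℕ} {Ω : Set (E d)} {M β : ℝ} {b : E d → E d} {g : E d → ℝ}
    (h : IsAdmissible Ω M β b g) : IsAdmissible Ω M β b fun x => -g x :=
  ⟨h.velocity, h.continuousOn.neg, fun x hx => by rw [abs_neg]; exact h.bound x hx⟩

namespace Triangulation

section FixedTime

variable {d : ℕ} {Ω : Set (E d)} (𝒯 : Triangulation Ω) {M β : ℝ} {b : E d → E d} {g : E d → ℝ}

/-! ### Matrix representation of the forms -/

lemma integrableOn_advection_hat (hΩ : IsOpen Ω) (hb : IsSolenoidalW1Inf Ω M b) (i j : 𝒯.Node) :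
    IntegrableOn (fun x => 𝒯.hat i x * ⟪b x, gradient (𝒯.hat j) x⟫) Ω := by
  classical
  have h := 𝒯.integrableOn_advection hΩ hb.1 hb.2.1 (Pi.single j 1) (Pi.single i 1)
  rwa [𝒯.fe_single, 𝒯.fe_single] at h

lemma integrableOn_inlet_hat (hd : d ≠ 0) (hreg : interior (closure Ω) = Ω)
    (hb : IsSolenoidalW1Inf Ω M b) (i j : 𝒯.Node) :
    IntegrableOn (fun x => 𝒯.hat i x * 𝒯.hat j x * ⟪b x, outwardNormal Ω x⟫) (inlet Ω b)
      (surface Ω) := by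
  have := 𝒯.isFiniteMeasure_surface hd hreg
  refine integrableOn_inlet (hreg ▸ isOpen_interior) hb.1 hb.2.1 (c := 1)
    ((𝒯.measurable_hat i).mul (𝒯.measurable_hat j)).aestronglyMeasurable fun x _ => ?_
  rw [abs_mul]
  exact mul_le_one₀ (𝒯.abs_hat_le_one i x) (abs_nonneg _) (𝒯.abs_hat_le_one j x)

lemma integrableOn_inflow_hat (hd : d ≠ 0) (hreg : interior (closure Ω) = Ω)
    (h : IsAdmissible Ω M β b g) (i : 𝒯.Node) :
    IntegrableOn (fun x => 𝒯.hat i x * g x * ⟪b x, outwardNormal Ω x⟫) (inlet Ω b)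
      (surface Ω) := by
  have hΩ : IsOpen Ω := hreg ▸ isOpen_interior
  have := 𝒯.isFiniteMeasure_surface hd hreg
  refine integrableOn_inlet hΩ h.velocity.1 h.velocity.2.1 (c := β)
    ((𝒯.measurable_hat i).aestronglyMeasurable.mul
      (aestronglyMeasurable_inflow hΩ h.velocity.1 h.continuousOn)) fun x hx => ?_
  rw [abs_mul]
  exact (mul_le_of_le_one_left (abs_nonneg _) (𝒯.abs_hat_le_one i x)).trans
    (h.bound x (subset_closure hx))

lemma aForm_fe (hd : d ≠ 0) (hreg : interior (closure Ω) = Ω) (hb : IsSolenoidalW1Inf Ω M b)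
    (v w : 𝒯.Node → ℝ) :
    aForm Ω b (𝒯.fe v) (𝒯.fe w) = ∑ i, w i * ∑ j, 𝒯.aMat b i j * v j := by
  have hΩ : IsOpen Ω := hreg ▸ isOpen_interior
  have h1 : ∫ x in Ω, 𝒯.fe w x * ⟪b x, gradient (𝒯.fe v) x⟫ =
      ∑ i, ∑ j, w i * v j * ∫ x in Ω, 𝒯.hat i x * ⟪b x, gradient (𝒯.hat j) x⟫ := by
    have hint : ∀ i j, Integrable
        (fun x => w i * v j * (𝒯.hat i x * ⟪b x, gradient (𝒯.hat j) x⟫)) (volume.restrict Ω) :=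
      fun i j => (𝒯.integrableOn_advection_hat hΩ hb i j).const_mul _
    simp_rw [← integral_const_mul]
    rw [integral_congr_ae (g := fun x => ∑ i, ∑ j,
      w i * v j * (𝒯.hat i x * ⟪b x, gradient (𝒯.hat j) x⟫)),
      integral_finsetSum _ fun i _ => integrable_finsetSum _ fun j _ => hint i j]
    · exact Finset.sum_congr rfl fun i _ => integral_finsetSum _ fun j _ => hint i j
    · filter_upwards [𝒯.gradient_fe_ae hΩ v] with x hx
      rw [hx, inner_sum, fe, Finset.sum_mul_sum]
      refine Finset.sum_congr rfl fun i _ => Finset.sum_congr rfl fun j _ => ?_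
      rw [inner_smul_right]; ring
  have h2 : ∫ x in inlet Ω b, 𝒯.fe w x * 𝒯.fe v x * ⟪b x, outwardNormal Ω x⟫ ∂(surface Ω) =
      ∑ i, ∑ j, w i * v j *
        ∫ x in inlet Ω b, 𝒯.hat i x * 𝒯.hat j x * ⟪b x, outwardNormal Ω x⟫ ∂(surface Ω) := by
    have hint : ∀ i j, Integrable
        (fun x => w i * v j * (𝒯.hat i x * 𝒯.hat j x * ⟪b x, outwardNormal Ω x⟫))
        ((surface Ω).restrict (inlet Ω b)) :=
      fun i j => (𝒯.integrableOn_inlet_hat hd hreg hb i j).const_mul _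
    simp_rw [← integral_const_mul]
    rw [integral_congr_ae (g := fun x => ∑ i, ∑ j,
      w i * v j * (𝒯.hat i x * 𝒯.hat j x * ⟪b x, outwardNormal Ω x⟫)),
      integral_finsetSum _ fun i _ => integrable_finsetSum _ fun j _ => hint i j]
    · exact Finset.sum_congr rfl fun i _ => integral_finsetSum _ fun j _ => hint i j
    · refine Eventually.of_forall fun x => ?_
      simp only [fe]
      rw [Finset.sum_mul_sum, Finset.sum_mul]
      refine Finset.sum_congr rfl fun i _ => ?_
      rw [Finset.sum_mul]
      exact Finset.sum_congr rfl fun j _ => by ring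
  rw [aForm, h1, h2, ← Finset.sum_sub_distrib]
  refine Finset.sum_congr rfl fun i _ => ?_
  rw [← Finset.sum_sub_distrib, Finset.mul_sum]
  refine Finset.sum_congr rfl fun j _ => ?_
  rw [aMat, aForm]; ring

lemma bForm_fe (hd : d ≠ 0) (hreg : interior (closure Ω) = Ω) (h : IsAdmissible Ω M β b g)
    (w : 𝒯.Node → ℝ) : bForm Ω b g (𝒯.fe w) = ∑ i, w i * 𝒯.bVec b g i := by
  have hint : ∀ i, Integrable
      (fun x => w i * (𝒯.hat i x * g x * ⟪b x, outwardNormal Ω x⟫))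
      ((surface Ω).restrict (inlet Ω b)) :=
    fun i => (𝒯.integrableOn_inflow_hat hd hreg h i).const_mul _
  rw [bForm, integral_congr_ae (g := fun x => ∑ i,
    w i * (𝒯.hat i x * g x * ⟪b x, outwardNormal Ω x⟫)),
    integral_finsetSum _ fun i _ => hint i, ← Finset.sum_neg_distrib]
  · refine Finset.sum_congr rfl fun i _ => ?_
    rw [integral_const_mul, bVec, bForm]; ring
  · refine Eventually.of_forall fun x => ?_
    simp only [fe, Finset.sum_mul]
    exact Finset.sum_congr rfl fun j _ => by ring

/-! ### Bounds for the matrices -/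

/-- The constant depends on the mesh through the gradients of the hat functions, which is harmless
because it serves existence only. What matters is uniformity in the velocity, hence in time. -/
lemma exists_abs_aMat_le (hd : d ≠ 0) (hreg : interior (closure Ω) = Ω) (M : ℝ) :
    ∃ A : ℝ, ∀ b, IsSolenoidalW1Inf Ω M b → ∀ i j, |𝒯.aMat b i j| ≤ A := by
  have hΩ : IsOpen Ω := hreg ▸ isOpen_interior
  have := 𝒯.isFiniteMeasure_surface hd hreg
  obtain ⟨G, hG0, hG⟩ := 𝒯.norm_gradient_hat_le hΩ
  refine ⟨|M| * G * volume.real Ω + |M| * (surface Ω).real univ, fun b hb i j => ?_⟩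
  rw [aMat, aForm, ← Real.norm_eq_abs]
  refine (norm_sub_le _ _).trans (add_le_add ?_ ?_)
  · refine norm_setIntegral_le_of_norm_le_const_ae 𝒯.volume_domain_lt_top ?_
    filter_upwards [hG j, ae_restrict_mem hΩ.measurableSet] with x hx hxΩ
    rw [norm_mul]
    refine (mul_le_of_le_one_left (norm_nonneg _) (𝒯.abs_hat_le_one i x)).trans ?_
    exact (norm_inner_le_norm _ _).trans (mul_le_mul
      ((hb.2.1 x (subset_closure hxΩ)).trans (le_abs_self M)) hx (norm_nonneg _) (abs_nonneg _))
  · refine (norm_setIntegral_le_of_norm_le_const_ae (C := |M|) (measure_lt_top _ _) ?_).trans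
      (mul_le_mul_of_nonneg_left (measureReal_mono (μ := surface Ω) (subset_univ (inlet Ω b))) (abs_nonneg _))
    filter_upwards [ae_restrict_mem (measurableSet_inlet hΩ hb.1)] with x hx
    rw [norm_mul, norm_mul]
    refine (mul_le_of_le_one_left (norm_nonneg _) ?_).trans (abs_normalVelocity_le hb.2.1 hx.1)
    exact mul_le_one₀ (𝒯.abs_hat_le_one i x) (norm_nonneg _) (𝒯.abs_hat_le_one j x)

lemma abs_bVec_le (hd : d ≠ 0) (hreg : interior (closure Ω) = Ω) (h : IsAdmissible Ω M β b g)
    (i : 𝒯.Node) : |𝒯.bVec b g i| ≤ |β| * |M| * (surface Ω).real univ := by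
  have hΩ : IsOpen Ω := hreg ▸ isOpen_interior
  have := 𝒯.isFiniteMeasure_surface hd hreg
  rw [bVec, bForm, abs_neg, ← Real.norm_eq_abs]
  refine (norm_setIntegral_le_of_norm_le_const_ae (C := |β| * |M|) (measure_lt_top _ _) ?_).trans
    (mul_le_mul_of_nonneg_left (measureReal_mono (μ := surface Ω) (subset_univ (inlet Ω b))) (by positivity))
  filter_upwards [ae_restrict_mem (measurableSet_inlet hΩ h.velocity.1)] with x hx
  rw [norm_mul, norm_mul]
  refine mul_le_mul ?_ (abs_normalVelocity_le h.velocity.2.1 hx.1) (norm_nonneg _) (abs_nonneg _)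
  exact (mul_le_of_le_one_left (norm_nonneg _) (𝒯.abs_hat_le_one i x)).trans
    ((h.bound x (subset_closure hx)).trans (le_abs_self β))

/-! ### Local bounds -/

lemma self_mem_stencil (hΩ : IsOpen Ω) (i : 𝒯.Node) : i ∈ 𝒯.stencil i := by
  simp [stencil, (𝒯.mass_self_pos hΩ i).ne']

lemma mem_stencil_of_mem {i j : 𝒯.Node} (h : j ∈ 𝒯.stencil' i) : j ∈ 𝒯.stencil i := by
  classical
  exact Finset.mem_of_mem_erase h

lemma localValues_abs_le (h : IsAdmissible Ω M β b g) (v : 𝒯.Node → ℝ) (i : 𝒯.Node) {y : ℝ}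
    (hy : y ∈ 𝒯.localValues b g v i) : |y| ≤ ‖v‖ + |β| := by
  rcases hy with ⟨j, -, rfl⟩ | ⟨x, hx, rfl⟩
  · have := norm_le_pi_norm v j
    rw [Real.norm_eq_abs] at this
    linarith [abs_nonneg β]
  · linarith [h.bound x (subset_closure hx.1), le_abs_self β, norm_nonneg v]

lemma bddAbove_localValues (h : IsAdmissible Ω M β b g) (v : 𝒯.Node → ℝ) (i : 𝒯.Node) :
    BddAbove (𝒯.localValues b g v i) :=
  ⟨‖v‖ + |β|, fun _ hy => (le_abs_self _).trans (𝒯.localValues_abs_le h v i hy)⟩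

lemma nonempty_localValues (hΩ : IsOpen Ω) (v : 𝒯.Node → ℝ) (i : 𝒯.Node) :
    (𝒯.localValues b g v i).Nonempty :=
  ⟨v i, Or.inl ⟨i, 𝒯.self_mem_stencil hΩ i, rfl⟩⟩

lemma le_uMax (h : IsAdmissible Ω M β b g) (v : 𝒯.Node → ℝ) {i j : 𝒯.Node}
    (hj : j ∈ 𝒯.stencil i) : v j ≤ 𝒯.uMax b g v i :=
  le_csSup (𝒯.bddAbove_localValues h v i) (Or.inl ⟨j, hj, rfl⟩)

/-- A reflection by which properties of the lower bound are inherited from the upper one; negated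
data remain admissible. -/
lemma uMin_eq (b : E d → E d) (g : E d → ℝ) (v : 𝒯.Node → ℝ) (i : 𝒯.Node) :
    𝒯.uMin b g v i = -𝒯.uMax b (fun x => -g x) (-v) i := by
  rw [uMin, uMax, Real.sInf_def]
  congr 2
  rw [← image_neg_eq_neg, localValues, localValues, image_union, image_image, image_image]
  rfl

lemma uMin_le (h : IsAdmissible Ω M β b g) (v : 𝒯.Node → ℝ) {i j : 𝒯.Node}
    (hj : j ∈ 𝒯.stencil i) : 𝒯.uMin b g v i ≤ v j := by
  rw [uMin_eq]
  have := 𝒯.le_uMax h.neg (-v) hj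
  simp only [Pi.neg_apply] at this
  linarith

lemma abs_uMax_zero_le (hΩ : IsOpen Ω) (h : IsAdmissible Ω M β b g) (i : 𝒯.Node) :
    |𝒯.uMax b g 0 i| ≤ |β| := by
  have h1 : ∀ y ∈ 𝒯.localValues b g 0 i, |y| ≤ |β| := fun y hy => by
    simpa using 𝒯.localValues_abs_le h 0 i hy
  obtain ⟨y, hy⟩ := 𝒯.nonempty_localValues (b := b) (g := g) hΩ 0 i
  rw [abs_le]
  exact ⟨(neg_le_of_abs_le (h1 y hy)).trans (le_csSup (𝒯.bddAbove_localValues h 0 i) hy),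
    csSup_le ⟨y, hy⟩ fun z hz => (le_abs_self z).trans (h1 z hz)⟩

/-- A supremum of coordinates of `v` and of inflow values independent of `v`, each 1-Lipschitz in
the maximum norm. -/
lemma lipschitzWith_uMax (hΩ : IsOpen Ω) (h : IsAdmissible Ω M β b g) (i : 𝒯.Node) :
    LipschitzWith 1 fun v => 𝒯.uMax b g v i := by
  refine LipschitzWith.of_le_add fun v w => ?_
  refine csSup_le (𝒯.nonempty_localValues hΩ v i) ?_
  rintro y (⟨j, hj, rfl⟩ | ⟨x, hx, rfl⟩)
  · have h1 := 𝒯.le_uMax h w hj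
    have h2 := (le_abs_self _).trans (dist_le_pi_dist v w j)
    have h3 := (le_abs_self _).trans (Real.dist_eq (v j) (w j) ▸ dist_le_pi_dist v w j)
    linarith
  · have h1 : g x ≤ 𝒯.uMax b g w i :=
      le_csSup (𝒯.bddAbove_localValues h w i) (Or.inr ⟨x, hx, rfl⟩)
    linarith [dist_nonneg (x := v) (y := w)]

/-! ### Limited fluxes -/

/-- If `d_ij = 0` then `a_ij = 0`, so clearing the denominator is valid in the degenerate case too.
The result is linear in `v` with bounded coefficients. -/
lemma two_mul_dMat_barState (b : E d → E d) (v : 𝒯.Node → ℝ) {i j : 𝒯.Node} (hij : i ≠ j) :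
    2 * 𝒯.dMat b i j * 𝒯.barState b v i j =
      𝒯.dMat b i j * (v i + v j) - 𝒯.aMat b i j * (v j - v i) := by
  rw [barState]
  by_cases h : 𝒯.dMat b i j = 0
  · have : 𝒯.aMat b i j = 0 :=
      abs_nonpos_iff.1 ((𝒯.abs_aMat_le_dMat b hij).trans h.le)
    rw [h, this]; ring
  · field_simp

/-- The bound on the limited flux from above. -/
def fluxUpper (b : E d → E d) (g : E d → ℝ) (v : 𝒯.Node → ℝ) (i j : 𝒯.Node) : ℝ :=
  min (2 * 𝒯.dMat b i j * (𝒯.uMax b g v i - 𝒯.barState b v i j))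
    (2 * 𝒯.dMat b i j * (𝒯.barState b v j i - 𝒯.uMin b g v j))

/-- The bound on the limited flux from below. -/
def fluxLower (b : E d → E d) (g : E d → ℝ) (v : 𝒯.Node → ℝ) (i j : 𝒯.Node) : ℝ :=
  max (2 * 𝒯.dMat b i j * (𝒯.uMin b g v i - 𝒯.barState b v i j))
    (2 * 𝒯.dMat b i j * (𝒯.barState b v j i - 𝒯.uMax b g v j))

/-- The product `2 d_ij ū_ij` equals `(d_ij + a_ij) v_i + (d_ij - a_ij) v_j`, and both weights are
nonnegative because `|a_ij| ≤ d_ij`. -/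
lemma barState_term_nonneg (b : E d → E d) (v : 𝒯.Node → ℝ) {i j : 𝒯.Node} (hij : i ≠ j) {m : ℝ}
    (hi : v i ≤ m) (hj : v j ≤ m) : 0 ≤ 2 * 𝒯.dMat b i j * (m - 𝒯.barState b v i j) := by
  rw [mul_sub, 𝒯.two_mul_dMat_barState b v hij]
  have h := abs_le.1 (𝒯.abs_aMat_le_dMat b hij)
  nlinarith [mul_nonneg (sub_nonneg.2 hi) (by linarith [h.1, h.2] :
    0 ≤ 𝒯.dMat b i j - 𝒯.aMat b i j), mul_nonneg (sub_nonneg.2 hj)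
    (by linarith [h.1, h.2] : 0 ≤ 𝒯.dMat b i j + 𝒯.aMat b i j)]

lemma barState_term_nonpos (b : E d → E d) (v : 𝒯.Node → ℝ) {i j : 𝒯.Node} (hij : i ≠ j) {m : ℝ}
    (hi : m ≤ v i) (hj : m ≤ v j) : 2 * 𝒯.dMat b i j * (m - 𝒯.barState b v i j) ≤ 0 := by
  rw [mul_sub, 𝒯.two_mul_dMat_barState b v hij]
  have h := abs_le.1 (𝒯.abs_aMat_le_dMat b hij)
  nlinarith [mul_nonneg (sub_nonneg.2 hi) (by linarith [h.1, h.2] :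
    0 ≤ 𝒯.dMat b i j - 𝒯.aMat b i j), mul_nonneg (sub_nonneg.2 hj)
    (by linarith [h.1, h.2] : 0 ≤ 𝒯.dMat b i j + 𝒯.aMat b i j)]

lemma fluxUpper_nonneg (hΩ : IsOpen Ω) (h : IsAdmissible Ω M β b g) (v : 𝒯.Node → ℝ)
    {i j : 𝒯.Node} (hj : j ∈ 𝒯.stencil' i) : 0 ≤ 𝒯.fluxUpper b g v i j := by
  have hij : i ≠ j := (𝒯.mem_stencil'_iff.1 hj).1.symm
  have hi := 𝒯.mem_stencil'_comm.1 hj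
  refine le_min (𝒯.barState_term_nonneg b v hij (𝒯.le_uMax h v (𝒯.self_mem_stencil hΩ i))
    (𝒯.le_uMax h v (𝒯.mem_stencil_of_mem hj))) ?_
  have := 𝒯.barState_term_nonpos b v hij.symm (𝒯.uMin_le h v (𝒯.self_mem_stencil hΩ j))
    (𝒯.uMin_le h v (𝒯.mem_stencil_of_mem hi))
  rw [𝒯.dMat_comm b i j hij]
  linarith

lemma fluxLower_nonpos (hΩ : IsOpen Ω) (h : IsAdmissible Ω M β b g) (v : 𝒯.Node → ℝ)
    {i j : 𝒯.Node} (hj : j ∈ 𝒯.stencil' i) : 𝒯.fluxLower b g v i j ≤ 0 := by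
  have hij : i ≠ j := (𝒯.mem_stencil'_iff.1 hj).1.symm
  have hi := 𝒯.mem_stencil'_comm.1 hj
  refine max_le (𝒯.barState_term_nonpos b v hij (𝒯.uMin_le h v (𝒯.self_mem_stencil hΩ i))
    (𝒯.uMin_le h v (𝒯.mem_stencil_of_mem hj))) ?_
  have := 𝒯.barState_term_nonneg b v hij.symm (𝒯.le_uMax h v (𝒯.self_mem_stencil hΩ j))
    (𝒯.le_uMax h v (𝒯.mem_stencil_of_mem hi))
  rw [𝒯.dMat_comm b i j hij]
  linarith

/-- The limited flux is obtained by clamping the target flux. -/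
lemma mclFlux_eq_clamp (hΩ : IsOpen Ω) (h : IsAdmissible Ω M β b g) (v v' : 𝒯.Node → ℝ)
    {i j : 𝒯.Node} (hj : j ∈ 𝒯.stencil' i) :
    𝒯.mclFlux b g v v' i j =
      max (𝒯.fluxLower b g v i j) (min (𝒯.flux b v v' i j) (𝒯.fluxUpper b g v i j)) := by
  have hu := 𝒯.fluxUpper_nonneg hΩ h v hj
  have hl := 𝒯.fluxLower_nonpos hΩ h v hj
  rw [mclFlux]
  split_ifs with hf
  -- The lower bound is at most zero and the upper one at least zero, so for either sign of the
  -- target flux the bound missing from the definition is inactive.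
  · exact (max_eq_right (hl.trans (le_min hf hu))).symm
  · rw [min_eq_left ((not_le.1 hf).le.trans hu), max_comm]
    rfl

lemma flux_swap (b : E d → E d) (v v' : 𝒯.Node → ℝ) {i j : 𝒯.Node} (hij : i ≠ j) :
    𝒯.flux b v v' j i = -𝒯.flux b v v' i j := by
  rw [flux, flux, 𝒯.dMat_comm b i j hij, 𝒯.mass_comm i j]; ring

lemma fluxUpper_swap (b : E d → E d) (g : E d → ℝ) (v : 𝒯.Node → ℝ) {i j : 𝒯.Node} (hij : i ≠ j) :
    𝒯.fluxUpper b g v j i = -𝒯.fluxLower b g v i j := by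
  rw [fluxUpper, fluxLower, 𝒯.dMat_comm b i j hij, ← min_neg_neg, min_comm]
  congr 1 <;> ring

/-- Exchanging the nodes negates the target flux and exchanges the two bounds with a change of sign.
Clamping respects this, since the order of maximum and minimum is irrelevant for ordered bounds. -/
lemma mclFlux_swap (hΩ : IsOpen Ω) (h : IsAdmissible Ω M β b g) (v v' : 𝒯.Node → ℝ)
    {i j : 𝒯.Node} (hj : j ∈ 𝒯.stencil' i) :
    𝒯.mclFlux b g v v' j i = -𝒯.mclFlux b g v v' i j := by
  have hij : i ≠ j := (𝒯.mem_stencil'_iff.1 hj).1.symm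
  have hu := 𝒯.fluxUpper_nonneg hΩ h v hj
  have hl := 𝒯.fluxLower_nonpos hΩ h v hj
  have hl' : 𝒯.fluxLower b g v j i = -𝒯.fluxUpper b g v i j := by
    rw [𝒯.fluxUpper_swap b g v hij.symm, neg_neg]
  rw [𝒯.mclFlux_eq_clamp hΩ h v v' hj, 𝒯.mclFlux_eq_clamp hΩ h v v' (𝒯.mem_stencil'_comm.1 hj),
    𝒯.flux_swap b v v' hij, 𝒯.fluxUpper_swap b g v hij, hl', min_neg_neg, max_neg_neg]
  congr 1
  rcases le_total (𝒯.flux b v v' i j) (𝒯.fluxLower b g v i j) with h1 | h1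
  · rw [max_eq_right h1, min_eq_right (hl.trans hu), min_eq_left (h1.trans (hl.trans hu)),
      max_eq_left h1]
  · rw [max_eq_left h1, max_eq_right (le_min h1 (hl.trans hu)), min_comm]

open Classical in
/-- The correction factors of monolithic convex limiting. -/
def mclFactor (b : E d → E d) (g : E d → ℝ) (v v' : 𝒯.Node → ℝ) (i j : 𝒯.Node) : ℝ :=
  if j ∈ 𝒯.stencil' i then 𝒯.mclFlux b g v v' i j / 𝒯.flux b v v' i j else 0

/-- Clamping to an interval around zero keeps the sign and does not increase the modulus, so the
quotient lies in `[0,1]`; it is symmetric because both fluxes are antisymmetric. -/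
lemma isMCL_mclFactor (hΩ : IsOpen Ω) (h : IsAdmissible Ω M β b g) (v v' : 𝒯.Node → ℝ) :
    𝒯.IsMCL b g v v' (𝒯.mclFactor b g v v') := by
  refine ⟨fun i j => ?_, fun i j hj => ?_⟩
  · by_cases hj : j ∈ 𝒯.stencil' i
    · have hij : i ≠ j := (𝒯.mem_stencil'_iff.1 hj).1.symm
      rw [mclFactor, mclFactor, if_pos hj, if_pos (𝒯.mem_stencil'_comm.1 hj),
        𝒯.flux_swap b v v' hij, 𝒯.mclFlux_swap hΩ h v v' hj, neg_div_neg_eq]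
      have hu := 𝒯.fluxUpper_nonneg hΩ h v hj
      have hl := 𝒯.fluxLower_nonpos hΩ h v hj
      refine ⟨rfl, ?_⟩
      rw [𝒯.mclFlux_eq_clamp hΩ h v v' hj]
      rcases le_or_gt 0 (𝒯.flux b v v' i j) with hf | hf
      · rw [max_eq_right (hl.trans (le_min hf hu))]
        exact ⟨div_nonneg (le_min hf hu) hf, div_le_one_of_le₀ (min_le_left _ _) hf⟩
      · rw [min_eq_left (hf.le.trans hu)]
        exact ⟨div_nonneg_of_nonpos (max_le hl hf.le) hf.le,
          (div_le_one_of_neg hf).2 (le_max_right _ _)⟩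
    · rw [mclFactor, mclFactor, if_neg hj, if_neg fun h' => hj (𝒯.mem_stencil'_comm.1 h')]
      exact ⟨rfl, le_rfl, zero_le_one⟩
  · rw [mclFactor, if_pos hj]
    -- A zero target flux is limited to zero, so the value `0` of the quotient `0 / 0` satisfies the
    -- requirement.
    by_cases hf : 𝒯.flux b v v' i j = 0
    · rw [𝒯.mclFlux_eq_clamp hΩ h v v' hj, hf, min_eq_left (𝒯.fluxUpper_nonneg hΩ h v hj),
        max_eq_right (𝒯.fluxLower_nonpos hΩ h v hj), mul_zero]
    · rw [div_mul_cancel₀ _ hf]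

end FixedTime

end Triangulation

end AFC

end

/-! ### Measurability in time with a moving inlet -/

noncomputable section

namespace AFC

open Filter Topology

lemma aemeasurable_setIntegral_of_continuousOn {α X V : Type*} [MeasurableSpace α] {μ : Measure α}
    [TopologicalSpace X] [TopologicalSpace.MetrizableSpace X] [SecondCountableTopology X]
    [MeasurableSpace X] [BorelSpace X] [TopologicalSpace V]
    [TopologicalSpace.PseudoMetrizableSpace V] [MeasurableSpace V] [BorelSpace V] [Zero V]
    {S : Set X} (hS : MeasurableSet S) {f : α → X → V}
    (hm : ∀ x ∈ S, AEMeasurable (fun t => f t x) μ) (hc : ∀ᵐ t ∂μ, ContinuousOn (f t) S)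
    {ν : Measure X} [IsFiniteMeasure ν] {g : V → X → ℝ} (hg : Measurable (Function.uncurry g)) :
    AEMeasurable (fun t => ∫ x in S, g (f t x) x ∂ν) μ := by
  have h : (fun t => ∫ x in S, g (f t x) x ∂ν) =
      fun t => ∫ y : S, g (f t y) y ∂(Measure.comap Subtype.val ν) :=
    funext fun t => (integral_subtype_comap hS fun x => g (f t x) x).symm
  rw [h]
  refine aemeasurable_integral_of_continuous (f := fun t (y : S) => f t y)
    (g := fun V (y : S) => g V y) (fun y => hm y y.2) ?_
    (hg.comp (measurable_fst.prodMk (measurable_subtype_coe.comp measurable_snd)))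
  filter_upwards [hc] with t ht
  exact continuousOn_iff_continuous_domRestrict.1 ht

/-- The data of the transport problem on the time interval `(0,T)`. -/
structure IsTransportData {d : ℕ} (Ω : Set (E d)) (T M : ℝ) (B : ℝ → ℝ) (a : ℝ → E d → E d)
    (uin : ℝ → E d → ℝ) : Prop where
  velocity : ∀ x ∈ closure Ω, AEMeasurable (fun t => a t x) (volume.restrict (Ioo 0 T))
  inflow : ∀ x ∈ frontier Ω, AEMeasurable (fun t => uin t x)
    (volume.restrict {t | t ∈ Ioo 0 T ∧ x ∈ inlet Ω (a t)})
  memLp : MemLp B 2 (volume.restrict (Ioo 0 T))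
  admissible : ∀ᵐ t ∂(volume.restrict (Ioo 0 T)), IsAdmissible Ω M (B t) (a t) (uin t)

namespace IsTransportData

variable {d : ℕ} {Ω : Set (E d)} {T M : ℝ} {B : ℝ → ℝ} {a : ℝ → E d → E d} {uin : ℝ → E d → ℝ}

lemma neg (h : IsTransportData Ω T M B a uin) :
    IsTransportData Ω T M B a fun t x => -uin t x :=
  ⟨h.velocity, fun x hx => (h.inflow x hx).neg, h.memLp, h.admissible.mono fun _ ht => ht.neg⟩

lemma integrable_bound (h : IsTransportData Ω T M B a uin) :
    Integrable (fun t => |B t|) (volume.restrict (Ioo 0 T)) :=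
  (h.memLp.integrable one_le_two).norm

lemma aemeasurable_normalVelocity (h : IsTransportData Ω T M B a uin) {x : E d}
    (hx : x ∈ frontier Ω) :
    AEMeasurable (fun t => ⟪a t x, outwardNormal Ω x⟫) (volume.restrict (Ioo 0 T)) :=
  (h.velocity x (frontier_subset_closure hx)).inner aemeasurable_const

lemma nullMeasurableSet_inlet (h : IsTransportData Ω T M B a uin) {x : E d}
    (hx : x ∈ frontier Ω) :
    NullMeasurableSet {t | x ∈ inlet Ω (a t)} (volume.restrict (Ioo 0 T)) := by
  have : {t | x ∈ inlet Ω (a t)} = {t | ⟪a t x, outwardNormal Ω x⟫ < 0} := by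
    ext t
    exact ⟨fun ht => ht.2, fun ht => ⟨hx, ht⟩⟩
  rw [this]
  exact nullMeasurableSet_lt (h.aemeasurable_normalVelocity hx) aemeasurable_const

/-- The inflow data at `x` are assumed measurable only over the times at which `x` belongs to the
inlet. The shift by `c` permits a default value other than zero at the remaining times. -/
lemma aemeasurable_indicator (h : IsTransportData Ω T M B a uin) {x : E d} (hx : x ∈ frontier Ω)
    (c : ℝ) : AEMeasurable ({t | x ∈ inlet Ω (a t)}.indicator fun t => uin t x - c)
      (volume.restrict (Ioo 0 T)) := by
  have hZ := h.nullMeasurableSet_inlet hx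
  rw [aemeasurable_indicator_iff₀ hZ, Measure.restrict_restrict₀ hZ, inter_comm]
  exact (h.inflow x hx).sub_const c

end IsTransportData

section Inlet

variable {d : ℕ} {Ω : Set (E d)} {M β : ℝ} {b : E d → E d} {g : E d → ℝ}

/-- The negative part of the normal velocity vanishes off the inlet, so the moving domain of
integration becomes a fixed one with a weight continuous in `x`. -/
lemma setIntegral_inlet (hΩ : IsOpen Ω) (hb : ContinuousOn b (closure Ω)) (φ : E d → ℝ) :
    ∫ x in inlet Ω b, φ x * ⟪b x, outwardNormal Ω x⟫ ∂(surface Ω) =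
      ∫ x in regularBoundary Ω, φ x * min ⟪b x, outwardNormal Ω x⟫ 0 ∂(surface Ω) := by
  classical
  rw [← inter_eq_self_of_subset_right (inlet_subset_regularBoundary b),
    ← setIntegral_indicator (measurableSet_inlet hΩ hb)]
  refine setIntegral_congr_fun (measurableSet_regularBoundary hΩ) fun x hx => ?_
  by_cases h : ⟪b x, outwardNormal Ω x⟫ < 0
  · simp only [indicator_of_mem (show x ∈ inlet Ω b from ⟨regularBoundary_subset hx, h⟩),
      min_eq_left h.le]
  · simp only [indicator_of_notMem (show x ∉ inlet Ω b from fun h' => h h'.2),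
      min_eq_right (not_lt.1 h), mul_zero]

lemma inlet_mem_nhdsWithin (hΩ : IsOpen Ω) (hb : ContinuousOn b (closure Ω)) {x : E d}
    (hx : x ∈ inlet Ω b) : inlet Ω b ∈ 𝓝[regularBoundary Ω] x := by
  filter_upwards [(continuousOn_normalVelocity hΩ hb x (inlet_subset_regularBoundary b hx)).eventually
    (gt_mem_nhds hx.2), self_mem_nhdsWithin] with y hy hyR
  exact ⟨regularBoundary_subset hyR, hy⟩

/-- The inflow values are continuous on the inlet, which is relatively open. Elsewhere the weight is
zero, and near such points the bound on `g` over the inlet squeezes the product to zero. -/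
lemma IsAdmissible.continuousOn_inflow (hΩ : IsOpen Ω) (h : IsAdmissible Ω M β b g) :
    ContinuousOn (fun x => g x * min ⟪b x, outwardNormal Ω x⟫ 0) (regularBoundary Ω) := by
  have hmin : ContinuousOn (fun x => min ⟪b x, outwardNormal Ω x⟫ 0) (regularBoundary Ω) :=
    (continuousOn_normalVelocity hΩ h.velocity.1).inf continuousOn_const
  intro x hx
  by_cases hxi : x ∈ inlet Ω b
  · have hg : ContinuousWithinAt g (regularBoundary Ω) x :=
      ((h.continuousOn.mono subset_closure) x hxi).mono_of_mem_nhdsWithin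
        (inlet_mem_nhdsWithin hΩ h.velocity.1 hxi)
    exact hg.mul (hmin x hx)
  · have hout : ∀ y ∈ regularBoundary Ω, y ∉ inlet Ω b →
        min ⟪b y, outwardNormal Ω y⟫ 0 = 0 := fun y hy hyi =>
      min_eq_right (not_lt.1 fun h' => hyi ⟨regularBoundary_subset hy, h'⟩)
    have hx0 := hout x hx hxi
    rw [ContinuousWithinAt, hx0, mul_zero]
    have hlim : Tendsto (fun y => |β| * |min ⟪b y, outwardNormal Ω y⟫ 0|)
        (𝓝[regularBoundary Ω] x) (𝓝 0) := by
      have := ((hmin x hx).abs).const_mul |β|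
      rw [ContinuousWithinAt, hx0, abs_zero, mul_zero] at this
      exact this
    refine squeeze_zero_norm' ?_ hlim
    filter_upwards [self_mem_nhdsWithin] with y hy
    rw [Real.norm_eq_abs, abs_mul]
    by_cases hyi : y ∈ inlet Ω b
    · exact mul_le_mul_of_nonneg_right ((h.bound y (subset_closure hyi)).trans (le_abs_self β))
        (abs_nonneg _)
    · rw [hout y hy hyi]; simp

end Inlet

namespace Triangulation

section Time

variable {d : ℕ} {Ω : Set (E d)} (𝒯 : Triangulation Ω) {T M : ℝ} {B : ℝ → ℝ} {a : ℝ → E d → E d}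
  {uin : ℝ → E d → ℝ}

/-! ### Measurability in time -/

lemma aemeasurable_aMat (hd : d ≠ 0) (hreg : interior (closure Ω) = Ω)
    (h : IsTransportData Ω T M B a uin) (i j : 𝒯.Node) :
    AEMeasurable (fun t => 𝒯.aMat (a t) i j) (volume.restrict (Ioo 0 T)) := by
  have hΩ : IsOpen Ω := hreg ▸ isOpen_interior
  have := 𝒯.isFiniteMeasure_surface hd hreg
  have : IsFiniteMeasure (volume.restrict Ω) :=
    ⟨by rw [Measure.restrict_apply_univ]; exact 𝒯.volume_domain_lt_top⟩
  simp only [aMat, aForm]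
  refine AEMeasurable.sub ?_ ?_
  · have h1 := aemeasurable_setIntegral_of_continuousOn (μ := volume.restrict (Ioo 0 T))
      (ν := volume.restrict Ω) hΩ.measurableSet (f := a)
      (g := fun V x => 𝒯.hat i x * ⟪V, gradient (𝒯.hat j) x⟫)
      (fun x hx => h.velocity x (subset_closure hx))
      (h.admissible.mono fun t ht => ht.velocity.1.mono subset_closure)
      (((𝒯.measurable_hat i).comp measurable_snd).mul
        (measurable_fst.inner ((measurable_gradient _).comp measurable_snd)))
    simpa only [Measure.restrict_restrict hΩ.measurableSet, inter_self] using h1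
  · refine (aemeasurable_setIntegral_of_continuousOn (μ := volume.restrict (Ioo 0 T))
      (ν := surface Ω) (measurableSet_regularBoundary hΩ)
      (f := fun t x => ⟪a t x, outwardNormal Ω x⟫)
      (g := fun V x => 𝒯.hat i x * 𝒯.hat j x * min V 0)
      (fun x hx => h.aemeasurable_normalVelocity (regularBoundary_subset hx))
      (h.admissible.mono fun t ht => continuousOn_normalVelocity hΩ ht.velocity.1)
      ((((𝒯.measurable_hat i).comp measurable_snd).mul
        ((𝒯.measurable_hat j).comp measurable_snd)).mul
        (measurable_fst.min measurable_const))).congr ?_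
    filter_upwards [h.admissible] with t ht
    exact (setIntegral_inlet hΩ ht.velocity.1 fun x => 𝒯.hat i x * 𝒯.hat j x).symm

lemma aemeasurable_bVec (hd : d ≠ 0) (hreg : interior (closure Ω) = Ω)
    (h : IsTransportData Ω T M B a uin) (i : 𝒯.Node) :
    AEMeasurable (fun t => 𝒯.bVec (a t) (uin t) i) (volume.restrict (Ioo 0 T)) := by
  have hΩ : IsOpen Ω := hreg ▸ isOpen_interior
  have := 𝒯.isFiniteMeasure_surface hd hreg
  have hm : ∀ x ∈ regularBoundary Ω, AEMeasurable
      (fun t => uin t x * min ⟪a t x, outwardNormal Ω x⟫ 0) (volume.restrict (Ioo 0 T)) := by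
    intro x hx
    have hxf := regularBoundary_subset hx
    refine ((h.aemeasurable_indicator hxf 0).mul
      ((h.aemeasurable_normalVelocity hxf).min (aemeasurable_const (b := (0 : ℝ))))).congr
      (Eventually.of_forall fun t => ?_)
    by_cases ht : x ∈ inlet Ω (a t)
    · simp [indicator_of_mem (show t ∈ {t | x ∈ inlet Ω (a t)} from ht)]
    · simp [min_eq_right (not_lt.1 fun h' => ht ⟨hxf, h'⟩)]
  simp only [bVec, bForm]
  refine ((aemeasurable_setIntegral_of_continuousOn (μ := volume.restrict (Ioo 0 T))
    (ν := surface Ω) (measurableSet_regularBoundary hΩ)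
    (f := fun t x => uin t x * min ⟪a t x, outwardNormal Ω x⟫ 0)
    (g := fun V x => 𝒯.hat i x * V) hm
    (h.admissible.mono fun t ht => ht.continuousOn_inflow hΩ)
    (((𝒯.measurable_hat i).comp measurable_snd).mul measurable_fst)).congr ?_).neg
  filter_upwards [h.admissible] with t ht
  rw [setIntegral_inlet hΩ ht.velocity.1 fun x => 𝒯.hat i x * uin t x]
  simp only [mul_assoc]

lemma inletAt_mem_nhdsWithin (hΩ : IsOpen Ω) {b : E d → E d} (hb : ContinuousOn b (closure Ω))
    {i : 𝒯.Node} {x : E d} (hx : x ∈ 𝒯.inletAt b i) :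
    𝒯.inletAt b i ∈ 𝓝[regularBoundary Ω] x := by
  have h1 := ((𝒯.continuousOn_hat i).mono
    (regularBoundary_subset.trans frontier_subset_closure)) x (inlet_subset_regularBoundary b hx.1)
  filter_upwards [inlet_mem_nhdsWithin hΩ hb hx.1, h1.eventually (isOpen_ne.mem_nhds hx.2)]
    with y hy hy' using ⟨hy, hy'⟩

open Classical in
/-- The local upper bound is a supremum over a fixed countable set of boundary points. -/
lemma uMax_eq_iSup (hΩ : IsOpen Ω) {β : ℝ} {b : E d → E d} {g : E d → ℝ}
    (h : IsAdmissible Ω M β b g) (v : 𝒯.Node → ℝ) (i : 𝒯.Node) {D : Set (regularBoundary Ω)}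
    (hD : Dense D) :
    𝒯.uMax b g v i = ⨆ o : Option D, o.elim (sSup (v '' {j | j ∈ 𝒯.stencil i}))
      fun x => if (x : E d) ∈ 𝒯.inletAt b i then g x else sSup (v '' {j | j ∈ 𝒯.stencil i}) := by
  -- The largest nodal value fills the index `none` and the points outside the inlet; it never
  -- exceeds the upper bound, so it does not change the supremum.
  set V := sSup (v '' {j | j ∈ 𝒯.stencil i}) with hV
  set φ : Option D → ℝ := fun o => o.elim V fun x => if (x : E d) ∈ 𝒯.inletAt b i then g x else V
  have hVle : V ≤ 𝒯.uMax b g v i := by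
    refine csSup_le ⟨v i, i, 𝒯.self_mem_stencil hΩ i, rfl⟩ ?_
    rintro y ⟨j, hj, rfl⟩
    exact 𝒯.le_uMax h v hj
  have hφ : ∀ o, φ o ≤ 𝒯.uMax b g v i := by
    rintro (_ | x)
    · exact hVle
    · simp only [φ, Option.elim]
      split_ifs with hx
      · exact le_csSup (𝒯.bddAbove_localValues h v i) (Or.inr ⟨_, hx, rfl⟩)
      · exact hVle
  have hbdd : BddAbove (range φ) := ⟨_, by rintro _ ⟨o, rfl⟩; exact hφ o⟩
  refine le_antisymm (csSup_le (𝒯.nonempty_localValues hΩ v i) ?_) (ciSup_le hφ)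
  rintro y (⟨j, hj, rfl⟩ | ⟨x, hx, rfl⟩)
  · refine le_trans ?_ (le_ciSup hbdd none)
    exact le_csSup ((Set.toFinite _).image v).bddAbove ⟨j, hj, rfl⟩
  -- An inflow value above the countable supremum would stay above it on a relatively open set,
  -- which contains a point of the dense set `D`.
  · by_contra hlt
    rw [not_le] at hlt
    have hxR := inlet_subset_regularBoundary b hx.1
    have hnhds := 𝒯.inletAt_mem_nhdsWithin hΩ h.velocity.1 hx
    have hg : ContinuousWithinAt g (regularBoundary Ω) x :=
      ((h.continuousOn.mono subset_closure) x hx.1).mono_of_mem_nhdsWithin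
        (inlet_mem_nhdsWithin hΩ h.velocity.1 hx.1)
    have hev : ∀ᶠ y in 𝓝[regularBoundary Ω] x, y ∈ 𝒯.inletAt b i ∧ ⨆ o, φ o < g y :=
      (eventually_mem_set.2 hnhds).and (hg.eventually (lt_mem_nhds hlt))
    rw [nhdsWithin_eq_map_subtype_coe hxR, eventually_map] at hev
    obtain ⟨y, hyD, hy1, hy2⟩ := (hD.inter_nhds_nonempty hev)
    have hle := le_ciSup hbdd (some ⟨y, hyD⟩)
    simp only [φ, Option.elim, if_pos hy1] at hle
    exact absurd hy2 (not_lt.2 hle)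

lemma aemeasurable_uMax (hΩ : IsOpen Ω) (h : IsTransportData Ω T M B a uin) (v : 𝒯.Node → ℝ)
    (i : 𝒯.Node) :
    AEMeasurable (fun t => 𝒯.uMax (a t) (uin t) v i) (volume.restrict (Ioo 0 T)) := by
  classical
  obtain ⟨D, hDc, hD⟩ := TopologicalSpace.exists_countable_dense (regularBoundary Ω)
  have := hDc.to_subtype
  set V := sSup (v '' {j | j ∈ 𝒯.stencil i}) with hV
  refine (AEMeasurable.iSup (ι := Option D) (f := fun o t => o.elim V
    fun x => if (x : E d) ∈ 𝒯.inletAt (a t) i then uin t x else V) ?_).congr ?_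
  · rintro (_ | x)
    · exact aemeasurable_const
    · simp only [Option.elim]
      by_cases hx : 𝒯.hat i x = 0
      · simp only [inletAt, mem_ofPred_eq, hx, ne_eq, not_true_eq_false, and_false, if_false]
        exact aemeasurable_const
      · refine ((h.aemeasurable_indicator (regularBoundary_subset (x : regularBoundary Ω).2)
          V).add_const V).congr (Eventually.of_forall fun t => ?_)
        by_cases ht : ((x : regularBoundary Ω) : E d) ∈ inlet Ω (a t)
        · simp [inletAt, hx, ht, indicator]
        · simp [inletAt, ht, indicator]
  · filter_upwards [h.admissible] with t ht
    exact (𝒯.uMax_eq_iSup hΩ ht v i hD).symm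

end Time

end Triangulation

end AFC

end

/-! ### The limited scheme as a Carathéodory equation -/

noncomputable section

namespace AFC

open Filter Topology

namespace Triangulation

section Existence

variable {d : ℕ} {Ω : Set (E d)} (𝒯 : Triangulation Ω) {T M : ℝ} {B : ℝ → ℝ} {a : ℝ → E d → E d}
  {uin : ℝ → E d → ℝ}

/-! ### The right-hand side of the limited scheme -/

lemma dMat_aemeasurable_bounded (hd : d ≠ 0) (hreg : interior (closure Ω) = Ω)
    (h : IsTransportData Ω T M B a uin) :
    ∃ A : ℝ, ∀ i j, i ≠ j →
      AEMeasurable (fun t => 𝒯.dMat (a t) i j) (volume.restrict (Ioo 0 T)) ∧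
      ∀ᵐ t ∂(volume.restrict (Ioo 0 T)), |𝒯.dMat (a t) i j| ≤ A := by
  obtain ⟨A, hA⟩ := 𝒯.exists_abs_aMat_le hd hreg M
  refine ⟨A, fun i j hij => ⟨?_, ?_⟩⟩
  · simp only [𝒯.dMat_of_ne _ hij]
    exact (𝒯.aemeasurable_aMat hd hreg h i j).abs.max (𝒯.aemeasurable_aMat hd hreg h j i).abs
  · filter_upwards [h.admissible] with t ht
    rw [𝒯.dMat_of_ne _ hij, abs_of_nonneg (le_max_of_le_left (abs_nonneg _))]
    exact max_le (hA _ ht.velocity i j) (hA _ ht.velocity j i)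

lemma aMat_mul_isCaratheodory (hd : d ≠ 0) (hreg : interior (closure Ω) = Ω)
    (h : IsTransportData Ω T M B a uin) (i j : 𝒯.Node) {f : ℝ → (𝒯.Node → ℝ) → ℝ}
    (hf : IsCaratheodory (volume.restrict (Ioo 0 T)) f) :
    IsCaratheodory (volume.restrict (Ioo 0 T)) fun t v => 𝒯.aMat (a t) i j * f t v := by
  obtain ⟨A, hA⟩ := 𝒯.exists_abs_aMat_le hd hreg M
  exact hf.coef_mul (𝒯.aemeasurable_aMat hd hreg h i j)
    (h.admissible.mono fun t ht => hA _ ht.velocity i j)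

lemma dMat_mul_isCaratheodory (hd : d ≠ 0) (hreg : interior (closure Ω) = Ω)
    (h : IsTransportData Ω T M B a uin) {i j : 𝒯.Node} (hij : i ≠ j) {f : ℝ → (𝒯.Node → ℝ) → ℝ}
    (hf : IsCaratheodory (volume.restrict (Ioo 0 T)) f) :
    IsCaratheodory (volume.restrict (Ioo 0 T)) fun t v => 𝒯.dMat (a t) i j * f t v := by
  obtain ⟨A, hA⟩ := 𝒯.dMat_aemeasurable_bounded hd hreg h
  exact hf.coef_mul (hA i j hij).1 (hA i j hij).2

lemma bVec_isCaratheodory (hd : d ≠ 0) (hreg : interior (closure Ω) = Ω)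
    (h : IsTransportData Ω T M B a uin) (i : 𝒯.Node) :
    IsCaratheodory (volume.restrict (Ioo 0 T)) fun t (_ : 𝒯.Node → ℝ) =>
      𝒯.bVec (a t) (uin t) i := by
  refine IsCaratheodory.of_integrable (Integrable.mono'
    (h.integrable_bound.mul_const |M| |>.mul_const ((surface Ω).real univ))
    (𝒯.aemeasurable_bVec hd hreg h i).aestronglyMeasurable ?_)
  filter_upwards [h.admissible] with t ht using 𝒯.abs_bVec_le hd hreg ht i

lemma uMax_isCaratheodory (hΩ : IsOpen Ω) (h : IsTransportData Ω T M B a uin) (i : 𝒯.Node) :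
    IsCaratheodory (volume.restrict (Ioo 0 T)) fun t v => 𝒯.uMax (a t) (uin t) v i :=
  ⟨fun v => 𝒯.aemeasurable_uMax hΩ h v i,
    ⟨1, h.admissible.mono fun _ ht => 𝒯.lipschitzWith_uMax hΩ ht i⟩, fun t => |B t|,
    h.integrable_bound, h.admissible.mono fun _ ht => 𝒯.abs_uMax_zero_le hΩ ht i⟩

lemma uMin_isCaratheodory (hΩ : IsOpen Ω) (h : IsTransportData Ω T M B a uin) (i : 𝒯.Node) :
    IsCaratheodory (volume.restrict (Ioo 0 T)) fun t v => 𝒯.uMin (a t) (uin t) v i := by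
  simp only [uMin_eq]
  obtain ⟨h1, ⟨K, h2⟩, k, h3, h4⟩ := 𝒯.uMax_isCaratheodory hΩ h.neg i
  refine IsCaratheodory.neg ⟨fun v => h1 (-v), ⟨K, ?_⟩, k, h3, ?_⟩
  · filter_upwards [h2] with t ht
    refine LipschitzWith.of_dist_le_mul fun v w => ?_
    simpa [dist_neg_neg] using ht.dist_le_mul (-v) (-w)
  · simpa using h4

lemma rate_isCaratheodory (hd : d ≠ 0) (hreg : interior (closure Ω) = Ω)
    (h : IsTransportData Ω T M B a uin) (ω : ℝ) (i : 𝒯.Node) :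
    IsCaratheodory (volume.restrict (Ioo 0 T)) fun t v => 𝒯.rate ω (a t) (uin t) v i := by
  refine IsCaratheodory.add (IsCaratheodory.const_mul (IsCaratheodory.sub
    (𝒯.bVec_isCaratheodory hd hreg h i) (IsCaratheodory.sum _ fun j _ =>
      𝒯.aMat_mul_isCaratheodory hd hreg h i j (IsCaratheodory.coord j))) _)
    (IsCaratheodory.const_mul (IsCaratheodory.sum _ fun j hj => ?_) _)
  exact 𝒯.dMat_mul_isCaratheodory hd hreg h (𝒯.mem_stencil'_iff.1 hj).1.symm
    ((IsCaratheodory.coord j).sub (IsCaratheodory.coord i))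

lemma dMat_mul_sub_barState_isCaratheodory (hd : d ≠ 0) (hreg : interior (closure Ω) = Ω)
    (h : IsTransportData Ω T M B a uin) {i j : 𝒯.Node} (hij : i ≠ j) {f : ℝ → (𝒯.Node → ℝ) → ℝ}
    (hf : IsCaratheodory (volume.restrict (Ioo 0 T)) f) :
    IsCaratheodory (volume.restrict (Ioo 0 T)) fun t v =>
      2 * 𝒯.dMat (a t) i j * (f t v - 𝒯.barState (a t) v i j) := by
  refine IsCaratheodory.congr (f := fun t v => 2 * (𝒯.dMat (a t) i j * f t v) -
    (𝒯.dMat (a t) i j * (v i + v j) - 𝒯.aMat (a t) i j * (v j - v i))) ?_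
    (Eventually.of_forall fun t => funext fun v => ?_)
  · exact ((𝒯.dMat_mul_isCaratheodory hd hreg h hij hf).const_mul 2).sub
      ((𝒯.dMat_mul_isCaratheodory hd hreg h hij
        ((IsCaratheodory.coord i).add (IsCaratheodory.coord j))).sub
      (𝒯.aMat_mul_isCaratheodory hd hreg h i j
        ((IsCaratheodory.coord j).sub (IsCaratheodory.coord i))))
  · linear_combination 𝒯.two_mul_dMat_barState (a t) v hij

lemma fluxUpper_isCaratheodory (hd : d ≠ 0) (hreg : interior (closure Ω) = Ω)
    (h : IsTransportData Ω T M B a uin) {i j : 𝒯.Node} (hij : i ≠ j) :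
    IsCaratheodory (volume.restrict (Ioo 0 T)) fun t v =>
      𝒯.fluxUpper (a t) (uin t) v i j := by
  have hΩ : IsOpen Ω := hreg ▸ isOpen_interior
  refine (𝒯.dMat_mul_sub_barState_isCaratheodory hd hreg h hij
    (𝒯.uMax_isCaratheodory hΩ h i)).min
    ((𝒯.dMat_mul_sub_barState_isCaratheodory hd hreg h hij.symm
    (𝒯.uMin_isCaratheodory hΩ h j)).neg.congr (Eventually.of_forall fun t => funext fun v => ?_))
  rw [𝒯.dMat_comm (a t) i j hij]; ring

lemma fluxLower_isCaratheodory (hd : d ≠ 0) (hreg : interior (closure Ω) = Ω)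
    (h : IsTransportData Ω T M B a uin) {i j : 𝒯.Node} (hij : i ≠ j) :
    IsCaratheodory (volume.restrict (Ioo 0 T)) fun t v =>
      𝒯.fluxLower (a t) (uin t) v i j :=
  (𝒯.fluxUpper_isCaratheodory hd hreg h hij.symm).neg.congr (Eventually.of_forall fun t =>
    funext fun v => by rw [𝒯.fluxUpper_swap _ _ v hij, neg_neg])

/-- The definition by cases shows no continuity across a vanishing target flux. The clamped form is
a maximum and minimum of Carathéodory functions. -/
lemma mclFlux_isCaratheodory (hd : d ≠ 0) (hreg : interior (closure Ω) = Ω)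
    (h : IsTransportData Ω T M B a uin) (ω : ℝ) {i j : 𝒯.Node} (hj : j ∈ 𝒯.stencil' i) :
    IsCaratheodory (volume.restrict (Ioo 0 T)) fun t v =>
      𝒯.mclFlux (a t) (uin t) v (𝒯.rate ω (a t) (uin t) v) i j := by
  have hΩ : IsOpen Ω := hreg ▸ isOpen_interior
  have hij : i ≠ j := (𝒯.mem_stencil'_iff.1 hj).1.symm
  have hflux : IsCaratheodory (volume.restrict (Ioo 0 T)) fun t v =>
      𝒯.flux (a t) v (𝒯.rate ω (a t) (uin t) v) i j :=
    (𝒯.dMat_mul_isCaratheodory hd hreg h hij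
      ((IsCaratheodory.coord i).sub (IsCaratheodory.coord j))).add
    (((𝒯.rate_isCaratheodory hd hreg h ω i).sub
      (𝒯.rate_isCaratheodory hd hreg h ω j)).const_mul (𝒯.mass i j))
  refine ((𝒯.fluxLower_isCaratheodory hd hreg h hij).max
    (hflux.min (𝒯.fluxUpper_isCaratheodory hd hreg h hij))).congr ?_
  filter_upwards [h.admissible] with t ht
  exact funext fun v => (𝒯.mclFlux_eq_clamp hΩ ht v _ hj).symm

/-- The time derivative of the nodal values in the scheme with monolithic convex limiting. -/
def mclRhs (ω : ℝ) (b : E d → E d) (g : E d → ℝ) (v : 𝒯.Node → ℝ) (i : 𝒯.Node) : ℝ :=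
  (𝒯.lumped i)⁻¹ * (𝒯.bVec b g i - ∑ j, 𝒯.aMat b i j * v j
    - ∑ j ∈ 𝒯.stencil' i, 𝒯.dMat b i j * (v i - v j)
    + ∑ j ∈ 𝒯.stencil' i, 𝒯.mclFlux b g v (𝒯.rate ω b g v) i j)

lemma mclRhs_isCaratheodory (hd : d ≠ 0) (hreg : interior (closure Ω) = Ω)
    (h : IsTransportData Ω T M B a uin) (ω : ℝ) (i : 𝒯.Node) :
    IsCaratheodory (volume.restrict (Ioo 0 T)) fun t v => 𝒯.mclRhs ω (a t) (uin t) v i := by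
  refine IsCaratheodory.const_mul (IsCaratheodory.add (IsCaratheodory.sub (IsCaratheodory.sub
    (𝒯.bVec_isCaratheodory hd hreg h i) (IsCaratheodory.sum _ fun j _ =>
      𝒯.aMat_mul_isCaratheodory hd hreg h i j (IsCaratheodory.coord j)))
    (IsCaratheodory.sum _ fun j hj => ?_))
    (IsCaratheodory.sum _ fun j hj => 𝒯.mclFlux_isCaratheodory hd hreg h ω hj)) _
  exact 𝒯.dMat_mul_isCaratheodory hd hreg h (𝒯.mem_stencil'_iff.1 hj).1.symm
    ((IsCaratheodory.coord i).sub (IsCaratheodory.coord j))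

/-- The identity `f*_ij = α_ij f_ij`, with the same factors in both forms, merges the anti-diffusive
part of `d_h` and the mass correction into the limited flux. The factors therefore drop out of the
ODE. -/
lemma mclRhs_weak (hd : d ≠ 0) (hreg : interior (closure Ω) = Ω) {β : ℝ} {b : E d → E d}
    {g : E d → ℝ} (h : IsAdmissible Ω M β b g) (ω : ℝ) {v : 𝒯.Node → ℝ}
    {α : 𝒯.Node → 𝒯.Node → ℝ} (hα : 𝒯.IsMCL b g v (𝒯.rate ω b g v) α) (w : 𝒯.Node → ℝ) :
    ∑ i, w i * 𝒯.lumped i * 𝒯.mclRhs ω b g v i + aForm Ω b (𝒯.fe v) (𝒯.fe w) + 𝒯.dForm b α v w =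
      bForm Ω b g (𝒯.fe w) + 𝒯.mForm α (𝒯.rate ω b g v) w := by
  have hΩ : IsOpen Ω := hreg ▸ isOpen_interior
  rw [𝒯.aForm_fe hd hreg h.velocity, 𝒯.bForm_fe hd hreg h, dForm, mForm, ← Finset.sum_add_distrib,
    ← Finset.sum_add_distrib, ← Finset.sum_add_distrib]
  refine Finset.sum_congr rfl fun i _ => ?_
  have h1 : ∑ j ∈ 𝒯.stencil' i, 𝒯.mclFlux b g v (𝒯.rate ω b g v) i j =
      ∑ j ∈ 𝒯.stencil' i, 𝒯.dMat b i j * (v i - v j)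
      - ∑ j ∈ 𝒯.stencil' i, (1 - α i j) * 𝒯.dMat b i j * (v i - v j)
      + ∑ j ∈ 𝒯.stencil' i, α i j * 𝒯.mass i j * (𝒯.rate ω b g v i - 𝒯.rate ω b g v j) := by
    rw [← Finset.sum_sub_distrib, ← Finset.sum_add_distrib]
    refine Finset.sum_congr rfl fun j hj => ?_
    rw [hα.2 i j hj, flux]; ring
  have h2 := (𝒯.lumped_pos hΩ i).ne'
  rw [mclRhs, h1, mul_assoc, mul_inv_cancel_left₀ h2]
  ring

/-- Global existence for monolithic convex limiting. -/
lemma exists_mcl_solution (hd : d ≠ 0) (hreg : interior (closure Ω) = Ω) (hT : 0 < T)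
    (h : IsTransportData Ω T M B a uin) (u0 : E d → ℝ) (ω : ℝ) :
    ∃ (α : ℝ → 𝒯.Node → 𝒯.Node → ℝ) (u' u : ℝ → 𝒯.Node → ℝ),
      (∀ᵐ t ∂(volume.restrict (Ioo 0 T)), u' t = 𝒯.rate ω (a t) (uin t) (u t) ∧
        𝒯.IsMCL (a t) (uin t) (u t) (u' t) (α t)) ∧
      𝒯.IsSolution a uin u0 T α α u' u := by
  have hΩ : IsOpen Ω := hreg ▸ isOpen_interior
  obtain ⟨u, hac, hu0, hder⟩ := exists_caratheodory_solution hT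
    (F := fun t v i => 𝒯.mclRhs ω (a t) (uin t) v i)
    (fun i => 𝒯.mclRhs_isCaratheodory hd hreg h ω i) fun i => u0 i
  -- The equation was solved in terms of limited fluxes; correction factors and `u̇` are read off
  -- the solution afterwards.
  refine ⟨fun t => 𝒯.mclFactor (a t) (uin t) (u t) (𝒯.rate ω (a t) (uin t) (u t)),
    fun t => 𝒯.rate ω (a t) (uin t) (u t), u, ?_, ?_, ?_, ?_, ?_⟩
  · filter_upwards [h.admissible] with t ht using ⟨rfl, 𝒯.isMCL_mclFactor hΩ ht _ _⟩
  · intro i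
    have := (hac i).continuousOn
    rw [uIcc_of_le hT.le] at this
    exact this.mono Ico_subset_Icc_self
  · intro i s t hs hst ht
    refine (hac i).mono ?_
    rw [uIcc_of_le hst, uIcc_of_le hT.le]
    exact Icc_subset_Icc hs.le ht.le
  · intro i
    rw [hu0]
  · filter_upwards [h.admissible, hder] with t ht htd w
    simp only [fun i => (htd i).deriv]
    exact 𝒯.mclRhs_weak hd hreg ht ω (𝒯.isMCL_mclFactor hΩ ht _ _) w

end Existence

end Triangulation

end AFC

end

/-! ### Stability and global existence -/

theorem theorem1 {d : ℕ} (hd : d = 1 ∨ d = 2 ∨ d = 3) {T : ℝ} (hT : 0 < T)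
    {Ω : Set (AFC.E d)} (hΩ : AFC.IsPolytopalDomain Ω)
    {a : ℝ → AFC.E d → AFC.E d} (ha : AFC.IsVelocity Ω T a)
    {uin : ℝ → AFC.E d → ℝ} (huin : AFC.IsInflowData Ω T a uin)
    {u0 : AFC.E d → ℝ} (hu0 : ContinuousOn u0 (closure Ω)) :
    ∃ C : ℝ≥0, ∀ (h : ℝ) (𝒯 : AFC.Triangulation Ω), 0 < h →
      (∀ K ∈ 𝒯.cells, Metric.diam (convexHull ℝ (K : Set (AFC.E d))) ≤ h) →
      -- stability, on every time interval `[0,τ)` of existence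
      (∀ γ ∈ Ioo (0 : ℝ) 1, ∀ τ ∈ Ioc 0 T,
        ∀ (α β : ℝ → 𝒯.Node → 𝒯.Node → ℝ) (u' u : ℝ → 𝒯.Node → ℝ),
          (∀ᵐ t ∂(volume.restrict (Ioo 0 τ)), 𝒯.IsCorrection (α t) ∧ 𝒯.IsCorrection (β t)) →
          𝒯.IsSolution a uin u0 τ α β u' u →
          (∀ᵐ t ∂(volume.restrict (Ioo 0 τ)),
            𝒯.GCC γ h (AFC.maxSpeed Ω T a) (a t) (α t) (β t) (u' t) (u t)) →
          ∀ t ∈ Ico 0 τ, eLpNorm (𝒯.fe (u t)) 2 (volume.restrict Ω) ≤ C) ∧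
      -- global existence for monolithic convex limiting
      (∀ ω ∈ Icc (0 : ℝ) 1,
        ∃ (α : ℝ → 𝒯.Node → 𝒯.Node → ℝ) (u' u : ℝ → 𝒯.Node → ℝ),
          (∀ᵐ t ∂(volume.restrict (Ioo 0 T)),
            u' t = 𝒯.rate ω (a t) (uin t) (u t) ∧
            𝒯.IsMCL (a t) (uin t) (u t) (u' t) (α t)) ∧
          𝒯.IsSolution a uin u0 T α α u' u) := by
  have hd0 : d ≠ 0 := by rcases hd with rfl | rfl | rfl <;> decide
  have hreg := hΩ.lipschitz.interior_closure hΩ.isOpen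
  obtain ⟨S, hS⟩ := hΩ.polytopal
  -- Compactness is taken from the polytopal structure and not from a mesh, so the bound on `u0` is
  -- fixed before any triangulation is given.
  have hcompact : IsCompact (closure Ω) := by
    rw [hS]
    exact S.finite_toSet.isCompact_biUnion fun P _ => P.finite_toSet.isCompact_convexHull ℝ
  obtain ⟨U, hU⟩ := hcompact.exists_bound_of_continuousOn hu0
  obtain ⟨ham, M, hM⟩ := ha
  obtain ⟨hum, B, hB, hBb⟩ := huin
  have hdata : AFC.IsTransportData Ω T M B a uin := by
    refine ⟨ham, hum, hB, ?_⟩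
    filter_upwards [hM, hBb] with t h1 h2 using ⟨h1, h2.1, h2.2⟩
  -- The first term bounds the lumped energy of the interpolated initial data, since the lumped
  -- masses sum to the volume of `Ω`; the second is the energy that can enter through the inlet.
  refine ⟨(√(U ^ 2 * (volume Ω).toReal +
    |M| * (AFC.surface Ω univ).toReal * ∫ s in Ioo 0 T, B s ^ 2)).toNNReal,
    fun h 𝒯 hh _ => ⟨?_, fun ω _ => 𝒯.exists_mcl_solution hd0 hreg hT hdata u0 ω⟩⟩
  intro γ hγ τ hτ α β u' u hαβ hsol hgcc t ht
  exact 𝒯.eLpNorm_fe_le hΩ.isOpen (u t) (𝒯.energy_le hd0 hreg hM hB hBb hU hγ hh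
    ENNReal.toReal_nonneg hτ hαβ hsol hgcc ht)
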